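/- Let $\Omega\subset\mathbb R^2=\mathbb C$ be a bounded convex open domain whose boundary is a $C^\infty$ closed curve of length $\ell$ with strictly positive curvature, and let $\gamma:\mathbb T_\ell=\mathbb R/\ell\mathbb Z\to\partial\Omega$ be its positively oriented arc-length parametrization. Let $f:\mathbb T_\ell\times[0,\pi]\to\mathbb T_\ell\times[0,\pi]$, $(s,\varphi)\mapsto(s',\varphi')$, be the billiard map in Birkhoff coordinates ($s$ is the arc-length parameter of the collision point, $\varphi$ the angle between the outgoing trajectory and the positive tangent; $f$ is the identity on $\{\varphi=0\}\cup\{\varphi=\pi\}$). Put $\mathbb T=\mathbb R/\mathbb Z$ and $\mathbb A_\varepsilon=\mathbb T\times(-\varepsilon,\varepsilon)$, and let $k\ge 1$ be an integer. A \emph{Lazutkin change of coordinates of order $k$} is a map $\Psi=(X,Y)$ of the form $$X(s,\varphi)=\sum_{j=0}^{k-1}X_j(s)\varphi^{2j},\qquad Y(s,\varphi)=\sum_{j=0}^{k}Y_j(s)\varphi^{2j+1},$$ with smooth $X_0:\mathbb T_\ell\to\mathbb T$ and smooth $X_j:\mathbb T_\ell\to\mathbb R$ ($1\le j\le k-1$),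 $Y_j:\mathbb T_\ell\to\mathbb R$ ($0\le j\le k$), which restricts to a diffeomorphism from an open neighbourhood $U$ of $\{\varphi=0\}$ in $\mathbb T_\ell\times[0,\pi]$ onto an open neighbourhood $V$ of $\mathbb T\times\{0\}$ in $\mathbb T\times[0,\varepsilon)$, for some $\varepsilon>0$, and conjugates $f$ to a map of the form $(x,y)\mapsto(x+y,y)+O(y^{2k+2})$ as $y\to0$, uniformly in $x$ (wherever $\Psi\circ f\circ\Psi^{-1}$ is defined). For points $z_-,z_0,z_+\in\partial\Omega$ with $z_\pm\neq z_0$, let $\varphi^+$ (resp. $\varphi^-$) be the angle between the vector $z_+-z_0$ (resp. $z_--z_0$) and the positively (resp. negatively) oriented tangent at $z_0$; the triple $(z_-,z_0,z_+)$ is a \emph{billiard $\varepsilon$-pseudocollision} if $|\varphi^+-\varphi^-|<\varepsilon$. An \emph{angular function of order $k$} on $\mathbb A_\varepsilon$ is a smooth map $Z:\mathbb A_\varepsilon\to\partial\Omega$ such that 1. $Z(\xi,-\eta)=Z(\xi,\eta)$ for all $(\xi,\eta)\in\mathbb A_\varepsilon$; 2. for every $\eta\in(-\varepsilon,\varepsilon)$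 the map $Z(\cdot,\eta):\mathbb T\to\partial\Omega$ is an orientation-preserving diffeomorphism, and $Z(0,\eta)=Z(0,0)$; 3. there are $C,\delta>0$ such that for all $\xi\in\mathbb T$ and all $\eta\in(-\varepsilon,\varepsilon)$ with $0<|\eta|<\delta$ the triple $(Z(\xi-\eta,\eta),Z(\xi,\eta),Z(\xi+\eta,\eta))$ is a billiard $C\eta^{2k+2}$-pseudocollision. Then the following are equivalent: (i) there exists a Lazutkin change of coordinates of order $k$; (ii) there exists an angular function of order $k$ on $\mathbb A_\varepsilon$ for some $\varepsilon>0$. -/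

import Mathlib

open Set
open scoped ContDiff

noncomputable section

/-- Derivative of a function on the circle `ℝ / aℤ` with respect to the coordinate of `ℝ`. -/
def circleDeriv {a : ℝ} (g : AddCircle a → ℂ) (p : AddCircle a) : ℂ :=
  deriv (fun t : ℝ => g (p + (t : AddCircle a))) 0

/-- A bounded open convex planar domain `Ω` (the plane being identified with `ℂ`) whose boundary
has length `ℓ`, is smooth and has strictly positive curvature. The boundary is described by its
positively oriented arc-length parametrization `γ`, defined on `ℝ / ℓℤ`. -/
structure BilliardTable where
  /-- the domain -/
  Ω : Set ℂ
  /-- the length of the boundary -/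
  ℓ : ℝ
  /-- the arc-length parametrization of the boundary -/
  γ : AddCircle ℓ → ℂ
  isOpen : IsOpen Ω
  isBounded : Bornology.IsBounded Ω
  convex : Convex ℝ Ω
  length_pos : 0 < ℓ
  smooth : ContDiff ℝ ∞ (fun t : ℝ => γ (t : AddCircle ℓ))
  injective : Function.Injective γ
  range_eq : range γ = frontier Ω
  unit_speed : ∀ s, ‖circleDeriv γ s‖ = 1
  /-- The signed curvature `Im (conj γ' * γ'')` is positive: the boundary turns left, so `γ` runs
  counterclockwise around `Ω`. -/
  curvature_pos : ∀ s,
    0 < ((starRingEnd ℂ) (circleDeriv γ s) * circleDeriv (circleDeriv γ) s).im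

/-- The covering `ℝ × ℝ → (ℝ / aℤ) × ℝ` of the cylinder. -/
def cylinderCover (a : ℝ) (q : ℝ × ℝ) : AddCircle a × ℝ := ((q.1 : AddCircle a), q.2)

/-- Smoothness of a circle-valued map on `S`, the circle being embedded in `ℂ` by
`x ↦ exp (2πix/b)`. -/
def SmoothToCircleOn {E : Type*} [NormedAddCommGroup E] [NormedSpace ℝ E] {b : ℝ}
    (F : E → AddCircle b) (S : Set E) : Prop :=
  ContDiffOn ℝ ∞ (fun x => (AddCircle.toCircle (F x) : ℂ)) S

/-- Smoothness of a map between cylinders on a set `U` (up to the boundary points of the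
cylinder that belong to `U`). -/
def SmoothOnCylinder {a b : ℝ} (F : AddCircle a × ℝ → AddCircle b × ℝ)
    (U : Set (AddCircle a × ℝ)) : Prop :=
  SmoothToCircleOn (fun q => (F (cylinderCover a q)).1) (cylinderCover a ⁻¹' U) ∧
  ContDiffOn ℝ ∞ (fun q => (F (cylinderCover a q)).2) (cylinderCover a ⁻¹' U)

/-- `F` restricts to a diffeomorphism of `U` onto `V`. -/
def IsCylinderDiffeo {a b : ℝ} (F : AddCircle a × ℝ → AddCircle b × ℝ)
    (U : Set (AddCircle a × ℝ)) (V : Set (AddCircle b × ℝ)) : Prop :=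
  BijOn F U V ∧ SmoothOnCylinder F U ∧
  ∃ G : AddCircle b × ℝ → AddCircle a × ℝ, InvOn G F U V ∧ SmoothOnCylinder G V

/-- `U` is an open neighbourhood of `(ℝ / aℤ) × {0}` in the cylinder `(ℝ / aℤ) × I`. -/
def IsBoundaryNhd {a : ℝ} (I : Set ℝ) (U : Set (AddCircle a × ℝ)) : Prop :=
  (∃ W : Set (AddCircle a × ℝ), IsOpen W ∧ U = W ∩ (univ ×ˢ I)) ∧
  ∀ s : AddCircle a, (s, (0 : ℝ)) ∈ U

namespace BilliardTable

variable (B : BilliardTable)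

/-- The positively oriented unit tangent vector of the boundary. -/
def tangent (s : AddCircle B.ℓ) : ℂ := circleDeriv B.γ s

/-- In Birkhoff coordinates (arc-length and angle with the positive tangent), the collision `q`
follows the collision `p`. For `0 < φ < π` the ray from `γ s` that makes the angle `φ` with the
tangent meets the boundary again at `γ s'`; the outgoing angle `φ'` there equals the angle
between the incoming direction and the tangent at `γ s'`. Collisions with `φ = 0` or `φ = π`
are fixed. -/
def IsNextCollision (p q : AddCircle B.ℓ × ℝ) : Prop :=
  ((p.2 = 0 ∨ p.2 = Real.pi) ∧ q = p) ∨
  (p.2 ∈ Ioo 0 Real.pi ∧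
    (∃ r : ℝ, 0 < r ∧
      B.γ q.1 = B.γ p.1 + (r : ℂ) * Complex.exp ((p.2 : ℂ) * Complex.I) * B.tangent p.1) ∧
    q.2 = InnerProductGeometry.angle (B.tangent q.1) (B.γ q.1 - B.γ p.1))

/-- The billiard map on the phase space `(ℝ / ℓℤ) × [0, π]` (its values elsewhere are
irrelevant). -/
def billiardMap (p : AddCircle B.ℓ × ℝ) : AddCircle B.ℓ × ℝ :=
  Classical.epsilon (B.IsNextCollision p)

/-- The map `(s, φ) ↦ (∑_{j<k} X_j(s) φ^{2j}, ∑_{j≤k} Y_j(s) φ^{2j+1})` for `k ≥ 1`. Its first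
component is circle-valued, as is `X₀`; the other coefficients are real-valued. -/
def lazutkinForm (k : ℕ) (X₀ : AddCircle B.ℓ → UnitAddCircle) (X Y : ℕ → AddCircle B.ℓ → ℝ)
    (p : AddCircle B.ℓ × ℝ) : UnitAddCircle × ℝ :=
  (X₀ p.1 + ((∑ j ∈ Finset.Ico 1 k, X j p.1 * p.2 ^ (2 * j) : ℝ) : UnitAddCircle),
    ∑ j ∈ Finset.range (k + 1), Y j p.1 * p.2 ^ (2 * j + 1))

/-- On `U`, the map `Ψ` conjugates the billiard map to `(x, y) ↦ (x + y, y) + O(y^{2k+2})`,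
where `O` is meant as `y → 0`, uniformly in `x`. -/
def ConjugatesToNormalForm (k : ℕ) (Ψ : AddCircle B.ℓ × ℝ → UnitAddCircle × ℝ)
    (U : Set (AddCircle B.ℓ × ℝ)) : Prop :=
  ∃ C > (0 : ℝ), ∃ δ > (0 : ℝ), ∀ p ∈ U, B.billiardMap p ∈ U → (Ψ p).2 < δ →
    ‖(Ψ (B.billiardMap p)).1 - ((Ψ p).1 + (((Ψ p).2 : ℝ) : UnitAddCircle))‖
        ≤ C * (Ψ p).2 ^ (2 * k + 2) ∧
    |(Ψ (B.billiardMap p)).2 - (Ψ p).2| ≤ C * (Ψ p).2 ^ (2 * k + 2)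

/-- `Ψ` is a Lazutkin change of coordinates of order `k ≥ 1`. -/
def IsLazutkinChange (k : ℕ) (Ψ : AddCircle B.ℓ × ℝ → UnitAddCircle × ℝ) : Prop :=
  (∃ (X₀ : AddCircle B.ℓ → UnitAddCircle) (X Y : ℕ → AddCircle B.ℓ → ℝ),
    SmoothToCircleOn (fun t : ℝ => X₀ (t : AddCircle B.ℓ)) univ ∧
    (∀ j, ContDiff ℝ ∞ (fun t : ℝ => X j (t : AddCircle B.ℓ))) ∧
    (∀ j, ContDiff ℝ ∞ (fun t : ℝ => Y j (t : AddCircle B.ℓ))) ∧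
    Ψ = B.lazutkinForm k X₀ X Y) ∧
  ∃ (U : Set (AddCircle B.ℓ × ℝ)) (ε : ℝ) (V : Set (UnitAddCircle × ℝ)),
    0 < ε ∧ IsBoundaryNhd (Icc 0 Real.pi) U ∧ IsBoundaryNhd (Ico 0 ε) V ∧
    IsCylinderDiffeo Ψ U V ∧ B.ConjugatesToNormalForm k Ψ U

/-- The triple `(z₋, z₀, z₊)` of boundary points is a billiard `ε`-pseudocollision: the angle
between `z₀z₊` and the positive tangent at `z₀` and the angle between `z₀z₋` and the negative
tangent differ by less than `ε`. -/
def IsPseudocollision (ε : ℝ) (zm z₀ zp : ℂ) : Prop :=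
  zm ∈ frontier B.Ω ∧ zp ∈ frontier B.Ω ∧ zm ≠ z₀ ∧ zp ≠ z₀ ∧
  ∃ s, B.γ s = z₀ ∧
    |InnerProductGeometry.angle (B.tangent s) (zp - z₀) -
      InnerProductGeometry.angle (-B.tangent s) (zm - z₀)| < ε

/-- `Z` is an angular function of order `k` on the annulus `(ℝ / ℤ) × (-ε, ε)`. -/
structure IsAngularFunction (k : ℕ) (ε : ℝ) (Z : UnitAddCircle → ℝ → ℂ) : Prop where
  smooth : ContDiffOn ℝ ∞ (fun q : ℝ × ℝ => Z (q.1 : UnitAddCircle) q.2) (univ ×ˢ Ioo (-ε) ε)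
  even : ∀ ξ, ∀ η ∈ Ioo (-ε) ε, Z ξ (-η) = Z ξ η
  bijOn : ∀ η ∈ Ioo (-ε) ε, BijOn (fun ξ => Z ξ η) univ (frontier B.Ω)
  /-- The derivative along the circle is a positive multiple of the positive tangent; together
  with `bijOn`, each `Z(·, η)` is an orientation-preserving diffeomorphism onto the boundary. -/
  orientation : ∀ η ∈ Ioo (-ε) ε, ∀ ξ s, B.γ s = Z ξ η →
    ∃ c : ℝ, 0 < c ∧ circleDeriv (fun ξ => Z ξ η) ξ = c * B.tangent s
  base_point : ∀ η ∈ Ioo (-ε) ε, Z 0 η = Z 0 0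
  pseudocollision : ∃ C > (0 : ℝ), ∃ δ > (0 : ℝ), ∀ ξ, ∀ η ∈ Ioo (-ε) ε, η ≠ 0 → |η| < δ →
    B.IsPseudocollision (C * η ^ (2 * k + 2))
      (Z (ξ - (η : UnitAddCircle)) η) (Z ξ η) (Z (ξ + (η : UnitAddCircle)) η)

end BilliardTable

end

noncomputable section

open Filter Topology Asymptotics MeasureTheory

/-! Everything is lifted to the plane and written in terms of `(s, d)`, where `d` is the arc length
from one collision to the next. Let `A (s, d)` be the signed angle between the tangent at `s` and
the chord to `s + d`. It is smooth across `d = 0`, vanishes there, and its transverse derivative is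
half the curvature. The collision `(s, A (s, d))` is followed by `(s + d, -A (s + d, -d))`, so time
reversal is the symmetry `d ↦ -d`. If `S` lifts an angular function, the pseudocollision condition
says that `reflectionDefect A S` is `O(η^{2k+2})`.

From a Lazutkin change `(X, Y)` to an angular function (`exists_even_of_conjugation`): let `(S, Φ)`
be the inverse. Since `X` is even and `Y` odd in the angle, `S` is even in `η`. The normal form
sends `(S, Φ)(ξ, η)` to `(S, Φ)(ξ + η, η)` up to the error, so `Φ (ξ, η)` approximates both the
angle towards `S (ξ + η, η)` and, after replacing `ξ` by `ξ - η`, the angle of arrival from `S (ξ -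
η, η)`. These two angles therefore agree up to the error. A translation in `ξ` depending on `η` then
fixes the base point (`exists_fixed_base`).

Conversely (`exists_conjugation`), let `B (ξ, η)` be the chord angle from `S (ξ, η)` to `S (ξ + η,
η)`. As `S` is even, a small defect means that `B` is odd up to the error, and the inverse `(P, Q)`
of `(S, B)` has the parities and the conjugation property of a Lazutkin change up to the error.
`exists_lazutkin_of_conjugation` replaces `P` and `Q` by Taylor polynomials. The term `w(s) φ^{2k}`
of `P`, which the required form excludes, is dropped: its change in one step is `W(s) φ^{2k+1}` to
leading order, and this is absorbed by `Q`.

The geometry enters through `exists_hasChordAngle`, with convexity used to make the next collision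
unique (`ray_unique`). Uniformity in `s` comes from compactness of a period. Positivity of the
derivative of `X₀` and its degree one are consequences of the conjugation and the diffeomorphism
property (`exists_stripCoord_of_isLazutkinChange`). -/

/-! ### Partial derivatives and Hadamard quotients -/

/-- An integral over `[0, 1]` depends smoothly on parameters if the integrand does. -/
theorem contDiff_parametric_intervalIntegral {P E : Type*} [NormedAddCommGroup P]
    [NormedSpace ℝ P] [NormedAddCommGroup E] [NormedSpace ℝ E]
    {F : P × ℝ → E} (hF : ContDiff ℝ ∞ F) :
    ContDiff ℝ ∞ (fun x => ∫ t in (0 : ℝ)..1, F (x, t)) := by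
  -- The integral is the convolution, evaluated at `0`, of the indicator of `(0, 1]` with `t ↦ χ t •
  -- F (x, -t)`. The cutoff equals `1` where the indicator lives and supplies the compact support
  -- that smoothness of convolutions requires.
  let χ : ContDiffBump (0 : ℝ) := ⟨1, 2, one_pos, one_lt_two⟩
  have key := contDiffOn_convolution_right_with_param_comp (𝕜 := ℝ) (μ := volume) (n := ⊤)
    (ContinuousLinearMap.lsmul ℝ ℝ : ℝ →L[ℝ] E →L[ℝ] E) (s := (univ : Set P))
    (v := fun _ => (0 : ℝ)) contDiffOn_const
    (f := (Ioc (0 : ℝ) 1).indicator fun _ => (1 : ℝ))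
    (g := fun x t => χ t • F (x, -t)) (k := Metric.closedBall 0 2) isOpen_univ
    (isCompact_closedBall _ _) ?_ ?_ ?_
  · rw [contDiffOn_univ] at key
    convert key using 1
    funext x
    rw [convolution_def, intervalIntegral.integral_of_le zero_le_one,
      ← integral_indicator measurableSet_Ioc]
    refine integral_congr_ae (Eventually.of_forall fun t => ?_)
    simp only
    by_cases ht : t ∈ Ioc (0 : ℝ) 1
    · have h1 : χ (-t) = 1 := χ.one_of_mem_closedBall (by
        simp only [mem_closedBall_zero_iff, norm_neg, Real.norm_eq_abs, abs_of_pos ht.1]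
        exact ht.2)
      simp [ht, h1]
    · simp [ht]
  · intro p x _ hx
    have : χ x = 0 := χ.zero_of_le_dist (by
      simp only [Metric.mem_closedBall, not_le] at hx
      exact hx.le)
    simp [this]
  · exact (integrable_indicator_iff measurableSet_Ioc).2 (by simp) |>.locallyIntegrable
  · refine ContDiff.contDiffOn ?_
    have h2 : ContDiff ℝ ∞ (fun q : P × ℝ => χ q.2) := χ.contDiff.comp contDiff_snd
    have h3 : ContDiff ℝ ∞ (fun q : P × ℝ => F (q.1, -q.2)) := by fun_prop
    exact h2.smul h3

/-- Partial derivative with respect to the first variable. -/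
def dx {E : Type*} [NormedAddCommGroup E] [NormedSpace ℝ E] (f : ℝ × ℝ → E) (p : ℝ × ℝ) : E :=
  fderiv ℝ f p (1, 0)

/-- Partial derivative with respect to the second variable. -/
def dy {E : Type*} [NormedAddCommGroup E] [NormedSpace ℝ E] (f : ℝ × ℝ → E) (p : ℝ × ℝ) : E :=
  fderiv ℝ f p (0, 1)

/-- The Hadamard quotient `(f(s, y) - f(s, 0)) / y`, as a smooth function. -/
def dq {E : Type*} [NormedAddCommGroup E] [NormedSpace ℝ E] (f : ℝ × ℝ → E) (p : ℝ × ℝ) : E :=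
  ∫ t in (0 : ℝ)..1, dy f (p.1, t * p.2)

section Calculus

variable {E : Type*} [NormedAddCommGroup E] [NormedSpace ℝ E] {f : ℝ × ℝ → E}

theorem ContDiff.dx (hf : ContDiff ℝ ∞ f) : ContDiff ℝ ∞ (dx f) :=
  (hf.fderiv_right (m := ∞) (by simp)).clm_apply contDiff_const

theorem ContDiff.dy (hf : ContDiff ℝ ∞ f) : ContDiff ℝ ∞ (dy f) :=
  (hf.fderiv_right (m := ∞) (by simp)).clm_apply contDiff_const

theorem ContDiff.dq (hf : ContDiff ℝ ∞ f) : ContDiff ℝ ∞ (dq f) := by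
  have h : ContDiff ℝ ∞ (fun q : (ℝ × ℝ) × ℝ => _root_.dy f (q.1.1, q.2 * q.1.2)) := by
    have := hf.dy
    fun_prop
  exact contDiff_parametric_intervalIntegral h

theorem ContDiff.hasFDerivAt_infty {P E : Type*} [NormedAddCommGroup P]
    [NormedSpace ℝ P] [NormedAddCommGroup E] [NormedSpace ℝ E] {f : P → E}
    (hf : ContDiff ℝ ∞ f) (p : P) : HasFDerivAt f (fderiv ℝ f p) p :=
  ((hf.differentiable (by simp)) p).hasFDerivAt

theorem hasDerivAt_snd_of_contDiff (hf : ContDiff ℝ ∞ f) (s y : ℝ) :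
    HasDerivAt (fun t => f (s, t)) (dy f (s, y)) y :=
  (hf.hasFDerivAt_infty (s, y)).comp_hasDerivAt y ((hasDerivAt_const y s).prodMk (hasDerivAt_id y))

theorem hasDerivAt_fst_of_contDiff (hf : ContDiff ℝ ∞ f) (s y : ℝ) :
    HasDerivAt (fun t => f (t, y)) (dx f (s, y)) s :=
  (hf.hasFDerivAt_infty (s, y)).comp_hasDerivAt s ((hasDerivAt_id s).prodMk (hasDerivAt_const s y))

theorem fderiv_apply_eq_dx_dy (f : ℝ × ℝ → E) (p v : ℝ × ℝ) :
    fderiv ℝ f p v = v.1 • dx f p + v.2 • dy f p := by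
  have : v = v.1 • ((1 : ℝ), (0 : ℝ)) + v.2 • ((0 : ℝ), (1 : ℝ)) := by ext <;> simp
  conv_lhs => rw [this, map_add, map_smul, map_smul]
  rfl

/-- Fundamental theorem of calculus along the segment `t ↦ (s, t y)`. This is how quotients by `y`
remain smooth across `y = 0`. -/
theorem eq_add_smul_dq [CompleteSpace E] (hf : ContDiff ℝ ∞ f) (p : ℝ × ℝ) :
    f p = f (p.1, 0) + p.2 • dq f p := by
  have h1 : ∀ t ∈ uIcc (0 : ℝ) 1,
      HasDerivAt (fun t => f (p.1, t * p.2)) (p.2 • dy f (p.1, t * p.2)) t := fun t _ => by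
    have h0 : HasDerivAt (fun t => t * p.2) p.2 t := by
      simpa using (hasDerivAt_id t).mul_const p.2
    exact HasDerivAt.scomp (h := fun t => t * p.2) t
      (hasDerivAt_snd_of_contDiff hf p.1 (t * p.2)) h0
  have h2 := intervalIntegral.integral_eq_sub_of_hasDerivAt h1
    (Continuous.intervalIntegrable (by have := hf.dy.continuous; fun_prop) _ _)
  rw [intervalIntegral.integral_smul] at h2
  simp only [one_mul, zero_mul] at h2
  rw [dq, h2]
  simp

theorem dq_zero [CompleteSpace E] (f : ℝ × ℝ → E) (s : ℝ) : dq f (s, 0) = dy f (s, 0) := by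
  simp [dq]

theorem dy_periodic {a : ℝ} {c : E} (h : ∀ s y, f (s + a, y) = f (s, y) + c) (s y : ℝ) :
    dy f (s + a, y) = dy f (s, y) := by
  have : (fun p : ℝ × ℝ => f (p + (a, 0))) = fun p => f p + c := by
    funext p; rw [← h p.1 p.2]; congr 1; ext <;> simp
  have h2 := fderiv_comp_add_right (𝕜 := ℝ) (f := f) (x := (s, y)) ((a, 0) : ℝ × ℝ)
  rw [this, fderiv_add_const] at h2
  simp only [Prod.mk_add_mk, add_zero] at h2
  rw [dy, dy, h2]

theorem fderiv_periodic {a : ℝ} {c : E} (h : ∀ s y, f (s + a, y) = f (s, y) + c) (s y : ℝ) :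
    fderiv ℝ f (s + a, y) = fderiv ℝ f (s, y) := by
  have : (fun p : ℝ × ℝ => f (p + (a, 0))) = fun p => f p + c := by
    funext p; rw [← h p.1 p.2]; congr 1; ext <;> simp
  have h2 := fderiv_comp_add_right (𝕜 := ℝ) (f := f) (x := (s, y)) ((a, 0) : ℝ × ℝ)
  rw [this, fderiv_add_const] at h2
  simp only [Prod.mk_add_mk, add_zero] at h2
  rw [h2]

theorem dq_periodic {a : ℝ} {c : E} (h : ∀ s y, f (s + a, y) = f (s, y) + c) (s y : ℝ) :
    dq f (s + a, y) = dq f (s, y) := by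
  simp only [dq, dy_periodic h]

end Calculus

/-! ### Uniform neighbourhoods of the boundary line -/

/-- The filter of uniform neighbourhoods of the line `ℝ × {0}` in the plane. -/
def stripNhds : Filter (ℝ × ℝ) := comap Prod.snd (𝓝 0)

/-- The filter of uniform one-sided neighbourhoods of the line `ℝ × {0}` in the plane. -/
def stripNhdsPos : Filter (ℝ × ℝ) := comap Prod.snd (𝓝[>] 0)

theorem stripNhdsPos_le : stripNhdsPos ≤ stripNhds := comap_mono nhdsWithin_le_nhds

theorem eventually_stripNhds_iff {P : ℝ × ℝ → Prop} :
    (∀ᶠ p in stripNhds, P p) ↔ ∃ r > 0, ∀ s y, |y| < r → P (s, y) := by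
  rw [stripNhds, (Metric.nhds_basis_ball.comap Prod.snd).eventually_iff]
  simp only [mem_preimage, mem_ball_zero_iff, Real.norm_eq_abs, Prod.forall]

theorem eventually_stripNhdsPos_iff {P : ℝ × ℝ → Prop} :
    (∀ᶠ p in stripNhdsPos, P p) ↔ ∃ r > 0, ∀ s y, 0 < y → y < r → P (s, y) := by
  rw [stripNhdsPos, ((nhdsGT_basis (0 : ℝ)).comap Prod.snd).eventually_iff]
  simp only [mem_preimage, mem_Ioo, Prod.forall, and_imp]

theorem tendsto_snd_stripNhds : Tendsto Prod.snd stripNhds (𝓝 (0 : ℝ)) := tendsto_comap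

theorem tendsto_stripNhds_iff {α : Type*} {l : Filter α} {u : α → ℝ × ℝ} :
    Tendsto u l stripNhds ↔ Tendsto (fun x => (u x).2) l (𝓝 0) := tendsto_comap_iff

theorem tendsto_stripNhdsPos_iff {α : Type*} {l : Filter α} {u : α → ℝ × ℝ} :
    Tendsto u l stripNhdsPos ↔
      Tendsto (fun x => (u x).2) l (𝓝 0) ∧ ∀ᶠ x in l, 0 < (u x).2 := by
  rw [stripNhdsPos, tendsto_comap_iff, tendsto_nhdsWithin_iff]
  rfl

theorem eventually_stripNhdsPos_pos : ∀ᶠ p in stripNhdsPos, 0 < p.2 :=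
  (tendsto_stripNhdsPos_iff.1 tendsto_id).2

/-- A property that holds locally near `ℝ × {0}` and is periodic in the first variable holds on a
uniform neighbourhood of `ℝ × {0}`. -/
theorem eventually_stripNhds_of_periodic {a : ℝ} (ha : 0 < a) {P : ℝ × ℝ → Prop}
    (hP : ∀ s y, P (s + a, y) ↔ P (s, y)) (h : ∀ s, ∀ᶠ p in 𝓝 (s, (0 : ℝ)), P p) :
    ∀ᶠ p in stripNhds, P p := by
  have hn : ∀ (n : ℤ) (s y : ℝ), P (s + n * a, y) ↔ P (s, y) := by
    intro n
    induction n using Int.induction_on with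
    | zero => simp
    | succ n ih =>
      intro s y
      rw [← ih s y, ← hP (s + ((n : ℤ) : ℝ) * a) y]
      push_cast
      ring_nf
    | pred n ih =>
      intro s y
      rw [← ih s y, ← hP (s + ((-n - 1 : ℤ) : ℝ) * a) y]
      push_cast
      ring_nf
  -- Tube lemma over one compact period: the neighbourhoods of single points contain a strip of
  -- uniform height, which translations by periods then extend to all `s`.
  have h1 : ∀ᶠ p in 𝓝ˢ (Icc 0 a ×ˢ {(0 : ℝ)}), P p := by
    rw [eventually_nhdsSet_iff_forall]
    rintro ⟨s, y⟩ ⟨_, rfl⟩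
    exact h s
  rw [isCompact_Icc.nhdsSet_prod_eq isCompact_singleton, nhdsSet_singleton] at h1
  obtain ⟨p1, hp1, p2, hp2, hp⟩ := eventually_prod_iff.1 h1
  obtain ⟨r, hr, hr2⟩ := Metric.eventually_nhds_iff_ball.1 hp2
  refine eventually_stripNhds_iff.2 ⟨r, hr, fun s y hy => ?_⟩
  rw [← hn (-⌊s / a⌋)]
  refine hp (hp1.self_of_nhdsSet _ ?_) (hr2 _ (by simpa using hy))
  have e : s = (s / a) * a := by field_simp
  constructor
  · have := mul_le_mul_of_nonneg_right (Int.floor_le (s / a)) ha.le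
    push_cast; linarith
  · have := mul_le_mul_of_nonneg_right (Int.lt_floor_add_one (s / a)).le ha.le
    push_cast; linarith

/-! ### Lifts of functions on a cylinder -/

/-- `f` is smooth on the plane and lifts a function on a cylinder: it gains `b` whenever the first
variable is translated by `a`. -/
structure IsLift (a b : ℝ) (f : ℝ × ℝ → ℝ) : Prop where
  smooth : ContDiff ℝ ∞ f
  map_add : ∀ s y, f (s + a, y) = f (s, y) + b

section Periodic

variable {a : ℝ} {E : Type*} {g : ℝ × ℝ → E}

theorem exists_mem_Icc_of_periodic (ha : 0 < a) (hp : ∀ s y, g (s + a, y) = g (s, y)) (s y : ℝ) :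
    ∃ t ∈ Icc 0 a, g (s, y) = g (t, y) := by
  have hper : Function.Periodic (fun s => g (s, y)) a := fun s => hp s y
  obtain ⟨t, ht, h⟩ := hper.exists_mem_Ico₀ ha s
  exact ⟨t, Ico_subset_Icc_self ht, h⟩

theorem isBigO_one_of_periodic [NormedAddCommGroup E] (ha : 0 < a) (hg : Continuous g)
    (hp : ∀ s y, g (s + a, y) = g (s, y)) : g =O[stripNhds] (fun _ => (1 : ℝ)) := by
  obtain ⟨M, hM⟩ := (isCompact_Icc (a := (0 : ℝ)) (b := a)).exists_bound_of_continuousOn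
    (f := fun s => g (s, 0)) (by fun_prop)
  refine IsBigO.of_bound (M + 1) ?_
  refine eventually_stripNhds_of_periodic ha (fun s y => by simp [hp]) fun s => ?_
  obtain ⟨t, ht, e⟩ := exists_mem_Icc_of_periodic ha hp s 0
  have : ‖g (s, 0)‖ < M + 1 := by
    rw [e]; linarith [hM t ht]
  filter_upwards [(hg.norm.tendsto (s, 0)).eventually_lt_const this] with p hp
  simpa using hp.le

theorem exists_pos_le_of_periodic (ha : 0 < a) {g : ℝ × ℝ → ℝ} (hg : Continuous g)
    (hp : ∀ s y, g (s + a, y) = g (s, y)) (h0 : ∀ s, 0 < g (s, 0)) :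
    ∃ m > 0, ∀ᶠ p in stripNhds, m ≤ g p := by
  obtain ⟨t, ht, hmin⟩ := (isCompact_Icc (a := (0 : ℝ)) (b := a)).exists_isMinOn
    (f := fun s => g (s, 0)) ⟨0, by simp [ha.le]⟩ (by fun_prop)
  refine ⟨g (t, 0) / 2, by linarith [h0 t], ?_⟩
  refine eventually_stripNhds_of_periodic ha (fun s y => by simp [hp]) fun s => ?_
  obtain ⟨t', ht', e⟩ := exists_mem_Icc_of_periodic ha hp s 0
  have : g (t, 0) / 2 < g (s, 0) := by
    rw [e]
    have h1 : g (t, 0) ≤ g (t', 0) := hmin ht'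
    linarith [h0 t]
  filter_upwards [(hg.tendsto (s, 0)).eventually_const_lt this] with p hp
  exact hp.le

end Periodic

section Lift

variable {a b c : ℝ} {f g : ℝ × ℝ → ℝ}

theorem IsLift.periodic (hf : IsLift a 0 f) (s y : ℝ) : f (s + a, y) = f (s, y) := by
  simpa using hf.map_add s y

theorem IsLift.isLift_dq (hf : IsLift a b f) : IsLift a 0 (dq f) :=
  ⟨hf.smooth.dq, fun s y => by simp [dq_periodic hf.map_add]⟩

theorem IsLift.isBigO_one (ha : 0 < a) (hf : IsLift a 0 f) :
    f =O[stripNhds] (fun _ => (1 : ℝ)) :=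
  isBigO_one_of_periodic ha hf.smooth.continuous hf.periodic

theorem IsLift.eq_mul_dq (hf : IsLift a b f) (h0 : ∀ s, f (s, 0) = 0) (p : ℝ × ℝ) :
    f p = p.2 * dq f p := by
  rw [eq_add_smul_dq hf.smooth p, h0]; simp

theorem IsLift.isBigO_snd (ha : 0 < a) (hf : IsLift a b f) (h0 : ∀ s, f (s, 0) = 0) :
    f =O[stripNhds] (Prod.snd : ℝ × ℝ → ℝ) := by
  have h1 := (isBigO_refl (Prod.snd : ℝ × ℝ → ℝ) stripNhds).mul (hf.isLift_dq.isBigO_one ha)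
  simp only [← hf.eq_mul_dq h0, mul_one] at h1
  exact h1

theorem IsLift.tendsto_zero (ha : 0 < a) (hf : IsLift a b f) (h0 : ∀ s, f (s, 0) = 0) :
    Tendsto f stripNhds (𝓝 0) :=
  (hf.isBigO_snd ha h0).trans_tendsto tendsto_snd_stripNhds

/-- A function vanishing on `ℝ × {0}` with positive transverse derivative is comparable to the
second coordinate. -/
theorem IsLift.exists_mul_le (ha : 0 < a) (hf : IsLift a b f) (h0 : ∀ s, f (s, 0) = 0)
    (h1 : ∀ s, 0 < dy f (s, 0)) : ∃ m > 0, ∀ᶠ p in stripNhdsPos, m * p.2 ≤ f p := by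
  obtain ⟨m, hm, h⟩ := exists_pos_le_of_periodic ha hf.isLift_dq.smooth.continuous
    hf.isLift_dq.periodic
    (fun s => by rw [dq_zero]; exact h1 s)
  refine ⟨m, hm, ?_⟩
  filter_upwards [stripNhdsPos_le h, eventually_stripNhdsPos_pos] with p hp hp2
  rw [hf.eq_mul_dq h0, mul_comm]
  exact mul_le_mul_of_nonneg_left hp hp2.le

theorem IsLift.tendsto_pos (ha : 0 < a) (hf : IsLift a b f) (h0 : ∀ s, f (s, 0) = 0)
    (h1 : ∀ s, 0 < dy f (s, 0)) (g : ℝ × ℝ → ℝ) :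
    Tendsto (fun p => (g p, f p)) stripNhdsPos stripNhdsPos := by
  refine tendsto_stripNhdsPos_iff.2 ⟨(hf.tendsto_zero ha h0).mono_left stripNhdsPos_le, ?_⟩
  obtain ⟨m, hm, h⟩ := hf.exists_mul_le ha h0 h1
  filter_upwards [h, eventually_stripNhdsPos_pos] with p hp hp2
  exact (mul_pos hm hp2).trans_le hp

theorem IsLift.snd_isBigO (ha : 0 < a) (hf : IsLift a b f) (h0 : ∀ s, f (s, 0) = 0)
    (h1 : ∀ s, 0 < dy f (s, 0)) : (Prod.snd : ℝ × ℝ → ℝ) =O[stripNhdsPos] f := by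
  obtain ⟨m, hm, h⟩ := hf.exists_mul_le ha h0 h1
  refine IsBigO.of_bound m⁻¹ ?_
  filter_upwards [h, eventually_stripNhdsPos_pos] with p hp hp2
  have h3 := mul_pos hm hp2
  rw [Real.norm_of_nonneg hp2.le, Real.norm_of_nonneg (h3.le.trans hp), ← div_eq_inv_mul,
    le_div_iff₀ hm]
  linarith

/-- A lift is Lipschitz on a uniform neighbourhood of `ℝ × {0}`. -/
theorem IsLift.exists_lipschitz (ha : 0 < a) (hf : IsLift a b f) :
    ∃ K, ∃ r > 0, ∀ p q : ℝ × ℝ, |p.2| < r → |q.2| < r → ‖f p - f q‖ ≤ K * ‖p - q‖ := by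
  obtain ⟨K, hK⟩ := (isBigO_one_of_periodic ha
    (hf.smooth.continuous_fderiv (by simp)) (fderiv_periodic hf.map_add)).bound
  obtain ⟨r, hr, h⟩ := eventually_stripNhds_iff.1 hK
  refine ⟨K, r, hr, fun p q hp hq => ?_⟩
  have hconv : Convex ℝ (Prod.snd ⁻¹' Metric.ball (0 : ℝ) r : Set (ℝ × ℝ)) :=
    (convex_ball (0 : ℝ) r).linear_preimage (LinearMap.snd ℝ ℝ ℝ)
  refine hconv.norm_image_sub_le_of_norm_fderiv_le (𝕜 := ℝ) (f := f)
    (fun x _ => (hf.smooth.differentiable (by simp)) x) (fun x hx => ?_) (by simpa using hq)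
    (by simpa using hp)
  have := h x.1 x.2 (by simpa using hx)
  simpa using this

/-- The rule by which errors propagate: by the uniform Lipschitz bound, an `O(e)` perturbation of
the arguments perturbs a lift by `O(e)`. -/
theorem IsLift.sub_isBigO (ha : 0 < a) (hf : IsLift a b f) {α : Type*} {l : Filter α}
    {u v : α → ℝ × ℝ} (hu : Tendsto u l stripNhds) (hv : Tendsto v l stripNhds) {e : α → ℝ}
    (h1 : (fun x => (u x).1 - (v x).1) =O[l] e) (h2 : (fun x => (u x).2 - (v x).2) =O[l] e) :
    (fun x => f (u x) - f (v x)) =O[l] e := by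
  obtain ⟨K, r, hr, h⟩ := hf.exists_lipschitz ha
  refine IsBigO.trans (g := fun x => u x - v x) (IsBigO.of_bound K ?_) (h1.prod_left h2)
  have hs : ∀ᶠ p in stripNhds, |p.2| < r := eventually_stripNhds_iff.2 ⟨r, hr, fun s y hy => hy⟩
  filter_upwards [hu.eventually hs, hv.eventually hs] with x hx hx2
  exact h _ _ hx hx2

/-- A germ of a lift along `ℝ × {0}` is represented by a lift. -/
theorem exists_isLift_eventuallyEq (ha : 0 < a) {f : ℝ × ℝ → ℝ}
    (hf : ∀ᶠ p in stripNhds, ContDiffAt ℝ ∞ f p)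
    (hp : ∀ᶠ p in stripNhds, f (p.1 + a, p.2) = f p + b) :
    ∃ g, IsLift a b g ∧ g =ᶠ[stripNhds] f := by
  obtain ⟨r, hr, h⟩ := eventually_stripNhds_iff.1 (hf.and hp)
  let χ : ContDiffBump (0 : ℝ) := ⟨r / 3, r / 2, by linarith, by linarith⟩
  -- Cutting off `f` itself would destroy the gain `b` per period. The linear function `L` has the
  -- same gain, so `f - L` is periodic and may be cut off.
  let L : ℝ × ℝ → ℝ := fun p => b / a * p.1
  have hL : ContDiff ℝ ∞ L := by fun_prop
  refine ⟨fun p => χ p.2 * (f p - L p) + L p, ⟨?_, ?_⟩, ?_⟩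
  · refine contDiff_iff_contDiffAt.2 fun p => ContDiffAt.add ?_ hL.contDiffAt
    have hχ : ContDiff ℝ ∞ (fun q : ℝ × ℝ => χ q.2) := χ.contDiff.comp contDiff_snd
    by_cases hpr : |p.2| < r
    · exact hχ.contDiffAt.mul ((h p.1 p.2 hpr).1.sub hL.contDiffAt)
    · have hz : (fun q : ℝ × ℝ => χ q.2 * (f q - L q)) =ᶠ[𝓝 p] fun _ => 0 := by
        have : ∀ᶠ q in 𝓝 p, r / 2 < |q.2| :=
          (continuous_abs.comp continuous_snd).tendsto p |>.eventually_const_lt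
            (show r / 2 < |p.2| by linarith)
        filter_upwards [this] with q hq
        rw [χ.zero_of_le_dist (by simpa using hq.le), zero_mul]
      exact contDiffAt_const.congr_of_eventuallyEq hz
  · intro s y
    have e : L (s + a, y) = L (s, y) + b := by
      simp only [L]; field_simp
    simp only
    by_cases hy : |y| < r
    · rw [(h s y hy).2, e]; ring
    · rw [χ.zero_of_le_dist (by
        simp only [dist_zero_right, Real.norm_eq_abs]
        change r / 2 ≤ _
        linarith), e]
      ring
  · refine eventually_stripNhds_iff.2 ⟨r / 3, by linarith, fun s y hy => ?_⟩
    simp only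
    rw [χ.one_of_mem_closedBall (by simpa using hy.le)]
    ring

end Lift

theorem IsLift.isLift_dx {a b : ℝ} {f : ℝ × ℝ → ℝ} (hf : IsLift a b f) : IsLift a 0 (dx f) :=
  ⟨hf.smooth.dx, fun s y => by simp [dx, fderiv_periodic hf.map_add]⟩

theorem IsLift.isLift_dy {a b : ℝ} {f : ℝ × ℝ → ℝ} (hf : IsLift a b f) : IsLift a 0 (dy f) :=
  ⟨hf.smooth.dy, fun s y => by simp [dy, fderiv_periodic hf.map_add]⟩

theorem IsLift.map_add_int {a b : ℝ} {f : ℝ × ℝ → ℝ} (hf : IsLift a b f) (n : ℤ) (s y : ℝ) :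
    f (s + n * a, y) = f (s, y) + n * b := by
  induction n using Int.induction_on with
  | zero => simp
  | succ n ih =>
    have := hf.map_add (s + ((n : ℤ) : ℝ) * a) y
    push_cast at this ih ⊢
    rw [add_mul, one_mul, ← add_assoc, this, ih]; ring
  | pred n ih =>
    have := hf.map_add (s + ((-n - 1 : ℤ) : ℝ) * a) y
    push_cast at this ih ⊢
    rw [show s + (-(n : ℝ) - 1) * a + a = s + -(n : ℝ) * a by ring, ih] at this
    linarith

theorem IsLift.surjective {a b : ℝ} {f : ℝ × ℝ → ℝ} (hf : IsLift a b f) (hb : 0 < b) (y x : ℝ) :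
    ∃ s, f (s, y) = x := by
  have hc : Continuous fun s => f (s, y) := by
    have := hf.smooth.continuous
    fun_prop
  have k := fun n : ℤ => hf.map_add_int n 0 y
  obtain ⟨n, hn⟩ := exists_int_lt ((x - f (0, y)) / b)
  obtain ⟨n', hn'⟩ := exists_int_gt ((x - f (0, y)) / b)
  rw [lt_div_iff₀ hb] at hn
  rw [div_lt_iff₀ hb] at hn'
  exact mem_range_of_exists_le_of_exists_ge hc ⟨0 + n * a, by rw [k]; linarith⟩
    ⟨0 + n' * a, by rw [k]; linarith⟩

/-! ### Changes of coordinates near the boundary and their inverses -/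

/-- `(F, G)` lifts a change of coordinates between neighbourhoods of the boundary of two
half-open cylinders, preserving orientation of the boundary and the boundary itself. -/
structure StripCoord (a b : ℝ) (F G : ℝ × ℝ → ℝ) : Prop where
  fst : IsLift a b F
  snd : IsLift a 0 G
  snd_zero : ∀ s, G (s, 0) = 0
  dx_pos : ∀ s, 0 < dx F (s, 0)
  dy_pos : ∀ s, 0 < dy G (s, 0)

theorem dx_eq_zero_of_boundary {G : ℝ × ℝ → ℝ} (hG : ContDiff ℝ ∞ G) (h : ∀ s, G (s, 0) = 0)
    (s : ℝ) : dx G (s, 0) = 0 := by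
  have h1 := hasDerivAt_fst_of_contDiff hG s 0
  simp only [h] at h1
  exact h1.unique (hasDerivAt_const s 0)

namespace StripCoord

variable {a b : ℝ} {F G : ℝ × ℝ → ℝ}

theorem tendsto_strip (ha : 0 < a) (h : StripCoord a b F G) :
    Tendsto (fun p => (F p, G p)) stripNhds stripNhds :=
  tendsto_stripNhds_iff.2 (h.snd.tendsto_zero ha h.snd_zero)

theorem tendsto_stripPos (ha : 0 < a) (h : StripCoord a b F G) :
    Tendsto (fun p => (F p, G p)) stripNhdsPos stripNhdsPos :=
  h.snd.tendsto_pos ha h.snd_zero h.dy_pos F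

/-- On the boundary line `dx G` vanishes, so the Jacobian is triangular with positive diagonal. By
periodicity it stays uniformly invertible nearby, with the off-diagonal bounds dominated by the
diagonal ones. -/
theorem exists_derivative_bounds (ha : 0 < a) (h : StripCoord a b F G) :
    ∃ m > 0, ∃ M ≥ 0, ∃ e ≥ 0, M * e < m * m ∧ ∀ᶠ p in stripNhds,
      m ≤ dx F p ∧ m ≤ dy G p ∧ |dy F p| ≤ M ∧ |dx G p| ≤ e := by
  obtain ⟨m₁, hm₁, h₁⟩ := exists_pos_le_of_periodic ha h.fst.smooth.dx.continuous
    h.fst.isLift_dx.periodic h.dx_pos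
  obtain ⟨m₂, hm₂, h₂⟩ := exists_pos_le_of_periodic ha h.snd.smooth.dy.continuous
    h.snd.isLift_dy.periodic h.dy_pos
  obtain ⟨M, hM, h₃⟩ := (h.fst.isLift_dy.isBigO_one ha).exists_nonneg
  have h₄ := h.snd.isLift_dx.tendsto_zero ha (dx_eq_zero_of_boundary h.snd.smooth h.snd_zero)
  set m := min m₁ m₂
  have hm : 0 < m := lt_min hm₁ hm₂
  -- `dx G` tends to zero, so it can be made as small as `m² / (M + 1)`, which ensures `M * e < m *
  -- m`.
  have he : 0 < m * m / (M + 1) := by positivity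
  refine ⟨m, hm, M, hM, m * m / (M + 1), he.le, ?_, ?_⟩
  · rw [← mul_div_assoc, div_lt_iff₀ (by linarith)]
    nlinarith [mul_pos hm hm]
  · filter_upwards [h₁, h₂, h₃.bound, (h₄.norm).eventually_lt_const (by simpa using he)] with
      p q1 q2 q3 q4
    refine ⟨(min_le_left _ _).trans q1, (min_le_right _ _).trans q2, by simpa using q3, ?_⟩
    simpa using q4.le

/-- The two rows give `|u| m ≤ |v| M` and `|v| m ≤ |u| e`, hence `|u| (m² - M e) ≤ 0`. Only bounds
on the entries matter, so the rows may be evaluated at different points. -/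
theorem eq_zero_of_bounds {m M e α β γ δ u v : ℝ} (hm : 0 < m) (hM : 0 ≤ M)
    (hMe : M * e < m * m) (hα : m ≤ α) (hδ : m ≤ δ) (hβ : |β| ≤ M) (hγ : |γ| ≤ e)
    (h1 : u * α + v * β = 0) (h2 : u * γ + v * δ = 0) : u = 0 ∧ v = 0 := by
  have k1 : |u| * m ≤ |v| * M := by
    have : |u| * |α| = |v| * |β| := by
      rw [← abs_mul, ← abs_mul, show u * α = -(v * β) by linarith, abs_neg]
    calc |u| * m ≤ |u| * |α| := by gcongr; exact hα.trans (le_abs_self _)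
      _ = |v| * |β| := this
      _ ≤ |v| * M := by gcongr
  have k2 : |v| * m ≤ |u| * e := by
    have : |v| * |δ| = |u| * |γ| := by
      rw [← abs_mul, ← abs_mul, show v * δ = -(u * γ) by linarith, abs_neg]
    calc |v| * m ≤ |v| * |δ| := by gcongr; exact hδ.trans (le_abs_self _)
      _ = |u| * |γ| := this
      _ ≤ |u| * e := by gcongr
  have k3 : |u| * (m * m - M * e) ≤ 0 := by
    have := mul_le_mul_of_nonneg_right k1 hm.le
    have := mul_le_mul_of_nonneg_right k2 hM
    nlinarith
  have hu : |u| = 0 := by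
    have := abs_nonneg u
    by_contra hne
    have : 0 < |u| := lt_of_le_of_ne this (Ne.symm hne)
    nlinarith
  have hv : |v| = 0 := by
    have := abs_nonneg v
    rw [hu] at k2
    nlinarith
  exact ⟨abs_eq_zero.1 hu, abs_eq_zero.1 hv⟩

/-- Near the boundary, a change of coordinates is injective with invertible derivative. -/
theorem exists_injOn (ha : 0 < a) (h : StripCoord a b F G) :
    ∃ r > 0, InjOn (fun p => (F p, G p)) {p : ℝ × ℝ | |p.2| < r} ∧
      ∀ p : ℝ × ℝ, |p.2| < r → ∃ e : (ℝ × ℝ) ≃L[ℝ] (ℝ × ℝ),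
        HasFDerivAt (fun p => (F p, G p)) (e : (ℝ × ℝ) →L[ℝ] (ℝ × ℝ)) p := by
  obtain ⟨m, hm, M, hM, e, -, hMe, hev⟩ := h.exists_derivative_bounds ha
  obtain ⟨r, hr, hb⟩ := eventually_stripNhds_iff.1 hev
  refine ⟨r, hr, ?_, ?_⟩
  · intro p hp q hq hpq
    have hconv : Convex ℝ (Prod.snd ⁻¹' Metric.ball (0 : ℝ) r : Set (ℝ × ℝ)) :=
      (convex_ball (0 : ℝ) r).linear_preimage (LinearMap.snd ℝ ℝ ℝ)
    have hp' : p ∈ (Prod.snd ⁻¹' Metric.ball (0 : ℝ) r : Set (ℝ × ℝ)) := by simpa using hp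
    have hq' : q ∈ (Prod.snd ⁻¹' Metric.ball (0 : ℝ) r : Set (ℝ × ℝ)) := by simpa using hq
    -- The mean value theorem for `F` and for `G` yields two different intermediate points `z` and
    -- `w`. The entrywise bounds still exclude a nonzero `q - p`.
    obtain ⟨z, hz, ez⟩ := domain_mvt (f := F)
      (fun x _ => (h.fst.smooth.hasFDerivAt_infty x).hasFDerivWithinAt) hconv hp' hq'
    obtain ⟨w, hw, ew⟩ := domain_mvt (f := G)
      (fun x _ => (h.snd.smooth.hasFDerivAt_infty x).hasFDerivWithinAt) hconv hp' hq'
    have hz' := hconv.segment_subset hp' hq' hz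
    have hw' := hconv.segment_subset hp' hq' hw
    simp only [mem_preimage, mem_ball_zero_iff, Real.norm_eq_abs] at hz' hw'
    simp only [Prod.mk.injEq] at hpq
    rw [hpq.1, sub_self, fderiv_apply_eq_dx_dy] at ez
    rw [hpq.2, sub_self, fderiv_apply_eq_dx_dy] at ew
    obtain ⟨b1, -, b3, -⟩ := hb _ _ hz'
    obtain ⟨-, b2, -, b4⟩ := hb _ _ hw'
    obtain ⟨e1, e2⟩ := eq_zero_of_bounds hm hM hMe b1 b2 b3 b4 ez.symm ew.symm
    ext
    · simp only [Prod.fst_sub] at e1; linarith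
    · simp only [Prod.snd_sub] at e2; linarith
  · intro p hp
    obtain ⟨b1, b2, b3, b4⟩ := hb _ _ hp
    let D : (ℝ × ℝ) →L[ℝ] (ℝ × ℝ) := (fderiv ℝ F p).prod (fderiv ℝ G p)
    have hD : Function.Injective D := by
      rw [injective_iff_map_eq_zero]
      intro v hv
      have hv1 : fderiv ℝ F p v = 0 := congrArg Prod.fst hv
      have hv2 : fderiv ℝ G p v = 0 := congrArg Prod.snd hv
      rw [fderiv_apply_eq_dx_dy] at hv1 hv2
      obtain ⟨e1, e2⟩ := eq_zero_of_bounds hm hM hMe b1 b2 b3 b4 hv1 hv2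
      ext <;> assumption
    let L : (ℝ × ℝ) ≃ₗ[ℝ] (ℝ × ℝ) := LinearEquiv.ofInjectiveEndo D.toLinearMap hD
    refine ⟨L.toContinuousLinearEquiv, ?_⟩
    have : (L.toContinuousLinearEquiv : (ℝ × ℝ) →L[ℝ] (ℝ × ℝ)) = D := by
      ext <;> simp [L]
    rw [this]
    exact (h.fst.smooth.hasFDerivAt_infty p).prodMk (h.snd.smooth.hasFDerivAt_infty p)

theorem surjective_boundary (hb : 0 < b) (h : StripCoord a b F G) (x : ℝ) :
    ∃ s, F (s, 0) = x := h.fst.surjective hb 0 x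

end StripCoord

namespace StripCoord

variable {a b : ℝ} {F G : ℝ × ℝ → ℝ}

/-- The germ along the boundary of the inverse of a change of coordinates. -/
theorem exists_inverse_germ (ha : 0 < a) (hb : 0 < b) (h : StripCoord a b F G) :
    ∃ K : ℝ × ℝ → ℝ × ℝ, (∀ᶠ q in stripNhds, ContDiffAt ℝ ∞ K q) ∧
      (∀ᶠ q in stripNhds, K (q.1 + b, q.2) = ((K q).1 + a, (K q).2)) ∧
      (∀ᶠ q in stripNhds, F (K q) = q.1 ∧ G (K q) = q.2) ∧
      ∀ᶠ p in stripNhds, K (F p, G p) = p := by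
  obtain ⟨r, hr, hinj, hder⟩ := h.exists_injOn ha
  set H : ℝ × ℝ → ℝ × ℝ := fun p => (F p, G p) with hH
  set band : Set (ℝ × ℝ) := {p | |p.2| < r} with hband
  have hbandOpen : IsOpen band := isOpen_lt (by fun_prop) continuous_const
  have hHs : ContDiff ℝ ∞ H := h.fst.smooth.prodMk h.snd.smooth
  -- A set-theoretic inverse on the whole band. It is smooth because injectivity makes it coincide
  -- locally with the inverses given by the inverse function theorem.
  set K := Function.invFunOn H band
  have hK1 : ∀ q ∈ H '' band, K q ∈ band ∧ H (K q) = q := fun q hq =>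
    ⟨Function.invFunOn_mem hq, Function.invFunOn_eq hq⟩
  have hK2 : ∀ p ∈ band, K (H p) = p := fun p hp =>
    hinj (hK1 _ ⟨p, hp, rfl⟩).1 hp (hK1 _ ⟨p, hp, rfl⟩).2
  have hopen : ∀ q ∈ H '' band, H '' band ∈ 𝓝 q := by
    rintro q ⟨p, hp, rfl⟩
    obtain ⟨e, he⟩ := hder p hp
    rw [← (hHs.contDiffAt.hasStrictFDerivAt' he (by simp)).map_nhds_eq_of_equiv]
    exact image_mem_map (hbandOpen.mem_nhds hp)
  have htrans : ∀ s y, (s + a, y) ∈ band ↔ (s, y) ∈ band := fun s y => by simp [hband]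
  have himg : ∀ x y, (x, y) ∈ H '' band → (x + b, y) ∈ H '' band := by
    rintro x y ⟨p, hp, e⟩
    refine ⟨(p.1 + a, p.2), (htrans _ _).2 hp, ?_⟩
    simp only [hH, Prod.mk.injEq] at e ⊢
    rw [h.fst.map_add, h.snd.map_add, e.1, e.2]
    simp
  have himg' : ∀ x y, (x + b, y) ∈ H '' band → (x, y) ∈ H '' band := by
    rintro x y ⟨p, hp, e⟩
    have hq : ((p.1 - a) + a, p.2) = p := by simp
    refine ⟨(p.1 - a, p.2), (htrans _ _).1 (by rwa [hq]), ?_⟩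
    have e1 := h.fst.map_add (p.1 - a) p.2
    have e2 := h.snd.map_add (p.1 - a) p.2
    rw [hq] at e1 e2
    simp only [hH, Prod.mk.injEq] at e ⊢
    constructor <;> linarith [e.1, e.2]
  have hev : ∀ᶠ q in stripNhds, q ∈ H '' band := by
    refine eventually_stripNhds_of_periodic hb (fun s y => ⟨himg' s y, himg s y⟩) fun x => ?_
    obtain ⟨s, hs⟩ := h.surjective_boundary hb x
    exact hopen _ ⟨(s, 0), by simp [hband, hr], by simp [hH, hs, h.snd_zero]⟩
  refine ⟨K, ?_, ?_, ?_, ?_⟩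
  · filter_upwards [hev] with q hq
    obtain ⟨p, hp, rfl⟩ := hq
    obtain ⟨e, he⟩ := hder p hp
    have hc : ContDiffAt ℝ ∞ H p := hHs.contDiffAt
    refine (hc.to_localInverse he (by simp)).congr_of_eventuallyEq ?_
    have hst := hc.hasStrictFDerivAt' he (by simp)
    filter_upwards [hst.eventually_right_inverse,
      hst.localInverse_tendsto.eventually (hbandOpen.mem_nhds hp)] with q h1 h2
    change K q = hst.localInverse H e p q
    conv_lhs => rw [← h1]
    exact hK2 _ h2
  · filter_upwards [hev] with q hq
    obtain ⟨p, hp, rfl⟩ := hq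
    have : (F p + b, G p) = H (p.1 + a, p.2) := by
      simp [hH, h.fst.map_add, h.snd.map_add]
    simp only [hH] at this ⊢
    rw [this, hK2 _ hp, hK2 _ ((htrans _ _).2 hp)]
  · filter_upwards [hev] with q hq
    have := (hK1 q hq).2
    simp only [hH] at this
    exact ⟨congrArg Prod.fst this, congrArg Prod.snd this⟩
  · exact eventually_stripNhds_iff.2 ⟨r, hr, fun s y hy => hK2 (s, y) hy⟩

theorem _root_.eventually_nhds_of_stripNhds {P : ℝ × ℝ → Prop} (h : ∀ᶠ p in stripNhds, P p)
    (s : ℝ) : ∀ᶠ p in 𝓝 (s, (0 : ℝ)), P p := by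
  refine Filter.Eventually.filter_mono ?_ h
  exact (continuous_snd.tendsto (s, (0 : ℝ))).le_comap

theorem _root_.eventually_nhds_fst_of_stripNhds {P : ℝ × ℝ → Prop} (h : ∀ᶠ p in stripNhds, P p)
    (s : ℝ) : ∀ᶠ t in 𝓝 (0 : ℝ), P (s, t) :=
  (show Tendsto (fun t : ℝ => (s, t)) (𝓝 0) (𝓝 (s, 0)) from
    (Continuous.tendsto (by fun_prop) _)).eventually (eventually_nhds_of_stripNhds h s)

/-- The chain rule along vertical lines. -/
theorem _root_.hasDerivAt_comp_prod {F : ℝ × ℝ → ℝ} (hF : ContDiff ℝ ∞ F) {u v : ℝ → ℝ}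
    {u' v' t : ℝ} (hu : HasDerivAt u u' t) (hv : HasDerivAt v v' t) :
    HasDerivAt (fun t => F (u t, v t)) (u' * dx F (u t, v t) + v' * dy F (u t, v t)) t := by
  have := (hF.hasFDerivAt_infty (u t, v t)).comp_hasDerivAt t (hu.prodMk hv)
  rw [fderiv_apply_eq_dx_dy] at this
  exact this

/-- A change of coordinates is invertible near the boundary, and the inverse is a change of
coordinates. -/
theorem exists_inverse (ha : 0 < a) (hb : 0 < b) (h : StripCoord a b F G) :
    ∃ P Q : ℝ × ℝ → ℝ, StripCoord b a P Q ∧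
      (∀ᶠ q in stripNhds, F (P q, Q q) = q.1 ∧ G (P q, Q q) = q.2) ∧
      ∀ᶠ p in stripNhds, P (F p, G p) = p.1 ∧ Q (F p, G p) = p.2 := by
  obtain ⟨K, h1, h2, h3, h4⟩ := h.exists_inverse_germ ha hb
  obtain ⟨P, hP, hPK⟩ := exists_isLift_eventuallyEq (b := a) (f := fun q => (K q).1) hb
    (h1.mono fun q hq => hq.fst) (h2.mono fun q hq => by rw [hq])
  obtain ⟨Q, hQ, hQK⟩ := exists_isLift_eventuallyEq (b := 0) (f := fun q => (K q).2) hb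
    (h1.mono fun q hq => hq.snd) (h2.mono fun q hq => by rw [hq]; simp)
  have hr : ∀ᶠ q in stripNhds, F (P q, Q q) = q.1 ∧ G (P q, Q q) = q.2 := by
    filter_upwards [h3, hPK, hQK] with q e1 e2 e3
    rw [e2, e3]
    exact e1
  have hl : ∀ᶠ p in stripNhds, P (F p, G p) = p.1 ∧ Q (F p, G p) = p.2 := by
    have ht := h.tendsto_strip ha
    filter_upwards [h4, ht.eventually hPK, ht.eventually hQK] with p e1 e2 e3
    rw [e2, e3, e1]
    exact ⟨rfl, rfl⟩
  have hQ0 : ∀ x, Q (x, 0) = 0 := by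
    intro x
    obtain ⟨s, rfl⟩ := h.surjective_boundary hb x
    have := (eventually_nhds_of_stripNhds hl s).self_of_nhds.2
    rwa [h.snd_zero] at this
  refine ⟨P, Q, ⟨hP, hQ, hQ0, fun x => ?_, fun x => ?_⟩, hr, hl⟩
  -- Differentiating `F (P (t, 0), 0) = t` shows that `dx P` and `dx F` have product `1`.
  · have e : (fun t => F (P (t, 0), 0)) = fun t => t := by
      funext t
      have := (eventually_nhds_of_stripNhds hr t).self_of_nhds.1
      rwa [hQ0] at this
    have d := hasDerivAt_comp_prod h.fst.smooth
      (hasDerivAt_fst_of_contDiff hP.smooth x 0) (hasDerivAt_const x (0 : ℝ))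
    rw [e] at d
    have := d.unique (hasDerivAt_id x)
    have hpos := h.dx_pos (P (x, 0))
    by_contra hneg
    nlinarith
  -- Differentiating `G (P, Q) = t` at the boundary: the `dx G` term vanishes there, leaving `dy Q *
  -- dy G = 1`.
  · have e : (fun t => G (P (x, t), Q (x, t))) =ᶠ[𝓝 0] fun t => t :=
      (eventually_nhds_fst_of_stripNhds hr x).mono fun t ht => ht.2
    have d := hasDerivAt_comp_prod h.snd.smooth
      (hasDerivAt_snd_of_contDiff hP.smooth x 0) (hasDerivAt_snd_of_contDiff hQ.smooth x 0)
    have := d.unique ((hasDerivAt_id (0 : ℝ)).congr_of_eventuallyEq e)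
    rw [hQ0, dx_eq_zero_of_boundary h.snd.smooth h.snd_zero] at this
    have hpos := h.dy_pos (P (x, 0))
    by_contra hneg
    nlinarith

end StripCoord

/-! ### The chord angle as a function of position and displacement -/

/-- The properties used here of the function sending `(s, d)` to the angle between the tangent at
the boundary point `s` and the chord from `s` to `s + d`. -/
structure IsChordAngle (ℓ : ℝ) (A : ℝ × ℝ → ℝ) : Prop where
  lift : IsLift ℓ 0 A
  zero : ∀ s, A (s, 0) = 0
  dy_pos : ∀ s, 0 < dy A (s, 0)

/-- The collision following `(s, A (s, d))`: it takes place at `s + d`. -/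
def nextPoint (A : ℝ × ℝ → ℝ) (p : ℝ × ℝ) : ℝ × ℝ := (p.1 + p.2, -A (p.1 + p.2, -p.2))

theorem isLift_fst (a : ℝ) : IsLift a a Prod.fst := ⟨contDiff_fst, fun _ _ => rfl⟩

theorem isLift_snd (a : ℝ) : IsLift a 0 Prod.snd := ⟨contDiff_snd, fun s y => by simp⟩

theorem dx_fst (p : ℝ × ℝ) : dx (Prod.fst : ℝ × ℝ → ℝ) p = 1 := by
  simp [dx, fderiv_fst]

theorem dy_snd (p : ℝ × ℝ) : dy (Prod.snd : ℝ × ℝ → ℝ) p = 1 := by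
  simp [dy, fderiv_snd]

theorem tendsto_stripNhds_of_snd_eq {l : Filter (ℝ × ℝ)} (hl : l ≤ stripNhds) (f : ℝ × ℝ → ℝ) :
    Tendsto (fun p => (f p, p.2)) l stripNhds :=
  tendsto_stripNhds_iff.2 (tendsto_snd_stripNhds.mono_left hl)

theorem tendsto_stripNhdsPos_of_snd_eq (f : ℝ × ℝ → ℝ) :
    Tendsto (fun p => (f p, p.2)) stripNhdsPos stripNhdsPos :=
  tendsto_stripNhdsPos_iff.2
    ⟨tendsto_snd_stripNhds.mono_left stripNhdsPos_le, eventually_stripNhdsPos_pos⟩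

theorem tendsto_stripNhds_neg (f : ℝ × ℝ → ℝ) :
    Tendsto (fun p => (f p, -p.2)) stripNhds stripNhds :=
  tendsto_stripNhds_iff.2 (by simpa using tendsto_snd_stripNhds.neg)

namespace IsChordAngle

variable {ℓ : ℝ} {A : ℝ × ℝ → ℝ}

theorem stripCoord (hA : IsChordAngle ℓ A) : StripCoord ℓ ℓ Prod.fst A :=
  ⟨isLift_fst ℓ, hA.lift, hA.zero, fun s => by simp [dx_fst], hA.dy_pos⟩

/-- `D` recovers the displacement from the position and the angle; it comes from inverting `(s, d) ↦
(s, A (s, d))`. Since `D` also satisfies `IsChordAngle`, every estimate for `A` applies to it. -/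
theorem exists_inverse (hℓ : 0 < ℓ) (hA : IsChordAngle ℓ A) :
    ∃ D, IsChordAngle ℓ D ∧ (∀ᶠ q in stripNhds, A (q.1, D q) = q.2) ∧
      ∀ᶠ p in stripNhds, D (p.1, A p) = p.2 := by
  obtain ⟨P, D, h, h1, h2⟩ := hA.stripCoord.exists_inverse hℓ hℓ
  refine ⟨D, ⟨h.snd, h.snd_zero, h.dy_pos⟩, ?_, h2.mono fun p hp => hp.2⟩
  filter_upwards [h1] with q hq
  have := hq.2
  rwa [show P q = q.1 from hq.1] at this

theorem tendsto_zero (hℓ : 0 < ℓ) (hA : IsChordAngle ℓ A) : Tendsto A stripNhds (𝓝 0) :=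
  hA.lift.tendsto_zero hℓ hA.zero

theorem tendsto_nextPoint (hℓ : 0 < ℓ) (hA : IsChordAngle ℓ A) :
    Tendsto (nextPoint A) stripNhds stripNhds :=
  tendsto_stripNhds_iff.2 (by
    simpa [nextPoint] using
      ((hA.tendsto_zero hℓ).comp (tendsto_stripNhds_neg fun p => p.1 + p.2)).neg)

theorem tendsto_angle_pos (hℓ : 0 < ℓ) (hA : IsChordAngle ℓ A) :
    Tendsto (fun p => (p.1, A p)) stripNhdsPos stripNhdsPos :=
  hA.stripCoord.tendsto_stripPos hℓ

end IsChordAngle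

/-! ### From the normal form to a small reflection defect -/

/-- The defect in the reflection law of the triple `S(ξ - η, η), S(ξ, η), S(ξ + η, η)`. -/
def reflectionDefect (A S : ℝ × ℝ → ℝ) (q : ℝ × ℝ) : ℝ :=
  A (S q, S (q.1 + q.2, q.2) - S q) + A (S q, S (q.1 - q.2, q.2) - S q)

theorem isLift_shift_sub {S : ℝ × ℝ → ℝ} {a b : ℝ} (hS : IsLift a b S) :
    IsLift a 0 (fun q => S (q.1 + q.2, q.2) - S q) := by
  refine ⟨?_, fun s y => ?_⟩
  · have := hS.smooth
    fun_prop
  · have := hS.map_add (s + y) y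
    simp only [show s + a + y = s + y + a by ring, this, hS.map_add]
    ring

section Core

variable {ℓ : ℝ} {A X Y : ℝ × ℝ → ℝ} {N : ℕ}

/-- `S` is the first component of the inverse of `(X, Y)`. One step of the map gives the chord angle
of `S (ξ, η)`, `S (ξ + η, η)` at both of its ends, namely `Φ (ξ, η)` and `Φ (ξ + η, η)` up to the
error. In the defect the two occurrences of `Φ` cancel. -/
theorem exists_even_of_conjugation (hℓ : 0 < ℓ) (hA : IsChordAngle ℓ A)
    (hXY : StripCoord ℓ 1 X Y) (hXe : ∀ s y, X (s, -y) = X (s, y))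
    (hYo : ∀ s y, Y (s, -y) = -Y (s, y))
    (hX : (fun p => X (nextPoint A p) - X (p.1, A p) - Y (p.1, A p))
      =O[stripNhdsPos] fun p => p.2 ^ N)
    (hY : (fun p => Y (nextPoint A p) - Y (p.1, A p)) =O[stripNhdsPos] fun p => p.2 ^ N) :
    ∃ S, IsLift 1 ℓ S ∧ (∀ ξ, 0 < dx S (ξ, 0)) ∧ (∀ᶠ q in stripNhds, S (q.1, -q.2) = S q) ∧
      reflectionDefect A S =O[stripNhdsPos] fun q => q.2 ^ N := by
  obtain ⟨S, Φ, hSΦ, hr, hl⟩ := hXY.exists_inverse hℓ one_pos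
  obtain ⟨D, hD, hD1, hD2⟩ := hA.exists_inverse hℓ
  refine ⟨S, hSΦ.fst, hSΦ.dx_pos, ?_, ?_⟩
  -- By the parities of `X` and `Y`, the point `(S, -Φ)` is sent to `(ξ, -η)`; applying the inverse
  -- gives `S (ξ, -η) = S (ξ, η)`.
  · have ht : Tendsto (fun q => (S q, -Φ q)) stripNhds stripNhds :=
      (tendsto_stripNhds_neg Prod.fst).comp (hSΦ.tendsto_strip one_pos)
    filter_upwards [hr, ht.eventually hl] with q h1 h2
    rw [hXe, hYo, h1.1, h1.2] at h2
    exact h2.1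
  have hSp := hSΦ.tendsto_stripPos one_pos
  have hS0 := hSp.mono_right stripNhdsPos_le
  -- The collision with new coordinates `(ξ, η)`, expressed by its position and the displacement to
  -- the next collision.
  set u : ℝ × ℝ → ℝ × ℝ := fun q => (S q, D (S q, Φ q)) with hu
  have hup : Tendsto u stripNhdsPos stripNhdsPos := (hD.tendsto_angle_pos hℓ).comp hSp
  have hu0 : Tendsto u stripNhdsPos stripNhds := hup.mono_right stripNhdsPos_le
  have huO : (fun q => (u q).2) =O[stripNhdsPos] (Prod.snd : ℝ × ℝ → ℝ) :=
    ((hD.lift.isBigO_snd hℓ hD.zero).comp_tendsto hS0).trans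
      ((hSΦ.snd.isBigO_snd one_pos hSΦ.snd_zero).mono stripNhdsPos_le)
  have huN : (fun q => (u q).2 ^ N) =O[stripNhdsPos] (fun q => q.2 ^ N) := huO.pow N
  have hAu : ∀ᶠ q in stripNhdsPos, A (u q) = Φ q := hS0.eventually hD1
  have hTu : Tendsto (fun q => nextPoint A (u q)) stripNhdsPos stripNhds :=
    (hA.tendsto_nextPoint hℓ).comp hu0
  have hrp := stripNhdsPos_le hr
  have eX : (fun q => X (nextPoint A (u q)) - (q.1 + q.2)) =O[stripNhdsPos]
      (fun q => q.2 ^ N) := by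
    refine ((hX.comp_tendsto hup).trans huN).congr' ?_ EventuallyEq.rfl
    filter_upwards [hAu, hrp] with q h1 h2
    simp only [Function.comp, h1]
    rw [show X ((u q).1, Φ q) = q.1 from h2.1, show Y ((u q).1, Φ q) = q.2 from h2.2]
    ring
  have eY : (fun q => Y (nextPoint A (u q)) - q.2) =O[stripNhdsPos] (fun q => q.2 ^ N) := by
    refine ((hY.comp_tendsto hup).trans huN).congr' ?_ EventuallyEq.rfl
    filter_upwards [hAu, hrp] with q h1 h2
    simp only [Function.comp, h1]
    rw [show Y ((u q).1, Φ q) = q.2 from h2.2]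
  have hXYT : Tendsto (fun q => (X (nextPoint A (u q)), Y (nextPoint A (u q)))) stripNhdsPos
      stripNhds := (hXY.tendsto_strip hℓ).comp hTu
  have hplus : Tendsto (fun q : ℝ × ℝ => (q.1 + q.2, q.2)) stripNhdsPos stripNhds :=
    tendsto_stripNhds_of_snd_eq stripNhdsPos_le _
  have hlT := hTu.eventually hl
  have e1 : (fun q => S q + (u q).2 - S (q.1 + q.2, q.2)) =O[stripNhdsPos]
      (fun q => q.2 ^ N) := by
    refine (hSΦ.fst.sub_isBigO one_pos hXYT hplus eX eY).congr' ?_ EventuallyEq.rfl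
    filter_upwards [hlT] with q h1
    rw [h1.1]
    rfl
  have e2 : (fun q => -A (S q + (u q).2, -(u q).2) - Φ (q.1 + q.2, q.2)) =O[stripNhdsPos]
      (fun q => q.2 ^ N) := by
    refine (hSΦ.snd.sub_isBigO one_pos hXYT hplus eX eY).congr' ?_ EventuallyEq.rfl
    filter_upwards [hlT] with q h1
    rw [h1.2]
    rfl
  have hJ0 : Tendsto (fun q => S (q.1 + q.2, q.2) - S q) stripNhdsPos (𝓝 0) :=
    ((isLift_shift_sub hSΦ.fst).tendsto_zero one_pos (fun s => by simp)).mono_left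
      stripNhdsPos_le
  have hzero : (fun _ : ℝ × ℝ => (0 : ℝ)) =O[stripNhdsPos] (fun q => q.2 ^ N) :=
    isBigO_zero _ _
  have f1 : (fun q => A (S q, S (q.1 + q.2, q.2) - S q) - Φ q) =O[stripNhdsPos]
      (fun q => q.2 ^ N) := by
    have := hA.lift.sub_isBigO hℓ (u := fun q => (S q, S (q.1 + q.2, q.2) - S q)) (v := u)
      (tendsto_stripNhds_iff.2 hJ0) hu0 (by simpa [hu] using hzero)
      (e1.neg_left.congr_left fun q => by ring)
    refine this.congr' ?_ EventuallyEq.rfl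
    filter_upwards [hAu] with q h1
    rw [h1]
  have f2 : (fun q => A (S (q.1 + q.2, q.2), S q - S (q.1 + q.2, q.2)) + Φ (q.1 + q.2, q.2))
      =O[stripNhdsPos] (fun q => q.2 ^ N) := by
    have := hA.lift.sub_isBigO hℓ
      (u := fun q => (S (q.1 + q.2, q.2), S q - S (q.1 + q.2, q.2)))
      (v := fun q => (S q + (u q).2, -(u q).2)) (e := fun q => q.2 ^ N) (l := stripNhdsPos)
      (tendsto_stripNhds_iff.2 (by simpa using hJ0.neg))
      (tendsto_stripNhds_iff.2 (by simpa using (tendsto_stripNhds_iff.1 hu0).neg))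
      (e1.neg_left.congr_left fun q => by ring) (e1.congr_left fun q => by ring)
    exact (this.sub e2).congr_left fun q => by ring
  -- Replacing `ξ` by `ξ - η` turns the relation at the arrival point into one at `S (ξ, η)`, with
  -- previous point `S (ξ - η, η)`.
  have f3 := f2.comp_tendsto (tendsto_stripNhdsPos_of_snd_eq fun q => q.1 - q.2)
  refine (f1.add f3).congr_left fun q => ?_
  simp only [Function.comp, sub_add_cancel, reflectionDefect]
  ring

/-- A translation of the first variable, depending on the second one, fixes the base point. -/
theorem exists_fixed_base (hℓ : 0 < ℓ) {S : ℝ × ℝ → ℝ} (hS : IsLift 1 ℓ S)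
    (hSx : ∀ ξ, 0 < dx S (ξ, 0)) (hSe : ∀ᶠ q in stripNhds, S (q.1, -q.2) = S q)
    (hdef : reflectionDefect A S =O[stripNhdsPos] fun q => q.2 ^ N) :
    ∃ S, IsLift 1 ℓ S ∧ (∀ ξ, 0 < dx S (ξ, 0)) ∧ (∀ᶠ q in stripNhds, S (q.1, -q.2) = S q) ∧
      (∀ᶠ q in stripNhds, S (0, q.2) = S (0, 0)) ∧
      reflectionDefect A S =O[stripNhdsPos] fun q => q.2 ^ N := by
  have hc : StripCoord 1 ℓ S Prod.snd :=
    ⟨hS, isLift_snd 1, fun s => rfl, hSx, fun s => by simp [dy_snd]⟩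
  obtain ⟨R, Q, hR, hr, hl⟩ := hc.exists_inverse one_pos hℓ
  have hr' : ∀ᶠ q in stripNhds, S (R q, q.2) = q.1 := by
    filter_upwards [hr] with q hq
    rw [← hq.1]
    congr 2
    exact hq.2.symm
  set o := S (0, 0)
  -- The solution of `S (α y, y) = S (0, 0)`. It is even in `y` because `S` is even and `S (·, y)`
  -- is injective for small `y`.
  set α : ℝ → ℝ := fun y => R (o, y)
  have hα : ContDiff ℝ ∞ α := by
    have := hR.fst.smooth
    fun_prop
  have ht : ∀ f : ℝ × ℝ → ℝ, Tendsto (fun q => (f q, q.2)) stripNhds stripNhds := fun f =>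
    tendsto_stripNhds_of_snd_eq le_rfl f
  have hαS : ∀ᶠ q in stripNhds, S (α q.2, q.2) = o := (ht fun _ => o).eventually hr'
  have hαe : ∀ᶠ q in stripNhds, α (-q.2) = α q.2 := by
    filter_upwards [hαS, (tendsto_stripNhds_neg fun q => q.1).eventually hαS,
      (ht fun q => α (-q.2)).eventually hSe, (ht fun q => α (-q.2)).eventually hl,
      (ht fun q => α q.2).eventually hl] with q h1 h2 h3 h4 h5
    rw [← h4.1, ← h5.1, ← h3, h2, h1]
  refine ⟨fun q => S (q.1 + α q.2, q.2), ⟨?_, ?_⟩, ?_, ?_, ?_, ?_⟩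
  · have := hS.smooth
    fun_prop
  · intro s y
    simp only [show s + 1 + α y = s + α y + 1 by ring, hS.map_add]
  · intro ξ
    have hsm : ContDiff ℝ ∞ fun q : ℝ × ℝ => S (q.1 + α q.2, q.2) := by
      have := hS.smooth
      fun_prop
    have h1 := hasDerivAt_fst_of_contDiff hsm ξ 0
    have h2 := (hasDerivAt_fst_of_contDiff hS.smooth (ξ + α 0) 0).comp_add_const ξ (α 0)
    rw [h1.unique h2]
    exact hSx _
  · filter_upwards [hαe, (ht fun q => q.1 + α q.2).eventually hSe] with q h1 h2
    rw [h1]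
    exact h2
  · have h0 : S (α 0, 0) = o := by
      have := eventually_nhds_of_stripNhds hαS 0
      exact this.self_of_nhds
    filter_upwards [hαS] with q hq
    simp only [zero_add]
    rw [hq, h0]
  -- All three points in the defect have the same `η`, so they are translated by the same amount.
  · refine (hdef.comp_tendsto (tendsto_stripNhdsPos_of_snd_eq fun q => q.1 + α q.2)).congr_left
      fun q => ?_
    simp only [Function.comp, reflectionDefect, add_right_comm, sub_add_eq_add_sub]

end Core

theorem dy_eq_of_hasDerivAt {f : ℝ × ℝ → ℝ} (hf : ContDiff ℝ ∞ f) {s c : ℝ}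
    (h : HasDerivAt (fun t => f (s, t)) c 0) : dy f (s, 0) = c :=
  (hasDerivAt_snd_of_contDiff hf s 0).unique h

namespace IsChordAngle

variable {ℓ : ℝ} {A : ℝ × ℝ → ℝ}

/-- At `d = 0` the `dx A` contribution vanishes and the two minus signs cancel, so the arrival angle
has the same transverse derivative as `A`. The estimates for `A` thus hold for the arrival angle
too. -/
theorem nextAngle (hA : IsChordAngle ℓ A) : IsChordAngle ℓ (fun p => (nextPoint A p).2) := by
  have hsm : ContDiff ℝ ∞ fun p => (nextPoint A p).2 := by
    have := hA.lift.smooth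
    simp only [nextPoint]
    fun_prop
  refine ⟨⟨hsm, fun s y => ?_⟩, fun s => by simp [nextPoint, hA.zero], fun s => ?_⟩
  · simp only [nextPoint, show s + ℓ + y = s + y + ℓ by ring, hA.lift.map_add]
    ring
  · have h1 : HasDerivAt (fun t : ℝ => s + t) 1 0 := (hasDerivAt_id (0 : ℝ)).const_add s
    have h2 : HasDerivAt (fun t : ℝ => -t) (-1) 0 := (hasDerivAt_id (0 : ℝ)).neg
    have h3 := (hasDerivAt_comp_prod hA.lift.smooth h1 h2).neg
    rw [dy_eq_of_hasDerivAt hsm h3]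
    simp only [add_zero, neg_zero, dx_eq_zero_of_boundary hA.lift.smooth hA.zero]
    linarith [hA.dy_pos s]

theorem tendsto_nextPoint_pos (hℓ : 0 < ℓ) (hA : IsChordAngle ℓ A) :
    Tendsto (nextPoint A) stripNhdsPos stripNhdsPos :=
  hA.nextAngle.lift.tendsto_pos hℓ hA.nextAngle.zero hA.nextAngle.dy_pos fun p => p.1 + p.2

theorem isBigO_snd (hℓ : 0 < ℓ) (hA : IsChordAngle ℓ A) :
    A =O[stripNhdsPos] (Prod.snd : ℝ × ℝ → ℝ) :=
  (hA.lift.isBigO_snd hℓ hA.zero).mono stripNhdsPos_le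

end IsChordAngle

/-! ### From a small reflection defect to approximate coordinates -/

section Converse

variable {ℓ : ℝ} {A S : ℝ × ℝ → ℝ} {N : ℕ}

theorem stripCoord_shift_sub (hS : IsLift 1 ℓ S) (hSx : ∀ ξ, 0 < dx S (ξ, 0)) :
    StripCoord 1 ℓ S (fun q => S (q.1 + q.2, q.2) - S q) := by
  have hJ := isLift_shift_sub hS
  refine ⟨hS, hJ, fun s => by simp, hSx, fun s => ?_⟩
  have h1 : HasDerivAt (fun t : ℝ => s + t) 1 0 := (hasDerivAt_id (0 : ℝ)).const_add s
  have h2 := hasDerivAt_comp_prod hS.smooth h1 (hasDerivAt_id (0 : ℝ))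
  have h3 := h2.sub (hasDerivAt_snd_of_contDiff hS.smooth s 0)
  rw [dy_eq_of_hasDerivAt hJ.smooth h3]
  simp only [id, add_zero]
  linarith [hSx s]

/-- The transverse derivative at the boundary is the product of `dx S` and `dy A`: the displacement
grows like `η * dx S`, and the angle linearly in the displacement. -/
theorem stripCoord_chord (hA : IsChordAngle ℓ A) (hS : IsLift 1 ℓ S)
    (hSx : ∀ ξ, 0 < dx S (ξ, 0)) :
    StripCoord 1 ℓ S (fun q => A (S q, S (q.1 + q.2, q.2) - S q)) := by
  have hJ := stripCoord_shift_sub hS hSx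
  have hsm : ContDiff ℝ ∞ fun q => A (S q, S (q.1 + q.2, q.2) - S q) :=
    hA.lift.smooth.comp (hS.smooth.prodMk hJ.snd.smooth)
  refine ⟨hS, ⟨hsm, fun s y => ?_⟩, fun s => by simp [hA.zero], hSx, fun s => ?_⟩
  · have := hJ.snd.map_add s y
    simp only at this
    rw [this, hS.map_add, hA.lift.map_add]
    simp
  · have h4 := hasDerivAt_comp_prod hA.lift.smooth
      (hasDerivAt_snd_of_contDiff hS.smooth s 0) (hasDerivAt_snd_of_contDiff hJ.snd.smooth s 0)
    rw [dy_eq_of_hasDerivAt hsm h4]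
    simp only [add_zero, sub_self, dx_eq_zero_of_boundary hA.lift.smooth hA.zero]
    have := mul_pos (hJ.dy_pos s) (hA.dy_pos (S (s, 0)))
    linarith

/-- `(P, Q)` inverts `(S, B)`. The next point of `(S, B)(ξ, η)` is exactly `(S (ξ + η, η), -B (ξ +
η, -η))`, so both approximate parity and approximate conjugation reduce to the approximate oddness
of `B`. -/
theorem exists_conjugation (hℓ : 0 < ℓ) (hA : IsChordAngle ℓ A) (hS : IsLift 1 ℓ S)
    (hSx : ∀ ξ, 0 < dx S (ξ, 0)) (hSe : ∀ᶠ q in stripNhds, S (q.1, -q.2) = S q)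
    (hdef : reflectionDefect A S =O[stripNhdsPos] fun q => q.2 ^ N) :
    ∃ P Q, StripCoord ℓ 1 P Q ∧
      (fun p => P (p.1, -p.2) - P p) =O[stripNhdsPos] (fun p => p.2 ^ N) ∧
      (fun p => Q (p.1, -p.2) + Q p) =O[stripNhdsPos] (fun p => p.2 ^ N) ∧
      (fun p => P (nextPoint A p) - P (p.1, A p) - Q (p.1, A p)) =O[stripNhdsPos]
        (fun p => p.2 ^ N) ∧
      (fun p => Q (nextPoint A p) - Q (p.1, A p)) =O[stripNhdsPos] fun p => p.2 ^ N := by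
  have hSB := stripCoord_chord hA hS hSx
  set B : ℝ × ℝ → ℝ := fun q => A (S q, S (q.1 + q.2, q.2) - S q) with hBdef
  obtain ⟨P, Q, hPQ, hr, hl⟩ := hSB.exists_inverse one_pos hℓ
  obtain ⟨D, hD, -, hD2⟩ := hA.exists_inverse hℓ
  have hneg : Tendsto (fun q : ℝ × ℝ => (q.1, -q.2)) stripNhds stripNhds :=
    tendsto_stripNhds_neg _
  have hplus : Tendsto (fun q : ℝ × ℝ => (q.1 + q.2, q.2)) stripNhds stripNhds :=
    tendsto_stripNhds_of_snd_eq le_rfl _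
  have hminus : Tendsto (fun q : ℝ × ℝ => (q.1 - q.2, q.2)) stripNhds stripNhds :=
    tendsto_stripNhds_of_snd_eq le_rfl _
  have hplusP : Tendsto (fun q : ℝ × ℝ => (q.1 + q.2, q.2)) stripNhdsPos stripNhdsPos :=
    tendsto_stripNhdsPos_of_snd_eq _
  -- Since `S` is even, `B (ξ, -η)` is the chord angle from `S (ξ, η)` to `S (ξ - η, η)`, and the
  -- sum is the reflection defect.
  have hB : (fun q => B q + B (q.1, -q.2)) =O[stripNhdsPos] fun q => q.2 ^ N := by
    refine hdef.congr' ?_ EventuallyEq.rfl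
    filter_upwards [stripNhdsPos_le hSe, stripNhdsPos_le (hminus.eventually hSe)] with q h1 h2
    simp only [hBdef, reflectionDefect]
    rw [h1, ← h2]
    rfl
  have hPQp := hPQ.tendsto_stripPos hℓ
  have hQO : (fun p => Q p ^ N) =O[stripNhdsPos] (fun p => p.2 ^ N) :=
    ((hPQ.snd.isBigO_snd hℓ hPQ.snd_zero).mono stripNhdsPos_le).pow N
  have hSBn : Tendsto (fun q => (S q, -B q)) stripNhdsPos stripNhds :=
    (hneg.comp (hSB.tendsto_strip one_pos)).mono_left stripNhdsPos_le
  have hSBw : Tendsto (fun q => (S q, B (q.1, -q.2))) stripNhdsPos stripNhds := by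
    have := tendsto_stripNhds_iff.1 ((hSB.tendsto_strip one_pos).comp hneg)
    exact tendsto_stripNhds_iff.2 (this.mono_left stripNhdsPos_le)
  have hzero : (fun _ : ℝ × ℝ => (0 : ℝ)) =O[stripNhdsPos] (fun q => q.2 ^ N) :=
    isBigO_zero _ _
  have hd1 : (fun q => (S q, -B q).1 - (S q, B (q.1, -q.2)).1) =O[stripNhdsPos]
      (fun q => q.2 ^ N) := by simpa using hzero
  have hd2 : (fun q => (S q, -B q).2 - (S q, B (q.1, -q.2)).2) =O[stripNhdsPos]
      (fun q => q.2 ^ N) := hB.neg_left.congr_left fun q => by ring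
  have hlw : ∀ᶠ q in stripNhdsPos, P (S q, B (q.1, -q.2)) = q.1 ∧
      Q (S q, B (q.1, -q.2)) = -q.2 := by
    filter_upwards [stripNhdsPos_le (hneg.eventually hl), stripNhdsPos_le hSe] with q h1 h2
    rw [h2] at h1
    exact h1
  have hrp := stripNhdsPos_le hr
  refine ⟨P, Q, hPQ, ?_, ?_, ?_⟩
  · have h1 := (hPQ.fst.sub_isBigO hℓ hSBn hSBw hd1 hd2).comp_tendsto hPQp
    refine (h1.trans hQO).congr' ?_ EventuallyEq.rfl
    filter_upwards [hPQp.eventually hlw, hrp] with p h2 h3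
    simp only [Function.comp]
    rw [h2.1, h3.1, h3.2]
  · have h1 := (hPQ.snd.sub_isBigO hℓ hSBn hSBw hd1 hd2).comp_tendsto hPQp
    refine (h1.trans hQO).congr' ?_ EventuallyEq.rfl
    filter_upwards [hPQp.eventually hlw, hrp] with p h2 h3
    simp only [Function.comp]
    rw [h2.2, h3.1, h3.2, sub_neg_eq_add]
  set z : ℝ × ℝ → ℝ × ℝ := fun p => (P (p.1, A p), Q (p.1, A p)) with hz
  have hzp : Tendsto z stripNhdsPos stripNhdsPos := hPQp.comp (hA.tendsto_angle_pos hℓ)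
  have hz0 := hzp.mono_right stripNhdsPos_le
  have hzO : (fun p => (z p).2 ^ N) =O[stripNhdsPos] (fun p => p.2 ^ N) :=
    (hQO.comp_tendsto (hA.tendsto_angle_pos hℓ)).trans ((hA.isBigO_snd hℓ).pow N)
  have hzr : ∀ᶠ p in stripNhdsPos, S (z p) = p.1 ∧ B (z p) = A p :=
    (hA.tendsto_angle_pos hℓ).eventually hrp
  have hJ0 : Tendsto (fun q => (S q, S (q.1 + q.2, q.2) - S q)) stripNhds stripNhds :=
    tendsto_stripNhds_iff.2
      ((isLift_shift_sub hS).tendsto_zero one_pos (fun s => by simp))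
  -- Both displacements, `d` and `S (ξ + η, η) - S (ξ, η)`, produce the same angle at the same
  -- position, and `D` identifies them.
  have hSz : ∀ᶠ p in stripNhdsPos, S ((z p).1 + (z p).2, (z p).2) = p.1 + p.2 := by
    filter_upwards [hzr, stripNhdsPos_le hD2, (hJ0.comp hz0).eventually hD2] with p h1 h2 h3
    simp only [Function.comp] at h3
    change D (S (z p), B (z p)) = _ at h3
    rw [h1.1, h1.2, h2] at h3
    linarith
  set zp : ℝ × ℝ → ℝ × ℝ := fun p => ((z p).1 + (z p).2, (z p).2) with hzpdef
  have hzpp : Tendsto zp stripNhdsPos stripNhdsPos := hplusP.comp hzp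
  have hzp0 := hzpp.mono_right stripNhdsPos_le
  have hnext : ∀ᶠ p in stripNhdsPos, nextPoint A p = (S (zp p), -B ((zp p).1, -(zp p).2)) := by
    filter_upwards [hSz, hzr, hz0.eventually hSe, hzp0.eventually hSe] with p h1 h2 h3 h4
    have hb : B ((zp p).1, -(zp p).2) = A (S (zp p), S (z p) - S (zp p)) := by
      simp only [hBdef]
      rw [h4, ← h3]
      simp [hzpdef]
    rw [hb, h1, h2.1, nextPoint]
    simp
  have hu : Tendsto (fun p => (S (zp p), -B ((zp p).1, -(zp p).2))) stripNhdsPos stripNhds :=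
    (((hA.tendsto_nextPoint hℓ).mono_left stripNhdsPos_le).congr' hnext)
  have hv : Tendsto (fun p => (S (zp p), B (zp p))) stripNhdsPos stripNhds :=
    (hSB.tendsto_strip one_pos).comp hzp0
  have hBz : (fun p => -B ((zp p).1, -(zp p).2) - B (zp p)) =O[stripNhdsPos]
      (fun p => p.2 ^ N) :=
    ((hB.comp_tendsto hzpp).neg_left.trans hzO).congr_left fun q => by
      simp only [Function.comp]; ring
  have hlz := hzp0.eventually hl
  constructor
  · have := hPQ.fst.sub_isBigO hℓ hu hv (e := fun p => p.2 ^ N) (by simpa using hzero) hBz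
    refine this.congr' ?_ EventuallyEq.rfl
    filter_upwards [hnext, hlz] with p h1 h2
    rw [← h1, h2.1]
    simp only [hzpdef, hz]
    ring
  · have := hPQ.snd.sub_isBigO hℓ hu hv (e := fun p => p.2 ^ N) (by simpa using hzero) hBz
    refine this.congr' ?_ EventuallyEq.rfl
    filter_upwards [hnext, hlz] with p h1 h2
    rw [← h1, h2.2]

end Converse

/-! ### Taylor expansion and parity -/

/-- The `i`-th Taylor coefficient at `y = 0`, as a function of the first variable. -/
def taylorCoeff (f : ℝ × ℝ → ℝ) (i : ℕ) (s : ℝ) : ℝ := (dq^[i] f) (s, 0)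

section Taylor

variable {a b : ℝ} {f : ℝ × ℝ → ℝ}

theorem contDiff_iterate_dq (hf : ContDiff ℝ ∞ f) (i : ℕ) : ContDiff ℝ ∞ (dq^[i] f) := by
  induction i with
  | zero => exact hf
  | succ i ih => rw [Function.iterate_succ_apply']; exact ih.dq

theorem IsLift.iterate_dq (hf : IsLift a b f) {i : ℕ} (hi : i ≠ 0) : IsLift a 0 (dq^[i] f) := by
  induction i with
  | zero => exact absurd rfl hi
  | succ i ih =>
    rw [Function.iterate_succ_apply']
    rcases eq_or_ne i 0 with rfl | h
    · exact hf.isLift_dq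
    · exact (ih h).isLift_dq

theorem contDiff_taylorCoeff (hf : ContDiff ℝ ∞ f) (i : ℕ) : ContDiff ℝ ∞ (taylorCoeff f i) :=
  (contDiff_iterate_dq hf i).comp (by fun_prop : ContDiff ℝ ∞ fun s : ℝ => (s, (0 : ℝ)))

theorem taylorCoeff_periodic (hf : IsLift a b f) {i : ℕ} (hi : i ≠ 0) (s : ℝ) :
    taylorCoeff f i (s + a) = taylorCoeff f i s := (hf.iterate_dq hi).periodic s 0

/-- Each application of the Hadamard quotient to the remainder extracts one more power of `y`. -/
theorem eq_sum_taylorCoeff (hf : ContDiff ℝ ∞ f) (n : ℕ) (p : ℝ × ℝ) :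
    f p = ∑ i ∈ Finset.range n, taylorCoeff f i p.1 * p.2 ^ i + p.2 ^ n * (dq^[n] f) p := by
  induction n with
  | zero => simp
  | succ n ih =>
    rw [Finset.sum_range_succ, Function.iterate_succ_apply']
    conv_lhs => rw [ih, eq_add_smul_dq (contDiff_iterate_dq hf n) p]
    simp only [taylorCoeff, smul_eq_mul]
    ring

theorem sub_sum_taylorCoeff_isBigO (ha : 0 < a) (hf : IsLift a b f) {n : ℕ} (hn : n ≠ 0) :
    (fun p => f p - ∑ i ∈ Finset.range n, taylorCoeff f i p.1 * p.2 ^ i) =O[stripNhds]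
      fun p => p.2 ^ n := by
  have h := (isBigO_refl (fun p : ℝ × ℝ => p.2 ^ n) stripNhds).mul
    ((hf.iterate_dq hn).isBigO_one ha)
  simp only [mul_one] at h
  refine h.congr_left fun p => ?_
  rw [eq_sum_taylorCoeff hf.smooth n p]
  ring

theorem sum_range_two_mul (g : ℕ → ℝ) (n : ℕ) :
    ∑ i ∈ Finset.range (2 * n), g i = ∑ j ∈ Finset.range n, (g (2 * j) + g (2 * j + 1)) := by
  induction n with
  | zero => simp
  | succ n ih =>
    rw [Finset.sum_range_succ, ← ih, show 2 * (n + 1) = 2 * n + 1 + 1 by ring,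
      Finset.sum_range_succ, Finset.sum_range_succ]
    ring

theorem neg_sub_sum_taylorCoeff_isBigO (ha : 0 < a) (hf : IsLift a b f) {n : ℕ} (hn : n ≠ 0) :
    (fun p => f (p.1, -p.2) - ∑ i ∈ Finset.range n, taylorCoeff f i p.1 * (-p.2) ^ i)
      =O[stripNhds] fun p => p.2 ^ n := by
  have h1 := (sub_sum_taylorCoeff_isBigO ha hf hn).comp_tendsto
    (tendsto_stripNhds_neg Prod.fst)
  refine h1.trans (IsBigO.of_bound 1 (Eventually.of_forall fun p => ?_))
  simp

/-- Write `2 f(y) = (f(y) + f(-y)) - (f(-y) - f(y))`. The odd Taylor terms cancel in the first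
bracket, and the second is the assumed error. The odd case is similar. -/
theorem even_expansion (ha : 0 < a) (hf : IsLift a b f) {n : ℕ} (hn : n ≠ 0)
    (h : (fun p => f (p.1, -p.2) - f p) =O[stripNhdsPos] fun p => p.2 ^ (2 * n)) :
    (fun p => f p - ∑ j ∈ Finset.range n, taylorCoeff f (2 * j) p.1 * p.2 ^ (2 * j))
      =O[stripNhdsPos] fun p => p.2 ^ (2 * n) := by
  have hn' : 2 * n ≠ 0 := by omega
  have h1 := (sub_sum_taylorCoeff_isBigO ha hf hn').mono stripNhdsPos_le
  have h2 := (neg_sub_sum_taylorCoeff_isBigO ha hf hn').mono stripNhdsPos_le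
  refine (((h1.add h2).sub h).const_mul_left (1 / 2)).congr_left fun p => ?_
  have e1 : ∀ j, (-p.2) ^ (2 * j) = p.2 ^ (2 * j) := fun j => (even_two_mul j).neg_pow _
  have e2 : ∀ j, (-p.2) ^ (2 * j + 1) = -p.2 ^ (2 * j + 1) := fun j =>
    (odd_two_mul_add_one j).neg_pow _
  simp only [sum_range_two_mul, e1, e2, Finset.sum_add_distrib, mul_neg, Finset.sum_neg_distrib]
  ring

theorem odd_expansion (ha : 0 < a) (hf : IsLift a b f) {n : ℕ} (hn : n ≠ 0)
    (h : (fun p => f (p.1, -p.2) + f p) =O[stripNhdsPos] fun p => p.2 ^ (2 * n)) :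
    (fun p => f p - ∑ j ∈ Finset.range n, taylorCoeff f (2 * j + 1) p.1 * p.2 ^ (2 * j + 1))
      =O[stripNhdsPos] fun p => p.2 ^ (2 * n) := by
  have hn' : 2 * n ≠ 0 := by omega
  have h1 := (sub_sum_taylorCoeff_isBigO ha hf hn').mono stripNhdsPos_le
  have h2 := (neg_sub_sum_taylorCoeff_isBigO ha hf hn').mono stripNhdsPos_le
  refine (((h1.sub h2).add h).const_mul_left (1 / 2)).congr_left fun p => ?_
  have e1 : ∀ j, (-p.2) ^ (2 * j) = p.2 ^ (2 * j) := fun j => (even_two_mul j).neg_pow _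
  have e2 : ∀ j, (-p.2) ^ (2 * j + 1) = -p.2 ^ (2 * j + 1) := fun j =>
    (odd_two_mul_add_one j).neg_pow _
  simp only [sum_range_two_mul, e1, e2, Finset.sum_add_distrib, mul_neg, Finset.sum_neg_distrib]
  ring

end Taylor

/-! ### Change of a monomial under one step of the billiard map -/

section Monomials

variable {ℓ : ℝ} {A : ℝ × ℝ → ℝ} {w : ℝ → ℝ}

/-- The change of a monomial `w(s) φ ^ m` in one step of the billiard map, divided by `d ^ m`. -/
theorem isLift_monomialChange (hA : IsChordAngle ℓ A) (hw : ContDiff ℝ ∞ w)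
    (hp : ∀ s, w (s + ℓ) = w s) (m : ℕ) :
    IsLift ℓ 0 (fun p => w (p.1 + p.2) * dq A (p.1 + p.2, -p.2) ^ m - w p.1 * dq A p ^ m) := by
  have h := hA.lift.isLift_dq
  refine ⟨?_, fun s y => ?_⟩
  · have := h.smooth
    fun_prop
  · simp only [show s + ℓ + y = s + y + ℓ by ring, h.periodic, hp]
    ring

/-- The initial angle and the arrival angle are both `d` times a Hadamard quotient of `A`, so `d ^
m` factors out. The other factor is smooth and vanishes at `d = 0`, which gains one more order. -/
theorem monomialChange_eq (hA : IsChordAngle ℓ A) (m : ℕ) (p : ℝ × ℝ) :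
    w (nextPoint A p).1 * (nextPoint A p).2 ^ m - w p.1 * A p ^ m =
      p.2 ^ m *
        (w (p.1 + p.2) * dq A (p.1 + p.2, -p.2) ^ m - w p.1 * dq A p ^ m) := by
  simp only [nextPoint]
  rw [hA.lift.eq_mul_dq hA.zero p, hA.lift.eq_mul_dq hA.zero (p.1 + p.2, -p.2)]
  simp only [mul_pow, neg_mul, neg_neg]
  ring

theorem monomialChange_isBigO (hℓ : 0 < ℓ) (hA : IsChordAngle ℓ A) (hw : ContDiff ℝ ∞ w)
    (hp : ∀ s, w (s + ℓ) = w s) (m : ℕ) :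
    (fun p => w (nextPoint A p).1 * (nextPoint A p).2 ^ m - w p.1 * A p ^ m) =O[stripNhds]
      fun p => p.2 ^ (m + 1) := by
  simp only [monomialChange_eq hA, pow_succ]
  exact (isBigO_refl _ _).mul
    ((isLift_monomialChange hA hw hp m).isBigO_snd hℓ fun s => by simp)

/-- The leading coefficient in powers of `d` is converted to powers of the angle through `φ = d * dq
A`. The division is legitimate because `dq A (s, 0)` is positive. -/
theorem exists_monomialChange_leading (hℓ : 0 < ℓ) (hA : IsChordAngle ℓ A)
    (hw : ContDiff ℝ ∞ w) (hp : ∀ s, w (s + ℓ) = w s) (m : ℕ) :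
    ∃ W : ℝ → ℝ, ContDiff ℝ ∞ W ∧ (∀ s, W (s + ℓ) = W s) ∧
      (fun p => w (nextPoint A p).1 * (nextPoint A p).2 ^ m - w p.1 * A p ^ m -
        W p.1 * A p ^ (m + 1)) =O[stripNhds] fun p => p.2 ^ (m + 2) := by
  have hE := isLift_monomialChange hA hw hp m
  set E := fun p : ℝ × ℝ =>
    w (p.1 + p.2) * dq A (p.1 + p.2, -p.2) ^ m - w p.1 * dq A p ^ m with hEdef
  have hE0 : ∀ s, E (s, 0) = 0 := fun s => by simp [hEdef]
  have hA1 : ∀ s, dq A (s, 0) ≠ 0 := fun s => by rw [dq_zero]; exact (hA.dy_pos s).ne'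
  set W : ℝ → ℝ := fun s => dq E (s, 0) / dq A (s, 0) ^ (m + 1) with hWdef
  have hW : ContDiff ℝ ∞ W := by
    have h1 := hE.isLift_dq.smooth
    have h2 := hA.lift.isLift_dq.smooth
    refine ContDiff.div (by fun_prop) (by fun_prop) fun s => pow_ne_zero _ (hA1 s)
  have hWp : ∀ s, W (s + ℓ) = W s := fun s => by
    simp only [hWdef, hE.isLift_dq.periodic, hA.lift.isLift_dq.periodic]
  refine ⟨W, hW, hWp, ?_⟩
  have hH : IsLift ℓ 0 (fun p => dq E p - W p.1 * dq A p ^ (m + 1)) := by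
    refine ⟨?_, fun s y => ?_⟩
    · have h1 := hE.isLift_dq.smooth
      have h2 := hA.lift.isLift_dq.smooth
      fun_prop
    · simp only [hWp, hE.isLift_dq.periodic, hA.lift.isLift_dq.periodic, add_zero]
  have hHO := hH.isBigO_snd hℓ fun s => by
    simp only [hWdef]
    rw [div_mul_cancel₀ _ (pow_ne_zero _ (hA1 s)), sub_self]
  refine ((isBigO_refl (fun p : ℝ × ℝ => p.2 ^ (m + 1)) stripNhds).mul hHO).congr
    (fun p => ?_) (fun p => by ring)
  rw [monomialChange_eq hA]
  change _ = p.2 ^ m * E p - _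
  rw [hE.eq_mul_dq hE0 p, hA.lift.eq_mul_dq hA.zero p]
  ring

end Monomials

/-! ### Coordinates in Lazutkin form -/

/-- The first component of a change of coordinates in Lazutkin form, lifted to the plane. -/
def lazutkinFst (k : ℕ) (x₀ : ℝ → ℝ) (X : ℕ → ℝ → ℝ) (p : ℝ × ℝ) : ℝ :=
  x₀ p.1 + ∑ j ∈ Finset.Ico 1 k, X j p.1 * p.2 ^ (2 * j)

/-- The second component of a change of coordinates in Lazutkin form, lifted to the plane. -/
def lazutkinSnd (k : ℕ) (Y : ℕ → ℝ → ℝ) (p : ℝ × ℝ) : ℝ :=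
  ∑ j ∈ Finset.range (k + 1), Y j p.1 * p.2 ^ (2 * j + 1)

section Form

variable {ℓ b : ℝ} {k : ℕ} {x₀ : ℝ → ℝ} {X Y : ℕ → ℝ → ℝ}

theorem isLift_lazutkinFst (hx : ContDiff ℝ ∞ x₀) (hX : ∀ j, ContDiff ℝ ∞ (X j))
    (hxp : ∀ s, x₀ (s + ℓ) = x₀ s + b) (hXp : ∀ j ∈ Finset.Ico 1 k, ∀ s, X j (s + ℓ) = X j s) :
    IsLift ℓ b (lazutkinFst k x₀ X) := by
  refine ⟨?_, fun s y => ?_⟩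
  · unfold lazutkinFst
    refine ContDiff.add (by fun_prop) (ContDiff.sum fun j _ => ?_)
    have := hX j
    fun_prop
  · simp only [lazutkinFst, hxp]
    rw [Finset.sum_congr rfl fun j hj => by rw [hXp j hj s]]
    ring

theorem isLift_lazutkinSnd (hY : ∀ j, ContDiff ℝ ∞ (Y j)) (hYp : ∀ j s, Y j (s + ℓ) = Y j s) :
    IsLift ℓ 0 (lazutkinSnd k Y) := by
  refine ⟨?_, fun s y => ?_⟩
  · unfold lazutkinSnd
    refine ContDiff.sum fun j _ => ?_
    have := hY j
    fun_prop
  · simp [lazutkinSnd, hYp]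

theorem lazutkinFst_zero (s : ℝ) : lazutkinFst k x₀ X (s, 0) = x₀ s := by
  simp only [lazutkinFst, add_eq_left]
  refine Finset.sum_eq_zero fun j hj => ?_
  have := (Finset.mem_Ico.1 hj).1
  rw [zero_pow (by omega), mul_zero]

theorem lazutkinSnd_zero (s : ℝ) : lazutkinSnd k Y (s, 0) = 0 := by
  simp [lazutkinSnd]

theorem lazutkinFst_neg (s y : ℝ) : lazutkinFst k x₀ X (s, -y) = lazutkinFst k x₀ X (s, y) := by
  simp [lazutkinFst, pow_mul]

theorem lazutkinSnd_neg (s y : ℝ) : lazutkinSnd k Y (s, -y) = -lazutkinSnd k Y (s, y) := by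
  simp only [lazutkinSnd, (odd_two_mul_add_one _).neg_pow, mul_neg, Finset.sum_neg_distrib]

theorem dx_lazutkinFst (h : ContDiff ℝ ∞ (lazutkinFst k x₀ X)) (s : ℝ) :
    dx (lazutkinFst k x₀ X) (s, 0) = deriv x₀ s := by
  have := (hasDerivAt_fst_of_contDiff h s 0).deriv
  simp only [lazutkinFst_zero] at this
  exact this.symm

theorem dy_lazutkinSnd (h : ContDiff ℝ ∞ (lazutkinSnd k Y)) (s : ℝ) :
    dy (lazutkinSnd k Y) (s, 0) = Y 0 s := by
  refine dy_eq_of_hasDerivAt h ?_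
  have e : (fun t => lazutkinSnd k Y (s, t)) =
      fun t => t * ∑ j ∈ Finset.range (k + 1), Y j s * t ^ (2 * j) := by
    funext t
    simp only [lazutkinSnd, Finset.mul_sum]
    refine Finset.sum_congr rfl fun j _ => by ring
  rw [e]
  have hd : DifferentiableAt ℝ
      (fun t : ℝ => ∑ j ∈ Finset.range (k + 1), Y j s * t ^ (2 * j)) 0 := by fun_prop
  have := (hasDerivAt_id (0 : ℝ)).mul hd.hasDerivAt
  have e0 : ∑ j ∈ Finset.range (k + 1), Y j s * (0 : ℝ) ^ (2 * j) = Y 0 s := by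
    rw [Finset.sum_range_succ', Finset.sum_eq_zero fun j _ => by
      rw [zero_pow (by omega), mul_zero]]
    simp
  rw [e0, id, one_mul, zero_mul, add_zero] at this
  exact this

theorem dy_lazutkinFst (h : ContDiff ℝ ∞ (lazutkinFst k x₀ X)) (s : ℝ) :
    dy (lazutkinFst k x₀ X) (s, 0) = 0 := by
  have h1 := hasDerivAt_snd_of_contDiff h s 0
  have h2 : HasDerivAt (fun t => lazutkinFst k x₀ X (s, -t))
      (-dy (lazutkinFst k x₀ X) (s, 0)) 0 := by
    have h3 := hasDerivAt_snd_of_contDiff h s (-0)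
    have := h3.scomp (0 : ℝ) (hasDerivAt_neg (0 : ℝ))
    simpa [Function.comp_def] using this
  simp only [lazutkinFst_neg] at h2
  have := h1.unique h2
  linarith

theorem stripCoord_lazutkin (hx : ContDiff ℝ ∞ x₀) (hX : ∀ j, ContDiff ℝ ∞ (X j))
    (hY : ∀ j, ContDiff ℝ ∞ (Y j))
    (hxp : ∀ s, x₀ (s + ℓ) = x₀ s + b) (hXp : ∀ j ∈ Finset.Ico 1 k, ∀ s, X j (s + ℓ) = X j s)
    (hYp : ∀ j s, Y j (s + ℓ) = Y j s) (hx' : ∀ s, 0 < deriv x₀ s) (hY0 : ∀ s, 0 < Y 0 s) :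
    StripCoord ℓ b (lazutkinFst k x₀ X) (lazutkinSnd k Y) where
  fst := isLift_lazutkinFst hx hX hxp hXp
  snd := isLift_lazutkinSnd hY hYp
  snd_zero := lazutkinSnd_zero
  dx_pos s := by rw [dx_lazutkinFst (isLift_lazutkinFst hx hX hxp hXp).smooth]; exact hx' s
  dy_pos s := by rw [dy_lazutkinSnd (isLift_lazutkinSnd hY hYp).smooth]; exact hY0 s

end Form

/-- Parity leaves the Taylor terms `φ^{2j}` of `P` and `φ^{2j+1}` of `Q` for `j ≤ k`. Dropping `w(s)
φ^{2k}` from `P` violates the first relation by `W(s) φ^{2k+1}` to leading order, so this term is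
subtracted from `Q`. It changes in one step only by `O(φ^{2k+2})`, so the second relation survives.
-/
theorem exists_lazutkin_of_conjugation {ℓ : ℝ} {A P Q : ℝ × ℝ → ℝ} {k : ℕ} (hk : 0 < k)
    (hℓ : 0 < ℓ) (hA : IsChordAngle ℓ A) (hPQ : StripCoord ℓ 1 P Q)
    (hPe : (fun p => P (p.1, -p.2) - P p) =O[stripNhdsPos] (fun p => p.2 ^ (2 * k + 2)))
    (hQo : (fun p => Q (p.1, -p.2) + Q p) =O[stripNhdsPos] (fun p => p.2 ^ (2 * k + 2)))
    (hP : (fun p => P (nextPoint A p) - P (p.1, A p) - Q (p.1, A p)) =O[stripNhdsPos]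
        (fun p => p.2 ^ (2 * k + 2)))
    (hQ : (fun p => Q (nextPoint A p) - Q (p.1, A p)) =O[stripNhdsPos]
      fun p => p.2 ^ (2 * k + 2)) :
    ∃ (x₀ : ℝ → ℝ) (X Y : ℕ → ℝ → ℝ), (ContDiff ℝ ∞ x₀ ∧ (∀ j, ContDiff ℝ ∞ (X j)) ∧
      ∀ j, ContDiff ℝ ∞ (Y j)) ∧ ((∀ s, x₀ (s + ℓ) = x₀ s + 1) ∧
      (∀ j s, X j (s + ℓ) = X j s) ∧ ∀ j s, Y j (s + ℓ) = Y j s) ∧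
      StripCoord ℓ 1 (lazutkinFst k x₀ X) (lazutkinSnd k Y) ∧
      (fun p => lazutkinFst k x₀ X (nextPoint A p) - lazutkinFst k x₀ X (p.1, A p) -
        lazutkinSnd k Y (p.1, A p)) =O[stripNhdsPos] (fun p => p.2 ^ (2 * k + 2)) ∧
      (fun p => lazutkinSnd k Y (nextPoint A p) - lazutkinSnd k Y (p.1, A p))
        =O[stripNhdsPos] fun p => p.2 ^ (2 * k + 2) := by
  have hPx := even_expansion hℓ hPQ.fst (n := k + 1) (by omega) hPe
  have hQx := odd_expansion hℓ hPQ.snd (n := k + 1) (by omega) hQo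
  rw [show 2 * (k + 1) = 2 * k + 2 by ring] at hPx hQx
  have hP1 := hPQ.fst.smooth
  have hQ1 := hPQ.snd.smooth
  obtain ⟨W, hW, hWp, hWO⟩ := exists_monomialChange_leading hℓ hA
    (contDiff_taylorCoeff hP1 (2 * k)) (taylorCoeff_periodic hPQ.fst (by omega)) (2 * k)
  have hWO' := (monomialChange_isBigO hℓ hA hW hWp (2 * k + 1)).mono stripNhdsPos_le
  replace hWO := hWO.mono stripNhdsPos_le
  set x₀ := taylorCoeff P 0 with hx₀
  -- The index `0` is never used by the form. The value `0` keeps every `X j` periodic, whereas the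
  -- zeroth coefficient of `P` gains `1` per period.
  set X : ℕ → ℝ → ℝ := fun j => if j = 0 then 0 else taylorCoeff P (2 * j) with hX
  set Y : ℕ → ℝ → ℝ := fun j s =>
    taylorCoeff Q (2 * j + 1) s - if j = k then W s else 0 with hY
  have hx₀s : ContDiff ℝ ∞ x₀ := contDiff_taylorCoeff hP1 0
  have hXs : ∀ j, ContDiff ℝ ∞ (X j) := by
    intro j
    by_cases hj : j = 0
    · simp only [hX, hj, if_true]; exact contDiff_const
    · simp only [hX, hj, if_false]; exact contDiff_taylorCoeff hP1 _
  have hYs : ∀ j, ContDiff ℝ ∞ (Y j) := by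
    intro j
    refine (contDiff_taylorCoeff hQ1 _).sub ?_
    by_cases hj : j = k
    · simp only [hj, if_true]; exact hW
    · simp only [hj, if_false]; exact contDiff_const
  have hx₀p : ∀ s, x₀ (s + ℓ) = x₀ s + 1 := fun s => hPQ.fst.map_add s 0
  have hXp : ∀ j s, X j (s + ℓ) = X j s := by
    intro j s
    by_cases hj : j = 0
    · simp [hX, hj]
    · simp only [hX, hj, if_false]
      exact taylorCoeff_periodic hPQ.fst (by omega) s
  have hYp : ∀ j s, Y j (s + ℓ) = Y j s := by
    intro j s
    simp only [hY, hWp, taylorCoeff_periodic hPQ.snd (Nat.succ_ne_zero (2 * j))]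
  have hx₀' : ∀ s, 0 < deriv x₀ s := by
    intro s
    have : HasDerivAt x₀ _ s := hasDerivAt_fst_of_contDiff hP1 s 0
    rw [this.deriv]
    exact hPQ.dx_pos s
  have hY0 : ∀ s, 0 < Y 0 s := by
    intro s
    -- As `k ≥ 1`, the correction `W` does not affect `Y 0`, which stays the positive transverse
    -- derivative of `Q`.
    simp only [hY, hk.ne, if_false, sub_zero]
    change 0 < dq Q (s, 0)
    rw [dq_zero]
    exact hPQ.dy_pos s
  refine ⟨x₀, X, Y, ⟨hx₀s, hXs, hYs⟩, ⟨hx₀p, hXp, hYp⟩,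
    stripCoord_lazutkin hx₀s hXs hYs hx₀p (fun j _ => hXp j) hYp hx₀' hY0, ?_⟩
  -- `rX` and `rY` are the Taylor remainders. They contribute `O(d^{2k+2})` both at the initial
  -- point and at its image.
  set rX : ℝ × ℝ → ℝ := fun p =>
    P p - taylorCoeff P (2 * k) p.1 * p.2 ^ (2 * k) - lazutkinFst k x₀ X p with hrX
  set rY : ℝ × ℝ → ℝ := fun p => Q p - W p.1 * p.2 ^ (2 * k + 1) - lazutkinSnd k Y p with hrY
  have hrXO : rX =O[stripNhdsPos] fun p => p.2 ^ (2 * k + 2) := by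
    refine hPx.congr_left fun p => ?_
    rw [Finset.sum_range_succ, ← Finset.sum_range_add_sum_Ico _ (show 1 ≤ k from hk),
      Finset.sum_range_one]
    have : ∑ j ∈ Finset.Ico 1 k, taylorCoeff P (2 * j) p.1 * p.2 ^ (2 * j) =
        ∑ j ∈ Finset.Ico 1 k, X j p.1 * p.2 ^ (2 * j) := by
      refine Finset.sum_congr rfl fun j hj => ?_
      have := (Finset.mem_Ico.1 hj).1
      simp only [hX, show j ≠ 0 by omega, if_false]
    rw [this]
    simp only [hrX, lazutkinFst, hx₀, mul_zero, pow_zero, mul_one]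
    ring
  have hrYO : rY =O[stripNhdsPos] fun p => p.2 ^ (2 * k + 2) := by
    refine hQx.congr_left fun p => ?_
    simp only [hrY, lazutkinSnd, hY, sub_mul, Finset.sum_sub_distrib, ite_mul, zero_mul,
      Finset.sum_ite_eq', Finset.mem_range, Nat.lt_succ_self, if_true]
    ring
  have hnO : (fun p => (nextPoint A p).2 ^ (2 * k + 2)) =O[stripNhdsPos]
      fun p => p.2 ^ (2 * k + 2) := (hA.nextAngle.isBigO_snd hℓ).pow _
  have hAO : (fun p => A p ^ (2 * k + 2)) =O[stripNhdsPos]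
      fun p => p.2 ^ (2 * k + 2) := (hA.isBigO_snd hℓ).pow _
  have hn := hA.tendsto_nextPoint_pos hℓ
  have ha := hA.tendsto_angle_pos hℓ
  have x1 := (hrXO.comp_tendsto hn).trans hnO
  have x2 := (hrXO.comp_tendsto ha).trans hAO
  have y1 := (hrYO.comp_tendsto hn).trans hnO
  have y2 := (hrYO.comp_tendsto ha).trans hAO
  constructor
  · refine ((((hP.sub hWO).sub x1).add x2).add y2).congr_left fun p => ?_
    simp only [hrX, hrY, Function.comp]
    ring
  · refine (((hQ.sub hWO').sub y1).add y2).congr_left fun p => ?_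
    simp only [hrY, Function.comp]
    ring

/-! ### The boundary curve and its chord angle -/

theorem circleDeriv_coe {a : ℝ} (g : AddCircle a → ℂ) (t : ℝ) :
    circleDeriv g (t : AddCircle a) = deriv (fun u : ℝ => g (u : AddCircle a)) t := by
  have := deriv_comp_const_add (fun u : ℝ => g (u : AddCircle a)) t 0
  simpa [circleDeriv] using this

namespace BilliardTable

variable (B : BilliardTable)

/-- The boundary parametrization, lifted to the line. -/
def curve (t : ℝ) : ℂ := B.γ (t : AddCircle B.ℓ)

/-- The unit tangent, lifted to the line. -/
def unitTangent (t : ℝ) : ℂ := deriv B.curve t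

theorem contDiff_curve : ContDiff ℝ ∞ B.curve := B.smooth

theorem contDiff_unitTangent : ContDiff ℝ ∞ B.unitTangent :=
  (contDiff_infty_iff_deriv.1 B.contDiff_curve).2

theorem hasDerivAt_curve (t : ℝ) : HasDerivAt B.curve (B.unitTangent t) t :=
  ((B.contDiff_curve.differentiable (by simp)) t).hasDerivAt

theorem curve_add (t : ℝ) : B.curve (t + B.ℓ) = B.curve t := by
  simp [curve]

theorem tangent_coe (t : ℝ) : B.tangent (t : AddCircle B.ℓ) = B.unitTangent t :=
  circleDeriv_coe _ _

theorem unitTangent_add (t : ℝ) : B.unitTangent (t + B.ℓ) = B.unitTangent t := by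
  rw [← tangent_coe, ← tangent_coe]; simp

theorem norm_unitTangent (t : ℝ) : ‖B.unitTangent t‖ = 1 := by
  rw [← tangent_coe]; exact B.unit_speed _

theorem unitTangent_ne_zero (t : ℝ) : B.unitTangent t ≠ 0 := by
  rw [← norm_pos_iff, norm_unitTangent]; exact one_pos

theorem unitTangent_mul_conj (t : ℝ) :
    B.unitTangent t * (starRingEnd ℂ) (B.unitTangent t) = 1 := by
  rw [Complex.mul_conj, Complex.normSq_eq_norm_sq, norm_unitTangent]; simp

theorem curvature_pos_coe (t : ℝ) :
    0 < ((starRingEnd ℂ) (B.unitTangent t) * deriv B.unitTangent t).im := by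
  have h := B.curvature_pos (t : AddCircle B.ℓ)
  rw [circleDeriv_coe (circleDeriv B.γ) t] at h
  have e : (fun u : ℝ => circleDeriv B.γ (u : AddCircle B.ℓ)) = B.unitTangent := by
    funext u; exact B.tangent_coe u
  rw [e] at h
  have e2 := B.tangent_coe t
  rw [tangent] at e2
  rwa [e2] at h

/-- The chord from `s` to `s + d` divided by `d` and by the tangent at `s`. -/
def chordRatio (p : ℝ × ℝ) : ℂ :=
  dq (fun p : ℝ × ℝ => B.curve (p.1 + p.2)) p * (starRingEnd ℂ) (B.unitTangent p.1)

theorem contDiff_curve_add : ContDiff ℝ ∞ (fun p : ℝ × ℝ => B.curve (p.1 + p.2)) := by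
  have := B.contDiff_curve
  fun_prop

theorem contDiff_chordRatio : ContDiff ℝ ∞ B.chordRatio := by
  have h1 := B.contDiff_curve_add.dq
  have h2 : ContDiff ℝ ∞ fun p : ℝ × ℝ => (starRingEnd ℂ) (B.unitTangent p.1) :=
    Complex.conjCLE.contDiff.comp (B.contDiff_unitTangent.comp contDiff_fst)
  exact h1.mul h2

theorem chordRatio_add (s y : ℝ) : B.chordRatio (s + B.ℓ, y) = B.chordRatio (s, y) := by
  unfold chordRatio
  rw [dq_periodic (c := 0), unitTangent_add]
  intro s y
  simp only [add_zero, show s + B.ℓ + y = s + y + B.ℓ by ring, curve_add]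

theorem curve_sub_curve (s d : ℝ) :
    B.curve (s + d) - B.curve s = d * B.chordRatio (s, d) * B.unitTangent s := by
  have h := eq_add_smul_dq B.contDiff_curve_add (s, d)
  simp only [add_zero, Complex.real_smul] at h
  rw [h, chordRatio]
  have := B.unitTangent_mul_conj s
  linear_combination (-(d : ℂ) * dq (fun p : ℝ × ℝ => B.curve (p.1 + p.2)) (s, d)) * this

theorem dy_curve_add (s t : ℝ) :
    dy (fun p : ℝ × ℝ => B.curve (p.1 + p.2)) (s, t) = B.unitTangent (s + t) := by
  have h1 := hasDerivAt_snd_of_contDiff B.contDiff_curve_add s t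
  exact h1.unique ((B.hasDerivAt_curve (s + t)).comp_const_add s t)

theorem chordRatio_zero (s : ℝ) : B.chordRatio (s, 0) = 1 := by
  rw [chordRatio, dq_zero, dy_curve_add, add_zero]
  exact B.unitTangent_mul_conj s

/-- Differentiating `γ(s + d) = γ(s) + d c(d)` gives `τ(s + d) = c(d) + d c'(d)` with `τ` the
tangent. A second derivative at `d = 0` yields `c'(0) = τ'(s) / 2`. -/
theorem hasDerivAt_chordRatio (s : ℝ) :
    HasDerivAt (fun d => B.chordRatio (s, d))
      (deriv B.unitTangent s / 2 * (starRingEnd ℂ) (B.unitTangent s)) 0 := by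
  set c : ℝ → ℂ := fun d => dq (fun p : ℝ × ℝ => B.curve (p.1 + p.2)) (s, d) with hc
  set c' : ℝ → ℂ := fun d => dy (dq (fun p : ℝ × ℝ => B.curve (p.1 + p.2))) (s, d) with hc'
  have hcd : ∀ d, HasDerivAt c (c' d) d := fun d =>
    hasDerivAt_snd_of_contDiff B.contDiff_curve_add.dq s d
  have hc's : ContDiff ℝ ∞ c' := by
    have := B.contDiff_curve_add.dq.dy
    fun_prop
  have e : (fun d => B.unitTangent (s + d)) = fun d => c d + d • c' d := by
    funext d
    have h1 : HasDerivAt (fun d => B.curve (s + d)) (B.unitTangent (s + d)) d :=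
      (B.hasDerivAt_curve (s + d)).comp_const_add s d
    have h2 : HasDerivAt (fun d : ℝ => B.curve s + d • c d) (d • c' d + (1 : ℝ) • c d) d :=
      ((hasDerivAt_id d).smul (hcd d)).const_add _
    have e2 : (fun d => B.curve (s + d)) = fun d : ℝ => B.curve s + d • c d := by
      funext d
      simpa using eq_add_smul_dq B.contDiff_curve_add (s, d)
    rw [e2] at h1
    rw [h1.unique h2, one_smul, add_comm]
  have h3 : HasDerivAt (fun d => B.unitTangent (s + d)) (deriv B.unitTangent s) 0 := by
    have :=
      ((B.contDiff_unitTangent.differentiable (by simp)) (s + 0)).hasDerivAt.comp_const_add s 0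
    simpa using this
  have h4 := (hcd 0).add ((hasDerivAt_id (0 : ℝ)).smul
    ((hc's.differentiable (by simp)) 0).hasDerivAt)
  rw [e] at h3
  have h5 := h3.unique h4
  simp only [id, zero_smul, one_smul, zero_add] at h5
  have h6 : c' 0 = deriv B.unitTangent s / 2 := by rw [h5]; ring
  have h7 := (hcd 0).mul_const ((starRingEnd ℂ) (B.unitTangent s))
  rw [h6] at h7
  exact h7

theorem eventually_re_chordRatio_pos : ∀ᶠ p in stripNhds, 0 < (B.chordRatio p).re := by
  refine eventually_stripNhds_of_periodic B.length_pos (fun s y => by rw [chordRatio_add])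
    fun s => ?_
  have hc : Continuous fun p => (B.chordRatio p).re :=
    Complex.continuous_re.comp B.contDiff_chordRatio.continuous
  exact (hc.tendsto (s, 0)).eventually_const_lt (by simp [chordRatio_zero])

/-- Dividing the chord by the signed `d` gives a ratio equal to `1` at `d = 0`, so its principal
argument is smooth across `d = 0`. The derivative of the argument there is half the curvature, hence
positive. -/
theorem exists_chordAngle : ∃ A, IsChordAngle B.ℓ A ∧
    ∀ᶠ p in stripNhds, 0 < (B.chordRatio p).re ∧ A p = (B.chordRatio p).arg := by
  have hev := B.eventually_re_chordRatio_pos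
  have hsm : ∀ p, 0 < (B.chordRatio p).re →
      ContDiffAt ℝ ∞ (fun p => (B.chordRatio p).arg) p := by
    intro p hp
    have h1 : ContDiffAt ℝ ∞ Complex.log (B.chordRatio p) :=
      (Complex.contDiffAt_log (n := ∞) (Or.inl hp)).restrict_scalars ℝ
    have h2 := h1.comp p B.contDiff_chordRatio.contDiffAt
    have h3 := Complex.imCLM.contDiff.contDiffAt.comp p h2
    refine h3.congr_of_eventuallyEq (Eventually.of_forall fun q => ?_)
    simp [Complex.log_im]
  obtain ⟨A, hA, hAe⟩ := exists_isLift_eventuallyEq (b := 0) B.length_pos (hev.mono hsm)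
    (Eventually.of_forall fun p => by rw [chordRatio_add]; simp)
  have hall : ∀ᶠ p in stripNhds, 0 < (B.chordRatio p).re ∧ A p = (B.chordRatio p).arg :=
    hev.and hAe
  have hA0 : ∀ s, A (s, 0) = 0 := fun s => by
    have := (eventually_nhds_of_stripNhds hAe s).self_of_nhds
    simpa [chordRatio_zero] using this
  refine ⟨A, ⟨hA, hA0, fun s => ?_⟩, hall⟩
  have h1 := B.hasDerivAt_chordRatio s
  have h2 := h1.clog_real (by rw [chordRatio_zero]; exact Or.inl one_pos)
  have h3 : HasDerivAt (fun d => (Complex.log (B.chordRatio (s, d))).im) _ 0 :=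
    Complex.imCLM.hasFDerivAt.comp_hasDerivAt (0 : ℝ) h2
  have h4 := h3.congr_of_eventuallyEq (f₁ := fun t => A (s, t))
    ((eventually_nhds_fst_of_stripNhds hAe s).mono fun t ht => by
      simpa [Complex.log_im] using ht)
  rw [dy_eq_of_hasDerivAt hA.smooth h4, chordRatio_zero, div_one, Complex.imCLM_apply]
  have := B.curvature_pos_coe s
  have e : deriv B.unitTangent s / 2 * (starRingEnd ℂ) (B.unitTangent s) =
      ((1 / 2 : ℝ) : ℂ) * ((starRingEnd ℂ) (B.unitTangent s) * deriv B.unitTangent s) := by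
    push_cast; ring
  rw [e, Complex.im_ofReal_mul]
  positivity

end BilliardTable

/-! ### Convexity and the billiard map -/

namespace BilliardTable

variable (B : BilliardTable)

theorem curve_mem_frontier (t : ℝ) : B.curve t ∈ frontier B.Ω :=
  B.range_eq ▸ mem_range_self _

theorem nonempty : B.Ω.Nonempty := by
  rw [nonempty_iff_ne_empty]
  intro h
  have := B.curve_mem_frontier 0
  simp [h] at this

/-- A linear form that is maximal on the boundary at `s` and vanishes on a direction transverse to
the boundary at `s` is zero. -/
theorem eq_zero_of_supporting {f : ℂ →L[ℝ] ℝ} {s : ℝ} {φ : ℝ} (hφ : φ ∈ Ioo 0 Real.pi)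
    (hmax : ∀ t, f (B.curve t) ≤ f (B.curve s))
    (hw : f (Complex.exp (φ * Complex.I) * B.unitTangent s) = 0) : f = 0 := by
  have h1 : HasDerivAt (fun t => f (B.curve t)) (f (B.unitTangent s)) s :=
    f.hasFDerivAt.comp_hasDerivAt s (B.hasDerivAt_curve s)
  have h2 : f (B.unitTangent s) = 0 :=
    (IsLocalMax.hasDerivAt_eq_zero (Eventually.of_forall hmax) h1)
  have h3 : f (Complex.I * B.unitTangent s) = 0 := by
    have e : Complex.exp (φ * Complex.I) * B.unitTangent s =
        Real.cos φ • B.unitTangent s + Real.sin φ • (Complex.I * B.unitTangent s) := by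
      rw [Complex.exp_mul_I, Complex.real_smul, Complex.real_smul]
      push_cast; ring
    rw [e, map_add, map_smul, map_smul, h2, smul_zero, zero_add, smul_eq_mul] at hw
    exact (mul_eq_zero.1 hw).resolve_left (Real.sin_pos_of_mem_Ioo hφ).ne'
  ext z
  have e : z = (z / B.unitTangent s).re • B.unitTangent s +
      (z / B.unitTangent s).im • (Complex.I * B.unitTangent s) := by
    rw [Complex.real_smul, Complex.real_smul, ← mul_assoc, ← add_mul, Complex.re_add_im,
      div_mul_cancel₀ _ (B.unitTangent_ne_zero s)]
  rw [e, map_add, map_smul, map_smul, h2, h3]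
  simp

theorem exists_supporting {z : ℂ} (hz : z ∈ frontier B.Ω) :
    ∃ f : ℂ →L[ℝ] ℝ, f ≠ 0 ∧ ∀ t, f (B.curve t) ≤ f z := by
  have hz' : z ∉ B.Ω := by
    rw [B.isOpen.frontier_eq] at hz
    exact hz.2
  obtain ⟨f, hf⟩ := geometric_hahn_banach_open_point B.convex B.isOpen hz'
  refine ⟨f, ?_, fun t => ?_⟩
  · rintro rfl
    obtain ⟨w, hw⟩ := B.nonempty
    simpa using hf w hw
  · have hcl : B.curve t ∈ closure B.Ω := frontier_subset_closure (B.curve_mem_frontier t)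
    exact closure_minimal (fun w hw => (hf w hw).le)
      (isClosed_le f.continuous continuous_const) hcl

/-- A ray entering the domain meets the boundary in at most one further point. -/
theorem ray_unique {s φ r₁ r₂ : ℝ} (hφ : φ ∈ Ioo 0 Real.pi) (h₁ : 0 < r₁) (h₂ : r₁ < r₂)
    (m₁ : B.curve s + r₁ * (Complex.exp (φ * Complex.I) * B.unitTangent s) ∈ frontier B.Ω)
    (m₂ : B.curve s + r₂ * (Complex.exp (φ * Complex.I) * B.unitTangent s) ∈ frontier B.Ω) :
    False := by
  set w := Complex.exp (φ * Complex.I) * B.unitTangent s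
  obtain ⟨f, hf0, hf⟩ := B.exists_supporting m₁
  have e : ∀ r : ℝ, f (B.curve s + r * w) = f (B.curve s) + r * f w := fun r => by
    rw [map_add, ← Complex.real_smul, map_smul, smul_eq_mul]
  have k1 := hf s
  rw [← B.range_eq] at m₂
  obtain ⟨q, hq⟩ := m₂
  obtain ⟨t, rfl⟩ := QuotientAddGroup.mk_surjective q
  have k2 := hf t
  rw [show B.curve t = B.curve s + r₂ * w from hq, e, e] at k2
  rw [e] at k1
  -- Along the ray `f` is affine in `r`, and its value at `r₁` dominates those at `0` and at `r₂`,
  -- on either side; so it is constant. The supporting line then contains the ray and touches the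
  -- curve at `s`.
  have hw : f w = 0 := by
    have a1 : 0 ≤ f w := by
      by_contra hneg
      nlinarith
    have a2 : (r₂ - r₁) * f w ≤ 0 := by linarith
    nlinarith
  refine hf0 (B.eq_zero_of_supporting hφ (fun t => ?_) hw)
  have := hf t
  rwa [e, hw, mul_zero, add_zero] at this

/-- By `ray_unique` and injectivity of `γ`, at most one collision can follow, so the choice made by
`Classical.epsilon` is forced. -/
theorem billiardMap_eq {s φ : ℝ} (hφ : φ ∈ Ioo 0 Real.pi) {q : AddCircle B.ℓ × ℝ}
    (h : B.IsNextCollision ((s : AddCircle B.ℓ), φ) q) :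
    B.billiardMap ((s : AddCircle B.ℓ), φ) = q := by
  have h0 : B.IsNextCollision ((s : AddCircle B.ℓ), φ) (B.billiardMap ((s : AddCircle B.ℓ), φ)) :=
    Classical.epsilon_spec (p := B.IsNextCollision ((s : AddCircle B.ℓ), φ)) ⟨q, h⟩
  have key : ∀ q, B.IsNextCollision ((s : AddCircle B.ℓ), φ) q → (∃ r : ℝ, 0 < r ∧
      B.γ q.1 = B.curve s + r * (Complex.exp (φ * Complex.I) * B.unitTangent s)) ∧
      q.2 = InnerProductGeometry.angle (B.tangent q.1) (B.γ q.1 - B.curve s) := by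
    rintro q (⟨h | h, -⟩ | ⟨-, ⟨r, hr, e⟩, h⟩)
    · exact absurd h hφ.1.ne'
    · exact absurd h hφ.2.ne
    · refine ⟨⟨r, hr, ?_⟩, h⟩
      rw [e, ← tangent_coe, mul_assoc]
      rfl
  obtain ⟨⟨r₁, hr₁, e₁⟩, a₁⟩ := key _ h0
  obtain ⟨⟨r₂, hr₂, e₂⟩, a₂⟩ := key _ h
  have m : ∀ x, B.γ x ∈ frontier B.Ω := fun x => B.range_eq ▸ mem_range_self _
  have hr : r₁ = r₂ := by
    rcases lt_trichotomy r₁ r₂ with hlt | heq | hgt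
    · exact (B.ray_unique hφ hr₁ hlt (e₁ ▸ m _) (e₂ ▸ m _)).elim
    · exact heq
    · exact (B.ray_unique hφ hr₂ hgt (e₂ ▸ m _) (e₁ ▸ m _)).elim
  have hq : (B.billiardMap ((s : AddCircle B.ℓ), φ)).1 = q.1 :=
    B.injective (by rw [e₁, e₂, hr])
  refine Prod.ext hq ?_
  rw [a₁, a₂, hq]

theorem billiardMap_zero (x : AddCircle B.ℓ) : B.billiardMap (x, 0) = (x, 0) := by
  have h : B.IsNextCollision (x, 0) (B.billiardMap (x, 0)) :=
    Classical.epsilon_spec (p := B.IsNextCollision (x, 0)) ⟨(x, 0), Or.inl ⟨Or.inl rfl, rfl⟩⟩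
  rcases h with ⟨-, h⟩ | ⟨h, -⟩
  · exact h
  · exact absurd h.1 (lt_irrefl _)

theorem angle_mul_of_re_pos {τ h : ℂ} (hτ : τ ≠ 0) (hh : 0 < h.re) {d : ℝ} (hd : 0 < d) :
    InnerProductGeometry.angle τ (d * h * τ) = |h.arg| := by
  have hne : h ≠ 0 := by rintro rfl; simp at hh
  have e : (d : ℂ) * h * τ = (d • h) * τ := by rw [Complex.real_smul]
  have e2 := Complex.angle_mul_right hτ 1 (d • h)
  rw [one_mul] at e2
  rw [e, e2, InnerProductGeometry.angle_smul_right_of_pos _ _ hd,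
    Complex.angle_one_left hne]

/-- `A` is the chord angle function of the billiard table `B`. -/
structure HasChordAngle (A : ℝ × ℝ → ℝ) : Prop where
  isChordAngle : IsChordAngle B.ℓ A
  curve_ne : ∀ᶠ p in stripNhds, p.2 ≠ 0 → B.curve (p.1 + p.2) ≠ B.curve p.1
  angle_pos : ∀ᶠ p in stripNhds, 0 < p.2 → InnerProductGeometry.angle (B.unitTangent p.1)
      (B.curve (p.1 + p.2) - B.curve p.1) = A p
  angle_neg : ∀ᶠ p in stripNhds, p.2 < 0 → InnerProductGeometry.angle (-B.unitTangent p.1)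
      (B.curve (p.1 + p.2) - B.curve p.1) = -A p
  billiardMap_eq : ∀ᶠ p in stripNhdsPos, B.billiardMap (cylinderCover B.ℓ (p.1, A p)) =
      cylinderCover B.ℓ (nextPoint A p)

/-- The sign of the displacement decides whether the argument of the chord ratio measures the angle
with the positive or with the negative tangent. The billiard formula is the second case read from
the end of the chord, with displacement `-d`. -/
theorem exists_hasChordAngle : ∃ A, B.HasChordAngle A := by
  obtain ⟨A, hA, hev⟩ := B.exists_chordAngle
  have hdq : ∀ᶠ p in stripNhds, 0 < dq A p := by
    obtain ⟨m, hm, h⟩ := exists_pos_le_of_periodic B.length_pos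
      hA.lift.isLift_dq.smooth.continuous hA.lift.isLift_dq.periodic
      (fun s => by rw [dq_zero]; exact hA.dy_pos s)
    exact h.mono fun p hp => hm.trans_le hp
  have hpos : ∀ᶠ p in stripNhds, 0 < p.2 → InnerProductGeometry.angle (B.unitTangent p.1)
      (B.curve (p.1 + p.2) - B.curve p.1) = A p := by
    filter_upwards [hev, hdq] with p h1 h2 hp
    rw [curve_sub_curve, angle_mul_of_re_pos (B.unitTangent_ne_zero _) h1.1 hp, ← h1.2,
      abs_of_nonneg]
    rw [hA.lift.eq_mul_dq hA.zero]
    exact (mul_pos hp h2).le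
  have hneg : ∀ᶠ p in stripNhds, p.2 < 0 → InnerProductGeometry.angle (-B.unitTangent p.1)
      (B.curve (p.1 + p.2) - B.curve p.1) = -A p := by
    filter_upwards [hev, hdq] with p h1 h2 hp
    have e : B.curve (p.1 + p.2) - B.curve p.1 =
        ((-p.2 : ℝ) : ℂ) * B.chordRatio p * (-B.unitTangent p.1) := by
      rw [curve_sub_curve]; push_cast; ring
    rw [e, angle_mul_of_re_pos (neg_ne_zero.2 (B.unitTangent_ne_zero _)) h1.1
      (neg_pos.2 hp), ← h1.2, abs_of_nonpos]
    rw [hA.lift.eq_mul_dq hA.zero]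
    exact (mul_neg_of_neg_of_pos hp h2).le
  refine ⟨A, hA, ?_, hpos, hneg, ?_⟩
  · filter_upwards [hev] with p h1 hp he
    have e := B.curve_sub_curve p.1 p.2
    rw [he, sub_self, eq_comm, mul_eq_zero, mul_eq_zero] at e
    rcases e with (e | e) | e
    · exact hp (by exact_mod_cast e)
    · rw [show (p.1, p.2) = p from rfl] at e
      simp [e] at h1
    · exact B.unitTangent_ne_zero _ e
  · have hπ : ∀ᶠ p in stripNhdsPos, A p ∈ Ioo 0 Real.pi := by
      have h1 := tendsto_stripNhdsPos_iff.1 (hA.tendsto_angle_pos B.length_pos)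
      filter_upwards [h1.2, h1.1.eventually_lt_const Real.pi_pos] with p h1 h2
      exact ⟨h1, h2⟩
    have hn := (tendsto_stripNhds_neg fun p => p.1 + p.2).eventually hneg
    filter_upwards [stripNhdsPos_le hev, hπ, stripNhdsPos_le hn, eventually_stripNhdsPos_pos]
      with p h1 h2 h3 h4
    -- The length of the chord is `d` times the modulus of the chord ratio.
    refine B.billiardMap_eq h2 (Or.inr ⟨h2, ⟨p.2 * ‖B.chordRatio p‖, ?_, ?_⟩, ?_⟩)
    · have : B.chordRatio p ≠ 0 := by
        intro h0; simp [h0] at h1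
      positivity
    · change B.curve (p.1 + p.2) = B.curve p.1 + _
      rw [← sub_eq_iff_eq_add', curve_sub_curve, tangent_coe, h1.2]
      have := Complex.norm_mul_exp_arg_mul_I (B.chordRatio p)
      change _ * B.chordRatio p * _ = _
      conv_lhs => rw [← this]
      push_cast
      ring
    · have h5 := h3 (neg_lt_zero.2 h4)
      rw [add_neg_cancel_right] at h5
      change -A _ = InnerProductGeometry.angle _ _
      rw [← h5]
      change _ = InnerProductGeometry.angle (B.tangent ((p.1 + p.2 : ℝ) : AddCircle B.ℓ))
        (B.curve (p.1 + p.2) - B.curve p.1)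
      rw [tangent_coe, ← InnerProductGeometry.angle_neg_neg, neg_neg, neg_sub]

end BilliardTable

/-! ### Lifting to the line, and degree -/

/-- A continuous function is smooth if its composition with an immersed curve is. -/
theorem contDiffAt_of_comp_curve {E : Type*} [NormedAddCommGroup E] [NormedSpace ℝ E]
    {σ : E → ℝ} {c : ℝ → ℂ} {x : E} (hσ : ContinuousAt σ x) (hc : ContDiff ℝ ∞ c)
    (hc' : deriv c (σ x) ≠ 0) (h : ContDiffAt ℝ ∞ (fun y => c (σ y)) x) :
    ContDiffAt ℝ ∞ σ x := by
  set w := deriv c (σ x)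
  -- Projecting along the velocity `w` turns the curve into a real function with derivative `|w|²`
  -- at `σ x`. Its local inverse recovers `σ` from the smooth composite, with continuity of `σ`
  -- selecting the branch.
  set L : ℂ →L[ℝ] ℝ := Complex.reCLM ∘L (ContinuousLinearMap.mul ℝ ℂ ((starRingEnd ℂ) w)) with hL
  set g : ℝ → ℝ := fun t => L (c t)
  have hg : ContDiff ℝ ∞ g := L.contDiff.comp hc
  have hd : HasDerivAt g (L w) (σ x) :=
    L.hasFDerivAt.comp_hasDerivAt (σ x) ((hc.differentiable (by simp)) (σ x)).hasDerivAt
  have hLw : L w ≠ 0 := by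
    have : L w = Complex.normSq w := by
      simp [hL, Complex.normSq_apply]
    rw [this]
    exact (Complex.normSq_pos.2 hc').ne'
  have hst := (hg.contDiffAt (x := σ x)).hasStrictFDerivAt' (hd.hasFDerivAt_equiv hLw) (by simp)
  have h1 := (hg.contDiffAt (x := σ x)).to_localInverse (hd.hasFDerivAt_equiv hLw) (by simp)
  have h2 : ContDiffAt ℝ ∞ (fun y => L (c (σ y))) x := L.contDiff.contDiffAt.comp x h
  refine (h1.comp x h2).congr_of_eventuallyEq ?_
  filter_upwards [hσ.eventually hst.eventually_left_inverse] with y hy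
  exact hy.symm

theorem exists_continuous_lift {E : Type*} [TopologicalSpace E] [SimplyConnectedSpace E]
    [LocallyPathConnectedSpace E] {a : ℝ} {F : E → AddCircle a} (hF : Continuous F) :
    ∃ f : E → ℝ, Continuous f ∧ ∀ x, (f x : AddCircle a) = F x := by
  obtain ⟨x₀⟩ : Nonempty E := inferInstance
  obtain ⟨t, ht⟩ := QuotientAddGroup.mk_surjective (F x₀)
  obtain ⟨f, ⟨-, hf⟩, -⟩ := (AddCircle.isCoveringMap_coe a).existsUnique_continuousMap_lifts
    ⟨F, hF⟩ x₀ t ht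
  exact ⟨f, f.continuous, fun x => congrFun hf x⟩

theorem toCircle_coe_unit (t : ℝ) :
    ((AddCircle.toCircle (t : UnitAddCircle) : Circle) : ℂ) =
      Complex.exp ((2 * Real.pi * t : ℝ) * Complex.I) := by
  rw [AddCircle.toCircle_apply_mk, Circle.coe_exp]
  simp

theorem exists_smooth_lift {F : ℝ → UnitAddCircle} (hF : SmoothToCircleOn F univ) :
    ∃ f : ℝ → ℝ, ContDiff ℝ ∞ f ∧ ∀ t, (f t : UnitAddCircle) = F t := by
  have hF' : ContDiff ℝ ∞ fun t => ((AddCircle.toCircle (F t) : Circle) : ℂ) :=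
    contDiffOn_univ.1 hF
  have hc : Continuous F := by
    have h1 : Continuous fun t => AddCircle.toCircle (F t) :=
      Continuous.subtype_mk hF'.continuous _
    have h2 := (AddCircle.homeomorphCircle (T := (1 : ℝ)) one_ne_zero).symm.continuous.comp h1
    refine h2.congr fun t => ?_
    rw [Function.comp, Homeomorph.symm_apply_eq, AddCircle.homeomorphCircle_apply]
  obtain ⟨f, hf, hfF⟩ := exists_continuous_lift hc
  refine ⟨f, contDiff_iff_contDiffAt.2 fun t => ?_, hfF⟩
  have hd : ∀ u : ℝ, HasDerivAt (fun u : ℝ => Complex.exp ((2 * Real.pi * u : ℝ) * Complex.I))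
      (Complex.exp ((2 * Real.pi * u : ℝ) * Complex.I) * ((2 * Real.pi : ℝ) * Complex.I)) u := by
    intro u
    have h1 : HasDerivAt (fun u : ℝ => 2 * Real.pi * u) (2 * Real.pi) u := by
      simpa using (hasDerivAt_id u).const_mul (2 * Real.pi)
    exact (h1.ofReal_comp.mul_const Complex.I).cexp
  refine contDiffAt_of_comp_curve (c := fun u => Complex.exp ((2 * Real.pi * u : ℝ) * Complex.I))
    hf.continuousAt ?_ ?_ ?_
  · have h1 : ContDiff ℝ ∞ fun u : ℝ => ((2 * Real.pi * u : ℝ) : ℂ) :=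
      Complex.ofRealCLM.contDiff.comp (contDiff_const.mul contDiff_id)
    exact (h1.mul contDiff_const).cexp
  · rw [(hd (f t)).deriv]
    refine mul_ne_zero (Complex.exp_ne_zero _) (mul_ne_zero ?_ Complex.I_ne_zero)
    exact_mod_cast Real.two_pi_pos.ne'
  · simp only [← toCircle_coe_unit, hfF]
    exact hF'.contDiffAt

/-- Two translates of a lift of a periodic map differ by a constant integer multiple of the
period of the target. -/
theorem exists_degree {E : Type*} [TopologicalSpace E] [PreconnectedSpace E] [Nonempty E] {b : ℝ}
    {f g : E → ℝ} (hf : Continuous f) (hg : Continuous g)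
    (h : ∀ x, (g x : AddCircle b) = (f x : AddCircle b)) : ∃ n : ℤ, ∀ x, g x = f x + n * b := by
  have hconst := (AddCircle.isCoveringMap_coe b).const_of_comp (hg.sub hf) fun x y => by
    simp [h]
  obtain ⟨x₀⟩ := ‹Nonempty E›
  have h0 : ((g x₀ - f x₀ : ℝ) : AddCircle b) = 0 := by simp [h]
  obtain ⟨n, hn⟩ := AddCircle.coe_eq_zero_iff b |>.1 h0
  refine ⟨n, fun x => ?_⟩
  have := hconst x x₀
  simp only [Pi.sub_apply, zsmul_eq_mul] at this hn
  linarith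

/-- Monotonicity forces `n ≥ 1`. If `n ≥ 2`, the value `f 0 + b` is attained strictly inside one
period, contradicting injectivity on the circle. -/
theorem degree_eq_one {a b : ℝ} (ha : 0 < a) (hb : 0 < b) {f : ℝ → ℝ} (hf : Continuous f)
    (hmono : StrictMono f) {n : ℤ} (hn : ∀ t, f (t + a) = f t + n * b)
    (hinj : ∀ s t : ℝ, (f s : AddCircle b) = (f t : AddCircle b) →
      (s : AddCircle a) = (t : AddCircle a)) : n = 1 := by
  have h0 := hn 0
  have h1 := hmono (show (0 : ℝ) < 0 + a by linarith)
  have hpos : 0 < n := by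
    by_contra hneg
    have : (n : ℝ) ≤ 0 := by exact_mod_cast not_lt.1 hneg
    nlinarith
  by_contra hne
  have h2 : (2 : ℝ) ≤ n := by
    have : 2 ≤ n := by omega
    exact_mod_cast this
  have hmem : f 0 + b ∈ Ioo (f 0) (f (0 + a)) := ⟨by linarith, by nlinarith⟩
  obtain ⟨t, ht, e⟩ := intermediate_value_Ioo (by linarith : (0 : ℝ) ≤ 0 + a) hf.continuousOn hmem
  have h3 := hinj t 0 (by rw [e]; simp)
  rw [AddCircle.coe_zero, AddCircle.coe_eq_zero_iff] at h3
  obtain ⟨m, hm⟩ := h3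
  rw [zsmul_eq_mul] at hm
  have hm0 : (0 : ℝ) < m := by
    by_contra hneg
    nlinarith [ht.1]
  have hm1 : (m : ℝ) < 1 := by
    by_contra hneg
    nlinarith [ht.2]
  have : 0 < m := by exact_mod_cast hm0
  have : m < 1 := by exact_mod_cast hm1
  omega

theorem eq_zero_of_hasDerivAt_of_isBigO {r : ℝ → ℝ} {c : ℝ} (h : HasDerivAt r c 0)
    (h0 : r 0 = 0) {N : ℕ} (hN : 1 < N) (hO : r =O[𝓝[>] 0] fun t => t ^ N) : c = 0 := by
  have h1 := (hasDerivAt_iff_isLittleO.1 h).mono (nhdsWithin_le_nhds (s := Ioi 0))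
  have h2 : (fun t : ℝ => t ^ N) =o[𝓝[>] 0] fun t : ℝ => t := by
    simpa using (isLittleO_pow_pow (𝕜 := ℝ) hN).mono (nhdsWithin_le_nhds (s := Ioi 0))
  have h3 := (hO.trans_isLittleO h2).sub (h1.congr_right fun t => by simp)
  have h4 : (fun t : ℝ => t * c) =o[𝓝[>] 0] fun t : ℝ => t := by
    refine h3.congr_left fun t => ?_
    simp [h0]
  by_contra hc
  have h5 : (fun t : ℝ => t) =O[𝓝[>] 0] fun t : ℝ => t * c := by
    refine IsBigO.of_bound |c|⁻¹ (Eventually.of_forall fun t => ?_)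
    have : |c| ≠ 0 := abs_ne_zero.2 hc
    rw [norm_mul, Real.norm_eq_abs c, mul_comm ‖t‖, inv_mul_cancel_left₀ this]
  have h6 := h5.trans_isLittleO h4
  have h7 : ∃ᶠ t in 𝓝[>] (0 : ℝ), t ≠ 0 := by
    refine Eventually.frequently ?_
    filter_upwards [self_mem_nhdsWithin] with t ht
    exact (ne_of_gt ht)
  exact isLittleO_irrefl' (h7.mono fun t ht => by simpa using ht) h6

theorem continuous_cylinderCover (a : ℝ) : Continuous (cylinderCover a) :=
  ((AddCircle.continuous_mk' a).comp continuous_fst).prodMk continuous_snd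

theorem cylinderCover_add (a s y : ℝ) : cylinderCover a (s + a, y) = cylinderCover a (s, y) := by
  simp [cylinderCover]

/-- A neighbourhood of the boundary circle contains a uniform neighbourhood. -/
theorem eventually_mem_of_isBoundaryNhd {a : ℝ} (ha : 0 < a) {I : Set ℝ}
    {U : Set (AddCircle a × ℝ)} (hU : IsBoundaryNhd I U) :
    ∀ᶠ p in stripNhds, p.2 ∈ I → cylinderCover a p ∈ U := by
  obtain ⟨⟨W, hW, rfl⟩, h0⟩ := hU
  have : ∀ᶠ p in stripNhds, cylinderCover a p ∈ W := by
    refine eventually_stripNhds_of_periodic ha (fun s y => by rw [cylinderCover_add]) fun s => ?_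
    exact (hW.preimage (continuous_cylinderCover a)).mem_nhds (h0 s).1
  filter_upwards [this] with p hp hI
  exact ⟨hp, mem_univ _, hI⟩

/-! ### Lifting a Lazutkin change of coordinates -/

section Extraction

variable {ℓ b : ℝ} {A : ℝ × ℝ → ℝ} {k : ℕ} {x₀ : ℝ → ℝ} {X Y : ℕ → ℝ → ℝ}

/-- The defect in the conjugation of the first component. -/
theorem isLift_conjDefect {F G : ℝ × ℝ → ℝ} (hA : IsChordAngle ℓ A) (hF : IsLift ℓ b F)
    (hG : IsLift ℓ 0 G) :
    IsLift ℓ 0 (fun p => F (nextPoint A p) - F (p.1, A p) - G (p.1, A p)) := by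
  have h1 := hF.smooth
  have h2 := hG.smooth
  have h3 := hA.lift.smooth
  have h4 := hA.nextAngle.lift
  refine ⟨?_, fun s y => ?_⟩
  · simp only [nextPoint]
    fun_prop
  · have e : nextPoint A (s + ℓ, y) = ((nextPoint A (s, y)).1 + ℓ, (nextPoint A (s, y)).2) := by
      refine Prod.ext ?_ (h4.periodic s y)
      simp only [nextPoint]; ring
    simp only [e, hA.lift.periodic, hF.map_add, hG.periodic]
    ring

/-- First-order term in `d` of the first conjugation relation; the angle derivative of the even
first component is zero. It transfers the sign of `Y 0` to the derivative of `x₀`. -/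
theorem deriv_eq_of_conj (hA : IsChordAngle ℓ A)
    (hF : IsLift ℓ b (lazutkinFst k x₀ X)) (hG : IsLift ℓ 0 (lazutkinSnd k Y))
    (hX : (fun p => lazutkinFst k x₀ X (nextPoint A p) - lazutkinFst k x₀ X (p.1, A p) -
      lazutkinSnd k Y (p.1, A p)) =O[stripNhdsPos] fun p => p.2 ^ (2 * k + 2)) (s : ℝ) :
    deriv x₀ s = dy A (s, 0) * Y 0 s := by
  have h1 : HasDerivAt (fun t : ℝ => s + t) 1 0 := (hasDerivAt_id (0 : ℝ)).const_add s
  have h2 := hasDerivAt_snd_of_contDiff hA.nextAngle.lift.smooth s 0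
  have h3 := hasDerivAt_snd_of_contDiff hA.lift.smooth s 0
  have h4 := hasDerivAt_comp_prod hF.smooth h1 h2
  have h5 := hasDerivAt_comp_prod hF.smooth (hasDerivAt_const (0 : ℝ) s) h3
  have h6 := hasDerivAt_comp_prod hG.smooth (hasDerivAt_const (0 : ℝ) s) h3
  have h7 := (h4.sub h5).sub h6
  have hs : Tendsto (fun t : ℝ => (s, t)) (𝓝[>] 0) stripNhdsPos :=
    tendsto_comap_iff.2 tendsto_id
  have h8 := eq_zero_of_hasDerivAt_of_isBigO h7
    (by simp [hA.zero, nextPoint, lazutkinSnd_zero]) (N := 2 * k + 2) (by omega)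
    (hX.comp_tendsto hs)
  simp only [add_zero, hA.zero, hA.nextAngle.zero, dx_lazutkinFst hF.smooth,
    dy_lazutkinFst hF.smooth, dy_lazutkinSnd hG.smooth] at h8
  linarith

end Extraction

namespace BilliardTable

variable (B : BilliardTable) {k : ℕ}

theorem lazutkinForm_cover {x₀ : ℝ → ℝ} {X₀ : AddCircle B.ℓ → UnitAddCircle}
    {X Y : ℕ → AddCircle B.ℓ → ℝ} (hx : ∀ t : ℝ, (x₀ t : UnitAddCircle) = X₀ t) (p : ℝ × ℝ) :
    B.lazutkinForm k X₀ X Y (cylinderCover B.ℓ p) =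
      cylinderCover 1 (lazutkinFst k x₀ (fun j t => X j t) p,
        lazutkinSnd k (fun j t => Y j t) p) := by
  simp only [lazutkinForm, cylinderCover, lazutkinFst, lazutkinSnd, AddCircle.coe_add, hx]

/-- A diffeomorphism near the boundary circle has positive transverse derivative. -/
theorem dy_pos_of_diffeo {F H : ℝ × ℝ → ℝ} (hF : ContDiff ℝ ∞ F) (hH : ContDiff ℝ ∞ H)
    (hH0 : ∀ s, H (s, 0) = 0) (hFy : ∀ s, dy F (s, 0) = 0)
    {Ψ : AddCircle B.ℓ × ℝ → UnitAddCircle × ℝ}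
    (hΨ : ∀ p, Ψ (cylinderCover B.ℓ p) = cylinderCover 1 (F p, H p)) {ε : ℝ}
    {U : Set (AddCircle B.ℓ × ℝ)} {V : Set (UnitAddCircle × ℝ)}
    (hU : IsBoundaryNhd (Icc 0 Real.pi) U) (hV : IsBoundaryNhd (Ico 0 ε) V)
    (h : IsCylinderDiffeo Ψ U V) (s : ℝ) : 0 < dy H (s, 0) := by
  obtain ⟨hbij, -, G, hG, -, hGs⟩ := h
  obtain ⟨r₁, hr₁, hr₁U⟩ := eventually_stripNhds_iff.1
    (eventually_mem_of_isBoundaryNhd B.length_pos hU)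
  obtain ⟨r, hr, hrU⟩ : ∃ r > 0, ∀ t ∈ Ico 0 r, cylinderCover B.ℓ (s, t) ∈ U := by
    refine ⟨min r₁ Real.pi, lt_min hr₁ Real.pi_pos, fun t ht => hr₁U s t ?_ ⟨ht.1, ?_⟩⟩
    · rw [abs_of_nonneg ht.1]; exact ht.2.trans_le (min_le_left _ _)
    · exact (ht.2.trans_le (min_le_right _ _)).le
  have hmaps : ∀ t ∈ Ico 0 r, cylinderCover 1 (F (s, t), H (s, t)) ∈ V := fun t ht => by
    rw [← hΨ]; exact hbij.1 (hrU t ht)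
  have hdH := hasDerivAt_snd_of_contDiff hH s 0
  -- Otherwise the image of the vertical segment has zero velocity at `t = 0`, and so has its image
  -- under the smooth inverse; but the second coordinate of that image is `t`.
  have hne : dy H (s, 0) ≠ 0 := by
    intro h0
    have hc : HasDerivAt (fun t => (F (s, t), H (s, t))) ((0 : ℝ), (0 : ℝ)) 0 := by
      have := (hasDerivAt_snd_of_contDiff hF s 0).prodMk hdH
      rwa [hFy, h0] at this
    have h00 : (0 : ℝ) ∈ Ico 0 r := ⟨le_rfl, hr⟩
    have hGd := (hGs.differentiableOn (by simp)
      (F (s, 0), H (s, 0)) (hmaps 0 h00)).hasFDerivWithinAt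
    have h1 := hGd.comp_hasDerivWithinAt (0 : ℝ) (hc.hasDerivWithinAt (s := Ico 0 r))
      fun t ht => hmaps t ht
    have e : ∀ t ∈ Ico 0 r, ((fun q => (G (cylinderCover 1 q)).2) ∘
        fun t => (F (s, t), H (s, t))) t = t := by
      intro t ht
      simp only [Function.comp, ← hΨ]
      rw [hG.1 (hrU t ht)]
      rfl
    have h2 := h1.congr (fun t ht => (e t ht).symm) (e 0 h00).symm
    have h3 := (uniqueDiffOn_Ico 0 r 0 h00).eq_deriv _ h2 (hasDerivWithinAt_id 0 _)
    rw [show ((0 : ℝ), (0 : ℝ)) = 0 from rfl, map_zero] at h3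
    exact zero_ne_one h3
  have hnn : 0 ≤ dy H (s, 0) := by
    have hs := hdH.hasDerivWithinAt (s := Ioi 0)
    rw [hasDerivWithinAt_iff_tendsto_slope' (by simp)] at hs
    refine ge_of_tendsto hs ?_
    have : ∀ᶠ t in 𝓝[>] (0 : ℝ), t < r := nhdsWithin_le_nhds (eventually_lt_nhds hr)
    filter_upwards [this, self_mem_nhdsWithin] with t h1 h2
    have h2' : 0 < t := h2
    obtain ⟨⟨W, -, rfl⟩, -⟩ := hV
    have h3 : 0 ≤ H (s, t) := ((hmaps t ⟨h2'.le, h1⟩).2.2).1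
    rw [slope_def_field, hH0, sub_zero, sub_zero]
    positivity
  exact lt_of_le_of_ne hnn (Ne.symm hne)

/-- The diffeomorphism property gives `Y 0 > 0`, the conjugation then gives a positive derivative of
`x₀`, and injectivity on the boundary circle reduces the degree to `1`. -/
theorem exists_stripCoord_of_isLazutkinChange {A : ℝ × ℝ → ℝ} (hA : IsChordAngle B.ℓ A)
    (hbill : ∀ᶠ p in stripNhdsPos, B.billiardMap (cylinderCover B.ℓ (p.1, A p)) =
      cylinderCover B.ℓ (nextPoint A p)) {Ψ : AddCircle B.ℓ × ℝ → UnitAddCircle × ℝ}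
    (h : B.IsLazutkinChange k Ψ) :
    ∃ (x₀ : ℝ → ℝ) (X Y : ℕ → ℝ → ℝ),
      StripCoord B.ℓ 1 (lazutkinFst k x₀ X) (lazutkinSnd k Y) ∧
      (fun p => lazutkinFst k x₀ X (nextPoint A p) - lazutkinFst k x₀ X (p.1, A p) -
        lazutkinSnd k Y (p.1, A p)) =O[stripNhdsPos] (fun p => p.2 ^ (2 * k + 2)) ∧
      (fun p => lazutkinSnd k Y (nextPoint A p) - lazutkinSnd k Y (p.1, A p))
        =O[stripNhdsPos] fun p => p.2 ^ (2 * k + 2) := by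
  have hℓ := B.length_pos
  obtain ⟨⟨X₀, X, Y, hX₀, hX, hY, rfl⟩, U, ε, V, hε, hU, hV, hdiff, C, hC, δ, hδ, hconj⟩ := h
  obtain ⟨x₀, hx₀, hx₀X⟩ := exists_smooth_lift hX₀
  obtain ⟨n, hn⟩ := exists_degree (b := 1) hx₀.continuous
    (g := fun t => x₀ (t + B.ℓ)) (by have := hx₀.continuous; fun_prop) fun t => by
      have h1 := hx₀X (t + B.ℓ)
      have h2 := hx₀X t
      simp only [AddCircle.coe_add, AddCircle.coe_period, add_zero] at h1
      exact h1.trans h2.symm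
  simp only [mul_one] at hn
  set X' : ℕ → ℝ → ℝ := fun j t => X j t
  set Y' : ℕ → ℝ → ℝ := fun j t => Y j t
  have hXp : ∀ j ∈ Finset.Ico 1 k, ∀ s, X' j (s + B.ℓ) = X' j s := fun j _ s => by simp [X']
  have hYp : ∀ j s, Y' j (s + B.ℓ) = Y' j s := fun j s => by simp [Y']
  have hF : IsLift B.ℓ n (lazutkinFst k x₀ X') := isLift_lazutkinFst hx₀ hX hn hXp
  have hG : IsLift B.ℓ 0 (lazutkinSnd k Y') := isLift_lazutkinSnd hY hYp
  have hΨ : ∀ p, B.lazutkinForm k X₀ X Y (cylinderCover B.ℓ p) =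
      cylinderCover 1 (lazutkinFst k x₀ X' p, lazutkinSnd k Y' p) :=
    B.lazutkinForm_cover hx₀X
  have hΨ0 : ∀ s : ℝ, B.lazutkinForm k X₀ X Y ((s : AddCircle B.ℓ), 0) =
      ((x₀ s : UnitAddCircle), 0) := fun s => by
    have := hΨ (s, 0)
    rwa [lazutkinFst_zero, lazutkinSnd_zero] at this
  have hY0 : ∀ s, 0 < Y' 0 s := fun s => by
    rw [← dy_lazutkinSnd hG.smooth s]
    exact B.dy_pos_of_diffeo hF.smooth hG.smooth lazutkinSnd_zero (dy_lazutkinFst hF.smooth) hΨ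
      hU hV hdiff s
  have hap := hA.tendsto_angle_pos hℓ
  have hnp := hA.tendsto_nextPoint_pos hℓ
  have hUe := eventually_mem_of_isBoundaryNhd hℓ hU
  have hUp : ∀ᶠ p in stripNhdsPos, cylinderCover B.ℓ p ∈ U := by
    have h1 := tendsto_stripNhdsPos_iff.1 (tendsto_id (x := stripNhdsPos))
    filter_upwards [stripNhdsPos_le hUe, h1.1.eventually_le_const Real.pi_pos, h1.2] with
      p h1 h2 h3
    exact h1 ⟨h3.le, h2⟩
  have hGz := hG.tendsto_zero hℓ lazutkinSnd_zero
  have hGd : ∀ᶠ p in stripNhdsPos, lazutkinSnd k Y' p < δ :=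
    stripNhdsPos_le (hGz.eventually_lt_const hδ)
  have hGO : (fun p => lazutkinSnd k Y' (p.1, A p) ^ (2 * k + 2)) =O[stripNhdsPos]
      fun p => p.2 ^ (2 * k + 2) :=
    ((((hG.isBigO_snd hℓ lazutkinSnd_zero).mono stripNhdsPos_le).comp_tendsto hap).trans
      (hA.isBigO_snd hℓ)).pow _
  have hR0 := (isLift_conjDefect hA hF hG).tendsto_zero hℓ
    (fun s => by simp [hA.zero, nextPoint, lazutkinSnd_zero])
  -- Once the lifted defect is at most `1 / 2`, its absolute value equals the norm in the circle, so
  -- the estimate on the circle bounds the lift.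
  have hRs : ∀ᶠ p in stripNhdsPos, |lazutkinFst k x₀ X' (nextPoint A p) -
      lazutkinFst k x₀ X' (p.1, A p) - lazutkinSnd k Y' (p.1, A p)| ≤ 1 / 2 :=
    stripNhdsPos_le ((hR0.abs).eventually_le_const (by norm_num))
  have hboth : ∀ᶠ p in stripNhdsPos,
      |lazutkinFst k x₀ X' (nextPoint A p) - lazutkinFst k x₀ X' (p.1, A p) -
        lazutkinSnd k Y' (p.1, A p)| ≤ C * lazutkinSnd k Y' (p.1, A p) ^ (2 * k + 2) ∧
      |lazutkinSnd k Y' (nextPoint A p) - lazutkinSnd k Y' (p.1, A p)| ≤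
        C * lazutkinSnd k Y' (p.1, A p) ^ (2 * k + 2) := by
    filter_upwards [hbill, hap.eventually hUp, hnp.eventually hUp, hap.eventually hGd, hRs] with
      p h1 h2 h3 h4 h5
    have h6 := hconj _ h2 (by rw [h1]; exact h3) (by rw [hΨ]; exact h4)
    rw [h1, hΨ, hΨ] at h6
    refine ⟨?_, h6.2⟩
    have h7 := h6.1
    simp only [cylinderCover] at h7
    rw [← AddCircle.coe_add, ← AddCircle.coe_sub, ← sub_sub,
      (AddCircle.norm_coe_eq_abs_iff 1 one_ne_zero).2 (by simpa using h5)] at h7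
    exact h7
  have key : ∀ {x y : ℝ}, |x| ≤ C * y → ‖x‖ ≤ C * ‖y‖ := fun h =>
    h.trans (mul_le_mul_of_nonneg_left (le_abs_self _) hC.le)
  have hXO : (fun p => lazutkinFst k x₀ X' (nextPoint A p) - lazutkinFst k x₀ X' (p.1, A p) -
      lazutkinSnd k Y' (p.1, A p)) =O[stripNhdsPos] (fun p => p.2 ^ (2 * k + 2)) :=
    (IsBigO.of_bound C (hboth.mono fun p hp => key hp.1)).trans hGO
  have hYO : (fun p => lazutkinSnd k Y' (nextPoint A p) - lazutkinSnd k Y' (p.1, A p))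
      =O[stripNhdsPos] (fun p => p.2 ^ (2 * k + 2)) :=
    (IsBigO.of_bound C (hboth.mono fun p hp => key hp.2)).trans hGO
  have hx' : ∀ s, 0 < deriv x₀ s := fun s => by
    rw [deriv_eq_of_conj hA hF hG hXO]
    exact mul_pos (hA.dy_pos s) (hY0 s)
  have hn1 : n = 1 := by
    refine degree_eq_one hℓ one_pos hx₀.continuous (strictMono_of_deriv_pos hx')
      (fun t => by rw [mul_one]; exact hn t) fun s t hst => ?_
    have h1 := hdiff.1.2.1 (hU.2 s) (hU.2 t) (by rw [hΨ0, hΨ0]; exact Prod.ext hst rfl)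
    exact congrArg Prod.fst h1
  subst hn1
  exact ⟨x₀, X', Y', stripCoord_lazutkin hx₀ hX hY (by simpa using hn) hXp hYp hx' hY0, hXO, hYO⟩

end BilliardTable

/-! ### Angular functions and their lifts -/

namespace BilliardTable

variable (B : BilliardTable) {k : ℕ} {A : ℝ × ℝ → ℝ}

/-- For small `η > 0` the forward displacement is positive and the backward one negative. The
backward angle is therefore minus a value of `A`, which is why the defect is a sum. -/
theorem eventually_angles (hA : B.HasChordAngle A) {S : ℝ × ℝ → ℝ}
    (hS : IsLift 1 B.ℓ S) (hSx : ∀ ξ, 0 < dx S (ξ, 0)) :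
    ∀ᶠ q in stripNhdsPos,
      B.curve (S (q.1 + q.2, q.2)) ≠ B.curve (S q) ∧
      B.curve (S (q.1 - q.2, q.2)) ≠ B.curve (S q) ∧
      InnerProductGeometry.angle (B.unitTangent (S q))
          (B.curve (S (q.1 + q.2, q.2)) - B.curve (S q)) -
        InnerProductGeometry.angle (-B.unitTangent (S q))
          (B.curve (S (q.1 - q.2, q.2)) - B.curve (S q)) = reflectionDefect A S q := by
  have hp := (stripCoord_shift_sub hS hSx).tendsto_stripPos one_pos
  have hp0 := hp.mono_right stripNhdsPos_le
  have hp2 := (tendsto_stripNhdsPos_iff.1 hp).2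
  have hm := (tendsto_stripNhdsPos_iff.1 hp).1.comp
    (tendsto_stripNhdsPos_of_snd_eq fun q => q.1 - q.2)
  have hm2 := (tendsto_stripNhdsPos_of_snd_eq fun q => q.1 - q.2).eventually hp2
  simp only [Function.comp_def, sub_add_cancel] at hm hm2
  have hm0 : Tendsto (fun q => (S q, S (q.1 - q.2, q.2) - S q)) stripNhdsPos stripNhds :=
    tendsto_stripNhds_iff.2 (by simpa using hm.neg)
  filter_upwards [hp2, hm2, hp0.eventually hA.curve_ne, hm0.eventually hA.curve_ne,
    hp0.eventually hA.angle_pos, hm0.eventually hA.angle_neg] with q h1 h2 h3 h4 h5 h6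
  simp only [add_sub_cancel] at h1 h2 h3 h4 h5 h6
  have h2' : S (q.1 - q.2, q.2) - S q < 0 := by
    have : S (q.1, q.2) = S q := rfl
    rw [this] at h2; linarith
  refine ⟨h3 h1.ne', h4 h2'.ne, ?_⟩
  rw [h5 h1, h6 h2', reflectionDefect]
  ring

theorem coe_eq_of_curve_eq {s t : ℝ} (h : B.curve s = B.curve t) :
    (s : AddCircle B.ℓ) = (t : AddCircle B.ℓ) := B.injective h

theorem exists_int_of_coe_eq {a s t : ℝ} (h : (s : AddCircle a) = (t : AddCircle a)) :
    ∃ n : ℤ, s = t + n * a := by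
  have h0 : ((s - t : ℝ) : AddCircle a) = 0 := by simp [h]
  obtain ⟨n, hn⟩ := (AddCircle.coe_eq_zero_iff a).1 h0
  refine ⟨n, ?_⟩
  rw [zsmul_eq_mul] at hn
  linarith

/-- Passing from a lift to an angular function. -/
theorem exists_isAngularFunction (hA : B.HasChordAngle A) {S : ℝ × ℝ → ℝ}
    (hS : IsLift 1 B.ℓ S) (hSx : ∀ ξ, 0 < dx S (ξ, 0))
    (hSe : ∀ᶠ q in stripNhds, S (q.1, -q.2) = S q)
    (hSb : ∀ᶠ q in stripNhds, S (0, q.2) = S (0, 0))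
    (hdef : reflectionDefect A S =O[stripNhdsPos] fun q => q.2 ^ (2 * k + 2)) :
    ∃ ε > (0 : ℝ), ∃ Z : UnitAddCircle → ℝ → ℂ, B.IsAngularFunction k ε Z := by
  have hℓ := B.length_pos
  obtain ⟨m, hm, hSm⟩ := exists_pos_le_of_periodic one_pos hS.smooth.dx.continuous
    hS.isLift_dx.periodic hSx
  -- On this annulus `S (·, η)` is strictly increasing, `S` is even in `η`, and the base point is
  -- fixed.
  obtain ⟨ε, hε, hall⟩ := eventually_stripNhds_iff.1 ((hSm.and hSe).and hSb)
  have hper : ∀ η, Function.Periodic (fun ξ => B.curve (S (ξ, η))) 1 := fun η ξ => by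
    simp only [hS.map_add, curve_add]
  have hmono : ∀ η ∈ Ioo (-ε) ε, StrictMono fun ξ => S (ξ, η) := fun η hη => by
    refine strictMono_of_deriv_pos fun ξ => ?_
    rw [(hasDerivAt_fst_of_contDiff hS.smooth ξ η).deriv]
    exact hm.trans_le (hall ξ η (abs_lt.2 hη)).1.1
  set Z : UnitAddCircle → ℝ → ℂ := fun x η => (hper η).lift x with hZ
  have hZc : ∀ (ξ η : ℝ), Z (ξ : UnitAddCircle) η = B.curve (S (ξ, η)) := fun ξ η =>
    (hper η).lift_coe ξ
  have heven : ∀ ξ, ∀ η ∈ Ioo (-ε) ε, Z ξ (-η) = Z ξ η := fun x η hη => by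
    obtain ⟨ξ, rfl⟩ := QuotientAddGroup.mk_surjective x
    exact (hZc _ _).trans ((congrArg B.curve (hall ξ η (abs_lt.2 hη)).1.2).trans (hZc _ _).symm)
  refine ⟨ε, hε, Z, ⟨?_, heven, ?_, ?_, ?_, ?_⟩⟩
  · simp only [hZc]
    have := B.contDiff_curve.comp hS.smooth
    exact this.contDiffOn
  · intro η hη
    refine ⟨?_, ?_, ?_⟩
    · intro x _
      obtain ⟨ξ, rfl⟩ := QuotientAddGroup.mk_surjective x
      exact (hZc ξ η ▸ B.curve_mem_frontier _ : Z (ξ : UnitAddCircle) η ∈ frontier B.Ω)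
    · intro x _ y _ hxy
      obtain ⟨ξ, rfl⟩ := QuotientAddGroup.mk_surjective x
      obtain ⟨ξ', rfl⟩ := QuotientAddGroup.mk_surjective y
      have h1 : B.curve (S (ξ, η)) = B.curve (S (ξ', η)) :=
        (hZc ξ η).symm.trans (hxy.trans (hZc ξ' η))
      obtain ⟨n, hn⟩ := exists_int_of_coe_eq (B.coe_eq_of_curve_eq h1)
      rw [← hS.map_add_int n] at hn
      have h2 := (hmono η hη).injective hn
      change ((ξ : ℝ) : UnitAddCircle) = ((ξ' : ℝ) : UnitAddCircle)
      rw [h2]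
      have h3 : (((n : ℝ) * 1 : ℝ) : UnitAddCircle) = 0 := by
        rw [AddCircle.coe_eq_zero_iff]; exact ⟨n, by simp⟩
      rw [AddCircle.coe_add, h3, add_zero]
    · intro z hz
      rw [← B.range_eq] at hz
      obtain ⟨y, rfl⟩ := hz
      obtain ⟨t, rfl⟩ := QuotientAddGroup.mk_surjective y
      obtain ⟨ξ, hξ⟩ := hS.surjective hℓ η t
      refine ⟨(ξ : UnitAddCircle), mem_univ _, ?_⟩
      exact (hZc ξ η).trans (by rw [hξ]; rfl)
  · intro η hη x s hs
    obtain ⟨ξ, rfl⟩ := QuotientAddGroup.mk_surjective x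
    have h1 : s = (S (ξ, η) : AddCircle B.ℓ) := B.injective (hs.trans (hZc ξ η))
    refine ⟨dx S (ξ, η), hm.trans_le (hall ξ η (abs_lt.2 hη)).1.1, ?_⟩
    rw [h1, tangent_coe]
    refine (circleDeriv_coe _ ξ).trans ?_
    simp only [hZc]
    have := (B.hasDerivAt_curve (S (ξ, η))).scomp ξ (hasDerivAt_fst_of_contDiff hS.smooth ξ η)
    rw [← Complex.real_smul]
    exact this.deriv
  · intro η hη
    have h0 := (hall 0 η (abs_lt.2 hη)).2
    have h1 := hZc 0 η
    have h2 := hZc 0 0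
    rw [AddCircle.coe_zero] at h1 h2
    rw [h1, h2, h0]
  · obtain ⟨C, hC, hb⟩ := hdef.exists_pos
    obtain ⟨δ, hδ, hpc⟩ := eventually_stripNhdsPos_iff.1
      ((B.eventually_angles hA hS hSx).and hb.bound)
    have hZp : ∀ ξ η : ℝ, Z ((ξ : UnitAddCircle) + (η : UnitAddCircle)) η =
        B.curve (S (ξ + η, η)) := fun ξ η => by rw [← AddCircle.coe_add, hZc]
    have hZm : ∀ ξ η : ℝ, Z ((ξ : UnitAddCircle) - (η : UnitAddCircle)) η =
        B.curve (S (ξ - η, η)) := fun ξ η => by rw [← AddCircle.coe_sub, hZc]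
    -- The `O` bound is non-strict and a pseudocollision needs a strict one, hence `C + 1`.
    refine ⟨C + 1, by linarith, δ, hδ, fun x η hη hη0 hηδ => ?_⟩
    obtain ⟨ξ, rfl⟩ := QuotientAddGroup.mk_surjective x
    change B.IsPseudocollision _ (Z ((ξ : UnitAddCircle) - (η : UnitAddCircle)) η)
      (Z (ξ : UnitAddCircle) η) (Z ((ξ : UnitAddCircle) + (η : UnitAddCircle)) η)
    have hbound : ∀ ζ, 0 < ζ → ζ < δ → |reflectionDefect A S (ξ, ζ)| <
        (C + 1) * ζ ^ (2 * k + 2) := fun ζ h1 h2 => by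
      have h3 := (hpc ξ ζ h1 h2).2
      rw [Real.norm_eq_abs, Real.norm_of_nonneg (by positivity)] at h3
      have : 0 < ζ ^ (2 * k + 2) := by positivity
      linarith
    rcases lt_or_gt_of_ne hη0 with hneg | hpos
    · have hη' : -η ∈ Ioo (-ε) ε := ⟨by linarith [hη.2], by linarith [hη.1]⟩
      have h1 : 0 < -η := by linarith
      have h2 : -η < δ := by rwa [abs_of_neg hneg] at hηδ
      obtain ⟨n1, n2, n3⟩ := (hpc ξ (-η) h1 h2).1
      rw [← heven _ η hη, ← heven _ η hη, ← heven _ η hη]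
      rw [show (ξ : UnitAddCircle) - (η : UnitAddCircle) =
        (ξ : UnitAddCircle) + ((-η : ℝ) : UnitAddCircle) by rw [AddCircle.coe_neg]; abel,
        show (ξ : UnitAddCircle) + (η : UnitAddCircle) =
        (ξ : UnitAddCircle) - ((-η : ℝ) : UnitAddCircle) by rw [AddCircle.coe_neg]; abel,
        hZp, hZm, hZc]
      refine ⟨B.curve_mem_frontier _, B.curve_mem_frontier _, n1, n2, _, rfl, ?_⟩
      rw [tangent_coe]
      have h3 := hbound _ h1 h2
      rw [← n3, Even.neg_pow ⟨k + 1, by ring⟩] at h3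
      -- For `η < 0` the two neighbours are exchanged. With the angle to the negative tangent
      -- rewritten as `π` minus the angle to the positive one, the difference is symmetric in them.
      rw [InnerProductGeometry.angle_neg_left] at h3 ⊢
      convert h3 using 2
      ring
    · have h2 : η < δ := by rwa [abs_of_pos hpos] at hηδ
      obtain ⟨n1, n2, n3⟩ := (hpc ξ η hpos h2).1
      rw [hZp, hZm, hZc]
      refine ⟨B.curve_mem_frontier _, B.curve_mem_frontier _, n2, n1, _, rfl, ?_⟩
      rw [tangent_coe]
      have h3 := hbound _ hpos h2
      rw [← n3] at h3
      exact h3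

end BilliardTable

theorem continuous_of_continuous_coe {a : ℝ} {α : Type*} [TopologicalSpace α]
    {f : AddCircle a → α} (hf : Continuous fun t : ℝ => f (t : AddCircle a)) : Continuous f :=
  QuotientAddGroup.isOpenQuotientMap_mk.isQuotientMap.continuous_iff.2 hf

namespace BilliardTable

variable (B : BilliardTable) {k : ℕ} {A : ℝ × ℝ → ℝ}

theorem isEmbedding_γ : IsEmbedding B.γ := by
  have : Fact (0 < B.ℓ) := ⟨B.length_pos⟩
  exact (Continuous.isClosedEmbedding (continuous_of_continuous_coe B.smooth.continuous)
    B.injective).isEmbedding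

/-- A continuous map from a simply connected space to the boundary lifts to the line. -/
theorem exists_curve_lift {E : Type*} [TopologicalSpace E] [SimplyConnectedSpace E]
    [LocallyPathConnectedSpace E] {F : E → ℂ} (hF : Continuous F) (h : ∀ x, F x ∈ frontier B.Ω) :
    ∃ f : E → ℝ, Continuous f ∧ ∀ x, B.curve (f x) = F x := by
  rw [← B.range_eq] at h
  choose G hG using h
  have hGc : Continuous G := B.isEmbedding_γ.continuous_iff.2 (hF.congr fun x => (hG x).symm)
  obtain ⟨f, hf, hfG⟩ := exists_continuous_lift hGc
  exact ⟨f, hf, fun x => by rw [curve, hfG, hG]⟩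

/-- Passing from an angular function to its lift. -/
theorem exists_lift_of_isAngularFunction (hA : B.HasChordAngle A) {ε : ℝ} (hε : 0 < ε)
    {Z : UnitAddCircle → ℝ → ℂ} (hZ : B.IsAngularFunction k ε Z) :
    ∃ S, IsLift 1 B.ℓ S ∧ (∀ ξ, 0 < dx S (ξ, 0)) ∧
      (∀ᶠ q in stripNhds, S (q.1, -q.2) = S q) ∧
      reflectionDefect A S =O[stripNhdsPos] fun q => q.2 ^ (2 * k + 2) := by
  have hℓ := B.length_pos
  -- Clamping `η` to `[-ε/2, ε/2]` extends `Z` continuously to the simply connected plane, where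
  -- lifting applies, without changing it near `η = 0`.
  set c : ℝ → ℝ := fun η => max (-(ε / 2)) (min η (ε / 2)) with hc
  have hcc : Continuous c := by fun_prop
  have hcI : ∀ η, c η ∈ Ioo (-ε) ε := fun η =>
    ⟨lt_of_lt_of_le (by linarith) (le_max_left _ _),
      (max_le (by linarith) (min_le_right _ _)).trans_lt (by linarith : ε / 2 < ε)⟩
  have hcid : ∀ η, |η| < ε / 2 → c η = η := fun η hη => by
    rw [abs_lt] at hη
    simp only [hc]
    rw [min_eq_left hη.2.le, max_eq_right hη.1.le]
  have hcneg : ∀ η, c (-η) = -c η := fun η => by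
    simp only [hc]
    rw [← min_neg_neg, neg_neg, ← max_neg_neg, max_min_distrib_left, max_comm (-(ε / 2)) (-η)]
    rw [max_eq_right (by linarith : -(ε / 2) ≤ ε / 2), min_comm]
  set F : ℝ × ℝ → ℂ := fun q => Z (q.1 : UnitAddCircle) (c q.2) with hF
  have hFc : Continuous F := by
    have h1 : Continuous fun q : ℝ × ℝ => (q.1, c q.2) := by fun_prop
    exact ContinuousOn.comp_continuous hZ.smooth.continuousOn h1 fun q => ⟨mem_univ _, hcI _⟩
  obtain ⟨T, hT, hTF⟩ := B.exists_curve_lift hFc fun q => (hZ.bijOn _ (hcI q.2)).1 (mem_univ _)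
  have hTn : ∀ q : ℝ × ℝ, T (q.1, -q.2) = T q := by
    obtain ⟨n, hn⟩ := exists_degree (b := B.ℓ) hT (g := fun q => T (q.1, -q.2)) (by fun_prop)
      fun q => B.coe_eq_of_curve_eq (by
        rw [hTF, hTF]
        simp only [hF, hcneg]
        exact hZ.even _ _ (hcI _))
    -- The two lifts agree at `η = 0`, so their constant difference is zero.
    have h0 := hn (0, 0)
    simp only [neg_zero, left_eq_add] at h0
    intro q
    simpa [h0] using hn q
  obtain ⟨n, hn⟩ := exists_degree (b := B.ℓ) hT (g := fun q => T (q.1 + 1, q.2)) (by fun_prop)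
    fun q => B.coe_eq_of_curve_eq (by
      rw [hTF, hTF]
      simp only [hF, AddCircle.coe_add, AddCircle.coe_period, add_zero])
  have hhalf : ∀ᶠ q in stripNhds, |q.2| < ε / 2 :=
    eventually_stripNhds_iff.2 ⟨ε / 2, by linarith, fun s y h => h⟩
  have hTs : ∀ᶠ q in stripNhds, ContDiffAt ℝ ∞ T q := by
    filter_upwards [hhalf] with q hq
    refine contDiffAt_of_comp_curve hT.continuousAt B.contDiff_curve
      (B.unitTangent_ne_zero _) ?_
    have hmem : (univ ×ˢ Ioo (-ε) ε : Set (ℝ × ℝ)) ∈ 𝓝 q := by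
      refine (isOpen_univ.prod isOpen_Ioo).mem_nhds ⟨mem_univ _, ?_⟩
      rw [← hcid _ hq]; exact hcI _
    refine (hZ.smooth.contDiffAt hmem).congr_of_eventuallyEq ?_
    have : ∀ᶠ p in 𝓝 q, |p.2| < ε / 2 :=
      (continuous_abs.comp continuous_snd).tendsto q |>.eventually_lt_const hq
    filter_upwards [this] with p hp
    rw [hTF]
    simp only [hF, hcid _ hp]
  obtain ⟨S, hS, hST⟩ := exists_isLift_eventuallyEq one_pos hTs (Eventually.of_forall hn)
  have hSZ : ∀ᶠ q in stripNhds, B.curve (S q) = Z (q.1 : UnitAddCircle) q.2 := by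
    filter_upwards [hST, hhalf] with q h1 h2
    rw [h1, hTF]
    simp only [hF, hcid _ h2]
  have hSZ0 : ∀ ξ : ℝ, B.curve (S (ξ, 0)) = Z (ξ : UnitAddCircle) 0 := fun ξ =>
    (eventually_nhds_of_stripNhds hSZ ξ).self_of_nhds
  have h0I : (0 : ℝ) ∈ Ioo (-ε) ε := ⟨by linarith, hε⟩
  have hSx : ∀ ξ, 0 < dx S (ξ, 0) := by
    intro ξ
    obtain ⟨r, hr, e⟩ := hZ.orientation 0 h0I (ξ : UnitAddCircle) (S (ξ, 0)) (hSZ0 ξ)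
    have h1 := (B.hasDerivAt_curve (S (ξ, 0))).scomp ξ (hasDerivAt_fst_of_contDiff hS.smooth ξ 0)
    rw [circleDeriv_coe, tangent_coe] at e
    simp only [← hSZ0] at e
    have h2 := h1.deriv.symm.trans e
    rw [Complex.real_smul] at h2
    have h3 := mul_right_cancel₀ (B.unitTangent_ne_zero _) h2
    have h4 : dx S (ξ, 0) = r := by exact_mod_cast h3
    rw [h4]; exact hr
  have hn1 : n = 1 := by
    have hS0 : Continuous fun ξ => S (ξ, 0) := by
      have := hS.smooth.continuous
      fun_prop
    refine degree_eq_one one_pos hℓ hS0 (strictMono_of_deriv_pos fun ξ => ?_)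
      (fun ξ => hS.map_add ξ 0) fun ξ ξ' h => ?_
    · rw [(hasDerivAt_fst_of_contDiff hS.smooth ξ 0).deriv]
      exact hSx ξ
    · refine (hZ.bijOn 0 h0I).2.1 (mem_univ _) (mem_univ _) ?_
      simp only [← hSZ0, curve, h]
  rw [hn1, Int.cast_one, one_mul] at hS
  have hneg : Tendsto (fun q : ℝ × ℝ => (q.1, -q.2)) stripNhds stripNhds :=
    tendsto_stripNhds_neg _
  refine ⟨S, hS, hSx, ?_, ?_⟩
  · filter_upwards [hST, hneg.eventually hST] with q h1 h2
    rw [h1, h2, hTn]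
  · obtain ⟨C, hC, δ, hδ, hpc⟩ := hZ.pseudocollision
    have hsmall : ∀ᶠ q in stripNhdsPos, q.2 < min δ ε :=
      stripNhdsPos_le (tendsto_snd_stripNhds.eventually_lt_const (lt_min hδ hε))
    refine IsBigO.of_bound C ?_
    have ht : ∀ f : ℝ × ℝ → ℝ, Tendsto (fun q => (f q, q.2)) stripNhdsPos stripNhds := fun f =>
      tendsto_stripNhds_of_snd_eq stripNhdsPos_le f
    filter_upwards [B.eventually_angles hA hS hSx, hsmall, eventually_stripNhdsPos_pos,
      stripNhdsPos_le hSZ, (ht fun q => q.1 + q.2).eventually hSZ,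
      (ht fun q => q.1 - q.2).eventually hSZ] with q h1 h2 h3 h4 h5 h6
    have h7 := hpc (q.1 : UnitAddCircle) q.2
      ⟨by linarith, h2.trans_le (min_le_right _ _)⟩ h3.ne'
      (by rw [abs_of_pos h3]; exact h2.trans_le (min_le_left _ _))
    rw [← AddCircle.coe_add, ← AddCircle.coe_sub, ← h4, ← h5, ← h6] at h7
    obtain ⟨-, -, -, -, s, hs, h8⟩ := h7
    have hs' : s = (S q : AddCircle B.ℓ) := B.injective hs
    rw [hs', tangent_coe, h1.2.2] at h8
    rw [Real.norm_eq_abs, Real.norm_of_nonneg (by positivity)]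
    exact h8.le

end BilliardTable

/-! ### Descending to the cylinder -/

theorem contDiff_toCircle_coe {E : Type*} [NormedAddCommGroup E] [NormedSpace ℝ E] {a : ℝ}
    {f : E → ℝ} (hf : ContDiff ℝ ∞ f) :
    ContDiff ℝ ∞ fun x => ((AddCircle.toCircle (f x : AddCircle a) : Circle) : ℂ) := by
  simp only [AddCircle.toCircle_apply_mk, Circle.coe_exp]
  have h1 : ContDiff ℝ ∞ fun x => ((2 * Real.pi / a * f x : ℝ) : ℂ) :=
    Complex.ofRealCLM.contDiff.comp (contDiff_const.mul hf)
  exact (h1.mul contDiff_const).cexp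

/-- A map between cylinders with a smooth lift is smooth. -/
theorem smoothOnCylinder_of_lift {a b : ℝ} {Ψ : AddCircle a × ℝ → AddCircle b × ℝ}
    {F G : ℝ × ℝ → ℝ} (hF : ContDiff ℝ ∞ F) (hG : ContDiff ℝ ∞ G)
    (h : ∀ p, Ψ (cylinderCover a p) = cylinderCover b (F p, G p)) (U : Set (AddCircle a × ℝ)) :
    SmoothOnCylinder Ψ U := by
  refine ⟨?_, ?_⟩
  · simp only [SmoothToCircleOn, h]
    exact (contDiff_toCircle_coe hF).contDiffOn
  · simp only [h]
    exact hG.contDiffOn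

theorem cylinderCover_surjective (a : ℝ) : Function.Surjective (cylinderCover a) := by
  rintro ⟨x, y⟩
  obtain ⟨t, rfl⟩ := QuotientAddGroup.mk_surjective x
  exact ⟨(t, y), rfl⟩

theorem exists_cylinder_map {a b : ℝ} {F G : ℝ × ℝ → ℝ} (hF : IsLift a b F) (hG : IsLift a 0 G) :
    ∃ Ψ : AddCircle a × ℝ → AddCircle b × ℝ,
      ∀ p, Ψ (cylinderCover a p) = cylinderCover b (F p, G p) := by
  have h1 : ∀ y, Function.Periodic (fun s => (F (s, y) : AddCircle b)) a := fun y s => by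
    simp [hF.map_add]
  have h2 : ∀ y, Function.Periodic (fun s => G (s, y)) a := fun y s => hG.periodic s y
  exact ⟨fun p => ((h1 p.2).lift p.1, (h2 p.2).lift p.1), fun p => rfl⟩

/-- Near the boundary, a change of coordinates descends to a diffeomorphism between
neighbourhoods of the boundary circles, contained in any prescribed neighbourhood. -/
theorem StripCoord.exists_diffeo {a b : ℝ} {F G : ℝ × ℝ → ℝ} (ha : 0 < a) (hb : 0 < b)
    (h : StripCoord a b F G) {Ψ : AddCircle a × ℝ → AddCircle b × ℝ}
    (hΨ : ∀ p, Ψ (cylinderCover a p) = cylinderCover b (F p, G p)) {R M : ℝ} (hR : 0 < R)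
    (hRM : R ≤ M) :
    ∃ (U : Set (AddCircle a × ℝ)) (ε : ℝ) (V : Set (AddCircle b × ℝ)),
      0 < ε ∧ IsBoundaryNhd (Icc 0 M) U ∧ IsBoundaryNhd (Ico 0 ε) V ∧ IsCylinderDiffeo Ψ U V ∧
      ∀ p ∈ U, 0 ≤ p.2 ∧ p.2 < R := by
  obtain ⟨P, Q, hPQ, hr, hl⟩ := h.exists_inverse ha hb
  obtain ⟨Θ, hΘ⟩ := exists_cylinder_map hPQ.fst hPQ.snd
  have hGpos := (tendsto_stripNhdsPos_iff.1 (h.tendsto_stripPos ha)).2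
  have hQpos := (tendsto_stripNhdsPos_iff.1 (hPQ.tendsto_stripPos hb)).2
  obtain ⟨r₁, hr₁, k₁⟩ := eventually_stripNhds_iff.1 hl
  obtain ⟨r₂, hr₂, k₂⟩ := eventually_stripNhdsPos_iff.1 hGpos
  set r := min (min r₁ r₂) R
  have hr0 : 0 < r := lt_min (lt_min hr₁ hr₂) hR
  have hrr₁ : r ≤ r₁ := (min_le_left _ _).trans (min_le_left _ _)
  have hrr₂ : r ≤ r₂ := (min_le_left _ _).trans (min_le_right _ _)
  have hrR : r ≤ R := min_le_right _ _
  obtain ⟨ρ₁, hρ₁, k₃⟩ := eventually_stripNhds_iff.1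
    (hr.and ((hPQ.snd.tendsto_zero hb hPQ.snd_zero).eventually_lt_const hr0))
  obtain ⟨ρ₂, hρ₂, k₄⟩ := eventually_stripNhdsPos_iff.1 hQpos
  set ρ := min ρ₁ ρ₂
  have hρ : 0 < ρ := lt_min hρ₁ hρ₂
  have hΨ2 : Continuous fun u => (Ψ u).2 := by
    have hq : IsQuotientMap (cylinderCover a) :=
      (QuotientAddGroup.isOpenQuotientMap_mk.prodMap IsOpenQuotientMap.id).isQuotientMap
    refine hq.continuous_iff.2 (h.snd.smooth.continuous.congr fun p => ?_)
    simp only [Function.comp, hΨ]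
    rfl
  -- `V` is a full collar of height `ρ` and `U` is its preimage within the height `r`. The choice of
  -- `ρ` keeps the inverse image of `V` below `r`, which makes the map onto.
  set U : Set (AddCircle a × ℝ) := {u | u.2 ∈ Ico 0 r ∧ (Ψ u).2 < ρ}
  set V : Set (AddCircle b × ℝ) := {v | v.2 ∈ Ico 0 ρ}
  have hGnn : ∀ s y, y ∈ Ico 0 r → 0 ≤ G (s, y) := by
    intro s y hy
    rcases hy.1.eq_or_lt with rfl | hpos
    · rw [h.snd_zero]
    · exact (k₂ s y hpos (hy.2.trans_le hrr₂)).le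
  have hQnn : ∀ s y, y ∈ Ico 0 ρ → 0 ≤ Q (s, y) := by
    intro s y hy
    rcases hy.1.eq_or_lt with rfl | hpos
    · rw [hPQ.snd_zero]
    · exact (k₄ s y hpos (hy.2.trans_le (min_le_right _ _))).le
  have hmapU : MapsTo Ψ U V := by
    intro u hu
    obtain ⟨⟨s, y⟩, rfl⟩ := cylinderCover_surjective a u
    obtain ⟨hu1, hu2⟩ := hu
    rw [hΨ] at hu2
    change (Ψ (cylinderCover a (s, y))).2 ∈ Ico 0 ρ
    rw [hΨ]
    exact ⟨hGnn s y hu1, hu2⟩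
  have hΨΘ : ∀ v ∈ V, Ψ (Θ v) = v := by
    intro v hv
    obtain ⟨⟨s, y⟩, rfl⟩ := cylinderCover_surjective b v
    have hy : y ∈ Ico 0 ρ := hv
    have hk := (k₃ s y (by
      rw [abs_of_nonneg hy.1]; exact hy.2.trans_le (min_le_left _ _))).1
    rw [hΘ, hΨ, hk.1, hk.2]
  have hmapV : MapsTo Θ V U := by
    intro v hv
    have hv' := hΨΘ v hv
    obtain ⟨⟨s, y⟩, rfl⟩ := cylinderCover_surjective b v
    have hy : y ∈ Ico 0 ρ := hv
    have hk := (k₃ s y (by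
      rw [abs_of_nonneg hy.1]; exact hy.2.trans_le (min_le_left _ _))).2
    refine ⟨?_, ?_⟩
    · rw [hΘ]
      exact ⟨hQnn s y hy, hk⟩
    · rw [hv']
      exact hy.2
  have hΘΨ : ∀ u ∈ U, Θ (Ψ u) = u := by
    intro u hu
    obtain ⟨⟨s, y⟩, rfl⟩ := cylinderCover_surjective a u
    have hy : y ∈ Ico 0 r := hu.1
    have hk := k₁ s y (by rw [abs_of_nonneg hy.1]; exact hy.2.trans_le hrr₁)
    rw [hΨ, hΘ, hk.1, hk.2]
  have hinv : InvOn Θ Ψ U V := ⟨hΘΨ, hΨΘ⟩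
  refine ⟨U, ρ, V, hρ, ⟨⟨{u | u.2 < r ∧ (Ψ u).2 < ρ}, ?_, ?_⟩, fun x => ?_⟩,
    ⟨⟨univ, isOpen_univ, ?_⟩, fun x => ⟨le_rfl, hρ⟩⟩,
    ⟨hinv.bijOn hmapU hmapV, smoothOnCylinder_of_lift h.fst.smooth h.snd.smooth hΨ U, Θ, hinv,
      smoothOnCylinder_of_lift hPQ.fst.smooth hPQ.snd.smooth hΘ V⟩,
    fun p hp => ⟨hp.1.1, hp.1.2.trans_le hrR⟩⟩
  · exact (isOpen_lt continuous_snd continuous_const).inter (isOpen_lt hΨ2 continuous_const)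
  · ext u
    constructor
    · rintro ⟨⟨h1, h2⟩, h3⟩
      exact ⟨⟨h2, h3⟩, mem_univ _, h1, h2.le.trans (hrR.trans hRM)⟩
    · rintro ⟨⟨h2, h3⟩, -, h1, -⟩
      exact ⟨⟨h1, h2⟩, h3⟩
  · obtain ⟨t, rfl⟩ := QuotientAddGroup.mk_surjective x
    refine ⟨⟨le_rfl, hr0⟩, ?_⟩
    have := hΨ (t, 0)
    rw [h.snd_zero] at this
    change (Ψ (cylinderCover a (t, 0))).2 < ρ
    rw [this]
    exact hρ
  · ext v
    simp [V]

namespace BilliardTable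

variable (B : BilliardTable) {k : ℕ} {A : ℝ × ℝ → ℝ}

/-- The conjugation relations in terms of the position and the angle of a collision. -/
theorem eventually_conjugation (hA : B.HasChordAngle A) {F G : ℝ × ℝ → ℝ}
    (h : StripCoord B.ℓ 1 F G)
    (hF : (fun p => F (nextPoint A p) - F (p.1, A p) - G (p.1, A p)) =O[stripNhdsPos]
      fun p => p.2 ^ (2 * k + 2))
    (hG : (fun p => G (nextPoint A p) - G (p.1, A p)) =O[stripNhdsPos]
      fun p => p.2 ^ (2 * k + 2)) :
    ∃ C > 0, ∀ᶠ q in stripNhdsPos, ∃ p, B.billiardMap (cylinderCover B.ℓ q) = cylinderCover B.ℓ p ∧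
      |F p - (F q + G q)| ≤ C * G q ^ (2 * k + 2) ∧ |G p - G q| ≤ C * G q ^ (2 * k + 2) := by
  have hℓ := B.length_pos
  obtain ⟨D, hD, hD1, -⟩ := hA.isChordAngle.exists_inverse hℓ
  have hDp := hD.tendsto_angle_pos hℓ
  -- The displacement, the angle and the new coordinate `G` are comparable near the boundary, so
  -- errors in `d` become errors in `G`.
  have hDO : (fun q => D q ^ (2 * k + 2)) =O[stripNhdsPos] fun q => G q ^ (2 * k + 2) :=
    ((hD.isBigO_snd hℓ).trans (h.snd.snd_isBigO hℓ h.snd_zero h.dy_pos)).pow _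
  obtain ⟨C₁, hC₁, h₁⟩ := ((hF.comp_tendsto hDp).trans hDO).exists_pos
  obtain ⟨C₂, hC₂, h₂⟩ := ((hG.comp_tendsto hDp).trans hDO).exists_pos
  refine ⟨max C₁ C₂, lt_max_of_lt_left hC₁, ?_⟩
  filter_upwards [h₁.bound, h₂.bound, stripNhdsPos_le hD1, hDp.eventually hA.billiardMap_eq] with
    q b₁ b₂ e eb
  simp only [Function.comp] at b₁ b₂ eb
  rw [e] at b₁ b₂ eb
  have hev : Even (2 * k + 2) := ⟨k + 1, by ring⟩
  rw [Real.norm_eq_abs, Real.norm_of_nonneg (hev.pow_nonneg _)] at b₁ b₂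
  refine ⟨_, eb, ?_, ?_⟩
  · rw [← sub_sub]
    exact b₁.trans (mul_le_mul_of_nonneg_right (le_max_left _ _) (hev.pow_nonneg _))
  · exact b₂.trans (mul_le_mul_of_nonneg_right (le_max_right _ _) (hev.pow_nonneg _))

theorem exists_isLazutkinChange (hA : B.HasChordAngle A) {x₀ : ℝ → ℝ} {X Y : ℕ → ℝ → ℝ}
    (hx : ContDiff ℝ ∞ x₀) (hX : ∀ j, ContDiff ℝ ∞ (X j)) (hY : ∀ j, ContDiff ℝ ∞ (Y j))
    (hxp : ∀ s, x₀ (s + B.ℓ) = x₀ s + 1) (hXp : ∀ j s, X j (s + B.ℓ) = X j s)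
    (hYp : ∀ j s, Y j (s + B.ℓ) = Y j s)
    (h : StripCoord B.ℓ 1 (lazutkinFst k x₀ X) (lazutkinSnd k Y))
    (hF : (fun p => lazutkinFst k x₀ X (nextPoint A p) - lazutkinFst k x₀ X (p.1, A p) -
        lazutkinSnd k Y (p.1, A p)) =O[stripNhdsPos] (fun p => p.2 ^ (2 * k + 2)))
    (hG : (fun p => lazutkinSnd k Y (nextPoint A p) - lazutkinSnd k Y (p.1, A p))
        =O[stripNhdsPos] fun p => p.2 ^ (2 * k + 2)) :
    ∃ Ψ : AddCircle B.ℓ × ℝ → UnitAddCircle × ℝ, B.IsLazutkinChange k Ψ := by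
  have hℓ := B.length_pos
  have px : Function.Periodic (fun t => (x₀ t : UnitAddCircle)) B.ℓ := fun t => by
    simp [hxp]
  have pX : ∀ j, Function.Periodic (X j) B.ℓ := hXp
  have pY : ∀ j, Function.Periodic (Y j) B.ℓ := hYp
  obtain ⟨C, hC, hconj⟩ := B.eventually_conjugation hA h hF hG
  obtain ⟨R, hR, hconjR⟩ := eventually_stripNhdsPos_iff.1 hconj
  set Ψ := B.lazutkinForm k px.lift (fun j => (pX j).lift) (fun j => (pY j).lift)
  have hΨ : ∀ p, Ψ (cylinderCover B.ℓ p) =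
      cylinderCover 1 (lazutkinFst k x₀ X p, lazutkinSnd k Y p) :=
    B.lazutkinForm_cover fun t => rfl
  obtain ⟨U, ε, V, hε, hU, hV, hdiff, hUR⟩ := h.exists_diffeo hℓ one_pos hΨ
    (lt_min hR Real.pi_pos) (min_le_right R Real.pi)
  refine ⟨Ψ, ⟨px.lift, fun j => (pX j).lift, fun j => (pY j).lift,
    (contDiff_toCircle_coe hx).contDiffOn, hX, hY, rfl⟩, U, ε, V, hε, hU, hV, hdiff,
    -- Any positive `δ` would do, since `U` already lies where the estimates hold. Points with angle
    -- `0` are fixed and are checked directly.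
    C, hC, 1, one_pos, fun u hu _ _ => ?_⟩
  obtain ⟨hu1, hu2⟩ := hUR u hu
  obtain ⟨⟨s, y⟩, rfl⟩ := cylinderCover_surjective B.ℓ u
  rcases hu1.eq_or_lt with h0 | hpos
  · have h0' : y = 0 := h0.symm
    subst h0'
    have e : B.billiardMap (cylinderCover B.ℓ (s, 0)) = cylinderCover B.ℓ (s, 0) :=
      B.billiardMap_zero _
    rw [e, hΨ, lazutkinSnd_zero]
    simp [cylinderCover]
  · obtain ⟨p, e, h1, h2⟩ := hconjR s y hpos (hu2.trans_le (min_le_left _ _))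
    rw [e, hΨ, hΨ]
    refine ⟨?_, h2⟩
    simp only [cylinderCover]
    rw [← AddCircle.coe_add, ← AddCircle.coe_sub]
    exact (QuotientAddGroup.norm_mk_le_norm).trans h1

end BilliardTable

end

/-! ### The equivalence -/

theorem mainTheorem4 (B : BilliardTable) (k : ℕ) (hk : 0 < k) :
    (∃ Ψ : AddCircle B.ℓ × ℝ → UnitAddCircle × ℝ, B.IsLazutkinChange k Ψ) ↔
      ∃ ε > (0 : ℝ), ∃ Z : UnitAddCircle → ℝ → ℂ, B.IsAngularFunction k ε Z := by
  obtain ⟨A, hA⟩ := B.exists_hasChordAngle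
  have hℓ := B.length_pos
  constructor
  · rintro ⟨Ψ, hΨ⟩
    obtain ⟨x₀, X, Y, hXY, hX, hY⟩ :=
      B.exists_stripCoord_of_isLazutkinChange hA.isChordAngle hA.billiardMap_eq hΨ
    obtain ⟨S, hS, hSx, hSe, hdef⟩ := exists_even_of_conjugation hℓ hA.isChordAngle hXY
      lazutkinFst_neg lazutkinSnd_neg hX hY
    obtain ⟨S, hS, hSx, hSe, hSb, hdef⟩ := exists_fixed_base hℓ hS hSx hSe hdef
    exact B.exists_isAngularFunction hA hS hSx hSe hSb hdef
  · rintro ⟨ε, hε, Z, hZ⟩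
    obtain ⟨S, hS, hSx, hSe, hdef⟩ := B.exists_lift_of_isAngularFunction hA hε hZ
    obtain ⟨P, Q, hPQ, hPe, hQo, hP, hQ⟩ :=
      exists_conjugation hℓ hA.isChordAngle hS hSx hSe hdef
    obtain ⟨x₀, X, Y, ⟨hx, hX, hY⟩, ⟨hxp, hXp, hYp⟩, h, hF, hG⟩ :=
      exists_lazutkin_of_conjugation hk hℓ hA.isChordAngle hPQ hPe hQo hP hQ
    exact B.exists_isLazutkinChange hA hx hX hY hxp hXp hYp h hF hG
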